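/- **Setting.** Let $\mathcal A$ be a unitary modular anyon model (finite label set with vacuum $1$ and antiparticles $a\mapsto\bar a$, fusion multiplicities $N_{ab}^c$, unitary $F$- and $R$-symbols satisfying the pentagon and hexagon equations, rigidity, non-degenerate braiding) that is *non-cyclic*: there is no sequence $x_1,\dots,x_m,x_{m+1}=x_1$ with $x_1\ne 1$ and $N_{x_i\bar x_i}^{x_{i+1}}>0$ for all $i$. Let $D$ be the diameter of the fusion graph (directed edges $a\to b$ for $a\neq1$, $N_{a\bar a}^b>0$), that is, the length of a longest directed path. Let $Q$ be odd, $n\ge1$, $a\ge3$, $Q\ge4(a+2)$, $b>2[4(3D+1)Q+1]$, $U=b^2$, $f_nb=4(3D+1)Q+1$, $f_cb=b-f_nb$. Anyons live on the sites of a $Q^n\times Q^n$ square lattice on a torus, starting in an arbitrary ground state. A level-$k$ colony is one of the $Q^k\times Q^k$ squares that tile the lattice; level-$0$ colonies are single sites. **Noise.** In time step $t=0,1,2,\dots$, for a given set $\mathcal E$ of errors, first every charge error $(e,t,c)\in\mathcal E$ (at most one per edge $e$ and time, $c\neq1$) creates from the vacuum a pair $c,\bar c$ at the two ends of $e$ and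 fuses it with the charges there, in an arbitrary given order of the edges. At time $t+\frac12$ the total charge of every site is projected, with outcome $c(r,t+\frac12)$, and a syndrome $s(r,t)$ is reported; it equals $c(r,t+\frac12)$, except at sites with a measurement error at time $t+\frac12$ (at most one per site and time), where a different charge, depending on the true one, is reported. Then the transition rules below are applied, and at time $t+1$ the total charge of every site is again projected, with outcome $c(r,t+1)$. A charge history is possible if it has positive probability. **Classification of errors.** Charge errors are located at the midpoints of edges and integer times, measurement errors at sites and half-integer times. Two sets of errors are $(l,m,d)$-linked if some half-open box of size $l\times m\times d$ meets both, otherwise separated. A level-$0$ candidate is a nonempty set of errors in $\mathcal E$, all charge errors or all measurement errors, at a single time and in a box $[x,x+1]\times[y,y+1]$ with $(x,y)$ a lattice site; it is a level-$0$ actual error if it is $(a,a,b)$-separated from the rest of $\mathcal E$. For $k\ge1$, with $E_{k-1}$ the union of all actual errors of level less than $k$, a level-$k$ candidate is a nonempty $S\subseteq\mathcal E\setminus E_{k-1}$ that fits in a half-open $Q^k\times Q^k\times U^k$ box and contains two disjoint level-$(k-1)$ candidates that are $(aQ^{k-1},aQ^{k-1},bU^{k-1})$-linked. It is a level-$k$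 actual error if, moreover, it does not contain two level-$k$ candidates that are $(4(a+2)Q^{k-1},4(a+2)Q^{k-1},4(b+2)U^{k-1})$-separated, and it is $(aQ^k,aQ^k,bU^k)$-separated from $\mathcal E\setminus(S\cup E_{k-1})$. It is assumed that every error belongs to an actual error of some level. **Decoder.** A level-$k$ rule ($0\le k<n$) acts at the end of each working period of $U^k$ time steps on a level-$k$ colony whose (charge) level-$k$ syndrome is nontrivial. It moves that charge from the central site of the colony, along a straight line, to the centre of an adjacent colony, or does nothing. (If the anyon at a site does not have the charge $q$ to be displaced, a pair $q,\bar q$ is created there and $q$ is displaced.) The displacements of one level are simultaneous, and anyons that meet at a site are fused. Level-$0$ syndromes are the reported charges. The level-$k$ syndromes are obtained from the level-$(k-1)$ ones by dividing a working period into $b$ bins of $b$ level-$(k-1)$ working periods: a bin is nontrivial if at least $f b$ of its reports are nontrivial, and it then declares the most frequent nontrivial charge; the last nontrivial bin is reported if at least $fb$ bins are nontrivial, and otherwise the vacuum. Here $f=f_c$ for the syndrome of the colony itself and $f=f_n$ for the syndromes it receives from its neighbours. The direction depends on the position $(X,Y)$, $0\le X,Y<Q$, of the colony in its level-$(k+1)$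 colony and on which of the neighbours N, E, S, W, NE, NW, SE, SW report nontrivial syndromes; "stop" means that nothing is done, and the first applicable clause decides. If $X=0$ (West border): NW, W or SW nontrivial $\Rightarrow$ move W. If $Y=0$ (South border): SW, S or SE nontrivial $\Rightarrow$ move S. Then, with $H=(Q-1)/2$: - $X<H,\ Y<H$: S, W or SW $\Rightarrow$ stop; N or NW $\Rightarrow$ move N; E or SE $\Rightarrow$ move E; else move N. - $X<H,\ Y=H$: S, W, N, SW or NW $\Rightarrow$ stop; else move E. - The remaining six regions are obtained by successive clockwise rotations by $90^\circ$: $X<H,Y>H$ (W, N or NW: stop; E or NE: E; S or SW: S; else E), $X=H,Y>H$ (W, N, E, NW or NE: stop; else S), $X>H,Y>H$ (N, E or NE: stop; S or SE: S; W or NW: W; else S), $X>H,Y=H$ (N, E, S, NE or SE: stop; else W), $X>H,Y<H$ (E, S or SE: stop; W or SW: W; N or NE: N; else W), $X=H,Y<H$ (E, S, W, SE or SW: stop; else N). - $X=Y=H$: no move. **Trajectories.** For a collection $\mathfrak A$ of actual errors, the causal region at time $t$ of $E$ is the set of space-time points $(r,t')$, $t'\le t$ ($t'$ integer or half-integer),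 at which removing $E$ from some subcollection of $\mathfrak A$ changes the probability distribution of the charge at $r$. The causally-linked cluster of $E$ at time $t$ consists of the actual errors of $\mathfrak A$ joined to $E$ by a chain of actual errors whose consecutive causal regions intersect; its level is the maximal level of its members. The restricted error set of $E$ consists of $E$ and all actual errors of lower level, and the restricted cluster of $E$ is its cluster within that set. For a charge history, an error in step $t_0$ has at time $t_0$ its own sites as locations; a location at time $t$ remains one at time $t+1$ if its charge is then nontrivial; and if at time $t+\frac12$ a rule of level $k$, at most the level of the error's cluster, moves a charge from a site that was a location at a time in $(t-U^k,t]$, then each of the source and the target of the displacement is a location at time $t+1$ if its charge is then nontrivial. The trajectory domain up to time $t$ of a collection $\mathcal C$ of errors is the set of all $(r,t')$, $t'\le t$, such that, after the removal of some subcollection of $\mathcal C$, $r$ is a location at time $t'$ of a remaining error of $\mathcal C$ for some possible charge history. The level-$k$ coarse-grained cluster at time $t$ is the union of the clusters at time $t$ of all actual errors of level at least $k$. **Statement.** For every initial ground state, every order of the edges in the noise steps and every error set $\mathcal E$ as above: 1. ($0$-locality) For every level-$0$ actual error $E$ and every time $t$, the trajectory domain up to time $t$ of the restricted cluster of $E$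 at time $t$, with respect to the restricted error set of $E$, lies in a block of $2\times2$ sites. 2. ($0$-faithfulness) If no actual error overlaps with a site and its eight neighbours in the time step $[\tau,\tau+1)$, then there is a time $t_c$ with $\tau\le t_c\le(1-f_c)bU^{-1}+\tau$ such that, for all $t\in[t_c,\tau+1)$, every point at time $t$ of the trajectory domain of the level-$0$ coarse-grained cluster at time $t_c$ that lies in the colony (the site) is at its centre. 3. ($0$-successfulness) Call a level-$0$ rule applied at $r$ active if the syndrome at $r$ is nontrivial and the syndromes reported at $r$ and at its eight neighbours are the true charges. For every possible charge history, if a level-$0$ rule is active at $r$ in step $\tau$, and in the steps $\tau,\dots,\tau+D-1$ there are no actual errors and no rules of level higher than $0$ on $r$ and its eight neighbours, then within at most $D$ successive applications, in each of which it is active, the rule is successful: it leaves the vacuum at $r$, that is, right after the time step the site $r$ contains only the fusion product of the charges that level-$0$ rules of other sites moved into $r$ in that same step (the vacuum, if there are none). 4. For every level-$0$ actual error $E$ of $\mathcal E$, if only the errors of $E$ occur, there is a fixed block of $2\times2$ sites such that in every possible charge history all nontrivial charges are in this block at all times, and all anyons are gone two time steps after they appear: there are no anyons at any time $\ge t+2$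 if $E$ consists of charge errors at time $t$, and none at any time $\ge t+3$ if $E$ consists of measurement errors at time $t+\frac12$ (which first create anyons at time $t+1$). -/

import Mathlib

namespace AnyonDecoder

open scoped Matrix ComplexConjugate

section Definitions

open scoped Classical

/-! ### Anyon models -/

/-- The numerical data of an anyon model with finite label set `A`: the vacuum, the antiparticle
map, the fusion multiplicities `N a b c` (of the channel `a × b → c`), and the `F`- and
`R`-symbols. Fusion vertices `a × b → c` are numbered `0, …, N a b c - 1`.

`F a b c d e α β f μ ν` is the coefficient of the tree
`(b c → f, μ), (a f → d, ν)` in the expansion of the tree `(a b → e, α), (e c → d, β)`;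
`R a b c μ ν` is the coefficient of the vertex `(b a → c, ν)` in the exchanged vertex
`(a b → c, μ)`. -/
structure AnyonData (A : Type*) where
  vac : A
  dual : A → A
  N : A → A → A → ℕ
  F : A → A → A → A → A → ℕ → ℕ → A → ℕ → ℕ → ℂ
  R : A → A → A → ℕ → ℕ → ℂ

variable {A : Type*} [Fintype A]

/-- The data define a unitary modular anyon model: unit and antiparticle rules, unitarity of the
`F`- and `R`-moves, the pentagon and the two hexagon equations, the unit normalization of the
`F`-symbols, rigidity, and non-degeneracy of the braiding. -/
structure AnyonData.IsModular (𝒜 : AnyonData A) : Prop where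
  dual_dual : ∀ a, 𝒜.dual (𝒜.dual a) = a
  N_vac_left : ∀ a b, 𝒜.N 𝒜.vac a b = if a = b then 1 else 0
  N_vac_right : ∀ a b, 𝒜.N a 𝒜.vac b = if a = b then 1 else 0
  N_dual : ∀ a b, 𝒜.N a b 𝒜.vac = if b = 𝒜.dual a then 1 else 0
  F_unitary_left : ∀ a b c d e e' α β α' β',
    α < 𝒜.N a b e → β < 𝒜.N e c d → α' < 𝒜.N a b e' → β' < 𝒜.N e' c d →
    ∑ f, ∑ μ ∈ Finset.range (𝒜.N b c f), ∑ ν ∈ Finset.range (𝒜.N a f d),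
      𝒜.F a b c d e α β f μ ν * conj (𝒜.F a b c d e' α' β' f μ ν)
      = if e = e' ∧ α = α' ∧ β = β' then 1 else 0
  F_unitary_right : ∀ a b c d f f' μ ν μ' ν',
    μ < 𝒜.N b c f → ν < 𝒜.N a f d → μ' < 𝒜.N b c f' → ν' < 𝒜.N a f' d →
    ∑ e, ∑ α ∈ Finset.range (𝒜.N a b e), ∑ β ∈ Finset.range (𝒜.N e c d),
      conj (𝒜.F a b c d e α β f μ ν) * 𝒜.F a b c d e α β f' μ' ν'
      = if f = f' ∧ μ = μ' ∧ ν = ν' then 1 else 0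
  R_unitary_left : ∀ a b c μ μ', μ < 𝒜.N a b c → μ' < 𝒜.N a b c →
    ∑ ν ∈ Finset.range (𝒜.N b a c), 𝒜.R a b c μ ν * conj (𝒜.R a b c μ' ν)
      = if μ = μ' then 1 else 0
  R_unitary_right : ∀ a b c ν ν', ν < 𝒜.N b a c → ν' < 𝒜.N b a c →
    ∑ μ ∈ Finset.range (𝒜.N a b c), conj (𝒜.R a b c μ ν) * 𝒜.R a b c μ ν'
      = if ν = ν' then 1 else 0
  F_vac_left : ∀ a b c α μ, α < 𝒜.N a b c → μ < 𝒜.N a b c →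
    𝒜.F 𝒜.vac a b c a 0 α c μ 0 = if α = μ then 1 else 0
  F_vac_mid : ∀ a b c β ν, β < 𝒜.N a b c → ν < 𝒜.N a b c →
    𝒜.F a 𝒜.vac b c a 0 β b 0 ν = if β = ν then 1 else 0
  F_vac_right : ∀ a b c α ν, α < 𝒜.N a b c → ν < 𝒜.N a b c →
    𝒜.F a b 𝒜.vac c c α 0 b 0 ν = if α = ν then 1 else 0
  rigid : ∀ a, 𝒜.F a (𝒜.dual a) a a 𝒜.vac 0 0 𝒜.vac 0 0 ≠ 0
  pentagon : ∀ a b c d e f g h k α β γ δ κ l,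
    α < 𝒜.N a b f → β < 𝒜.N f c g → γ < 𝒜.N g d e →
    δ < 𝒜.N c d h → κ < 𝒜.N b h k → l < 𝒜.N a k e →
    ∑ ε ∈ Finset.range (𝒜.N f h e), 𝒜.F f c d e g β γ h δ ε * 𝒜.F a b h e f α ε k κ l
      = ∑ m, ∑ σ ∈ Finset.range (𝒜.N b c m), ∑ ρ ∈ Finset.range (𝒜.N a m g),
        ∑ τ ∈ Finset.range (𝒜.N m d k),
          𝒜.F a b c g f α β m σ ρ * 𝒜.F a m d e g ρ γ k τ l * 𝒜.F b c d k m σ τ h δ κ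
  hexagon : ∀ a b c d e g α β σ τ,
    α < 𝒜.N a b e → β < 𝒜.N e c d → σ < 𝒜.N c a g → τ < 𝒜.N b g d →
    ∑ f, ∑ μ ∈ Finset.range (𝒜.N b c f), ∑ ν ∈ Finset.range (𝒜.N a f d),
      ∑ ν' ∈ Finset.range (𝒜.N f a d),
        𝒜.F a b c d e α β f μ ν * 𝒜.R a f d ν ν' * 𝒜.F b c a d f μ ν' g σ τ
      = ∑ α' ∈ Finset.range (𝒜.N b a e), ∑ σ' ∈ Finset.range (𝒜.N a c g),
          𝒜.R a b e α α' * 𝒜.F b a c d e α' β g σ' τ * 𝒜.R a c g σ' σ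
  hexagon_inv : ∀ a b c d e g α β σ τ,
    α < 𝒜.N a b e → β < 𝒜.N e c d → σ < 𝒜.N c a g → τ < 𝒜.N b g d →
    ∑ f, ∑ μ ∈ Finset.range (𝒜.N b c f), ∑ ν ∈ Finset.range (𝒜.N a f d),
      ∑ ν' ∈ Finset.range (𝒜.N f a d),
        𝒜.F a b c d e α β f μ ν * conj (𝒜.R f a d ν' ν) * 𝒜.F b c a d f μ ν' g σ τ
      = ∑ α' ∈ Finset.range (𝒜.N b a e), ∑ σ' ∈ Finset.range (𝒜.N a c g),
          conj (𝒜.R b a e α' α) * 𝒜.F b a c d e α' β g σ' τ * conj (𝒜.R c a g σ σ')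
  nondegenerate : ∀ x, x ≠ 𝒜.vac → ∃ a c, ∃ μ < 𝒜.N x a c, ∃ ν < 𝒜.N x a c,
    ∑ κ ∈ Finset.range (𝒜.N a x c), 𝒜.R x a c μ κ * 𝒜.R a x c κ ν ≠ if μ = ν then 1 else 0

/-- There is no cyclic sequence `x₁, …, xₙ, x₁` of charges with `x₁ ≠ 1` in which every charge is
a possible outcome of fusing its predecessor with the antiparticle of the predecessor. -/
def AnyonData.NonCyclic (𝒜 : AnyonData A) : Prop :=
  ¬ ∃ (n : ℕ) (x : ℕ → A), 1 ≤ n ∧ x 0 ≠ 𝒜.vac ∧ x n = x 0 ∧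
    ∀ i < n, 0 < 𝒜.N (x i) (𝒜.dual (x i)) (x (i + 1))

/-- The diameter of the fusion graph: the maximal number of successive fusions of a nontrivial
particle with its antiparticle that can be needed before the outcome is the vacuum, i.e. the
length of a longest directed path in the graph with an edge from `a ≠ 1` to `b` whenever
`N a ā b > 0`. -/
noncomputable def AnyonData.diam (𝒜 : AnyonData A) : ℕ :=
  sSup {l | ∃ x : ℕ → A, ∀ i < l, x i ≠ 𝒜.vac ∧ 0 < 𝒜.N (x i) (𝒜.dual (x i)) (x (i + 1))}

/-- A common bound for the numbering of all fusion vertices. -/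
abbrev AnyonData.Idx (𝒜 : AnyonData A) : Type := Fin (∑ a, ∑ b, ∑ c, 𝒜.N a b c)

/-! ### Parameters and lattice -/

/-- The parameters of the lattice (of linear size `Q ^ n`), of the decoder, and of the
classification of errors. -/
structure Params where
  Q : ℕ
  n : ℕ
  a : ℕ
  b : ℕ
  n_pos : 0 < n
  Q_odd : Odd Q
  three_le_a : 3 ≤ a
  le_Q : 4 * (a + 2) ≤ Q

namespace Params

/-- Linear size of the lattice. -/
def L (P : Params) : ℕ := P.Q ^ P.n

/-- Duration of a working period. -/
def U (P : Params) : ℕ := P.b ^ 2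

instance (P : Params) : NeZero P.L :=
  ⟨pow_ne_zero _ (by have := P.le_Q; omega)⟩

/-- The sites of the toroidal lattice. -/
abbrev Site (P : Params) : Type := ZMod P.L × ZMod P.L

/-- `(r, false)` is the edge from `r` to its eastern neighbour, `(r, true)` the edge from `r` to its
northern neighbour. -/
abbrev Edge (P : Params) : Type := P.Site × Bool

/-- The site `r + m v`. -/
def shift (P : Params) (r : P.Site) (m : ℕ) (v : ℤ × ℤ) : P.Site :=
  (r.1 + ((m * v.1 : ℤ) : ZMod P.L), r.2 + ((m * v.2 : ℤ) : ZMod P.L))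

def tail (P : Params) (e : P.Edge) : P.Site := e.1

def head (P : Params) (e : P.Edge) : P.Site :=
  P.shift e.1 1 (if e.2 then (0, 1) else (1, 0))

/-- The edge between `r` and `r + v`, for a unit vector `v`. -/
def edgeAt (P : Params) (r : P.Site) (v : ℤ × ℤ) : P.Edge :=
  if v = (1, 0) then (r, false)
  else if v = (-1, 0) then (P.shift r 1 v, false)
  else if v = (0, 1) then (r, true)
  else (P.shift r 1 v, true)

/-- The eight neighbours and the origin. -/
def nbhd : Set (ℤ × ℤ) := {v | |v.1| ≤ 1 ∧ |v.2| ≤ 1}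

/-- `r` is the physical site at the centre of its level-`k` colony. Level-`k` colonies and the sites
of the level-`k` renormalized lattice are referred to by these centres. -/
def IsCentre (P : Params) (k : ℕ) (r : P.Site) : Prop :=
  r.1.val % P.Q ^ k = (P.Q ^ k - 1) / 2 ∧ r.2.val % P.Q ^ k = (P.Q ^ k - 1) / 2

/-- `r` and `s` lie in the same level-`k` colony. -/
def SameColony (P : Params) (k : ℕ) (r s : P.Site) : Prop :=
  r.1.val / P.Q ^ k = s.1.val / P.Q ^ k ∧ r.2.val / P.Q ^ k = s.2.val / P.Q ^ k

/-- The `2 × 2` block of level-`k` colonies whose south-west colony is the one of `r`. -/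
def block (P : Params) (k : ℕ) (r : P.Site) : Set P.Site :=
  {s | ∃ i j : ℤ, (i = 0 ∨ i = 1) ∧ (j = 0 ∨ j = 1) ∧
    P.SameColony k (P.shift r (P.Q ^ k) (i, j)) s}

/-! Anyons on the torus are described in the fusion basis of a closed chain that visits the columns
one after the other, each from south to north. Every site carries two consecutive positions of the
chain: `(r, false)` holds the resident anyon, `(r, true)` holds anyons that have arrived at `r` and
have not been fused yet with the resident one. -/

/-- Positions of the chain. -/
abbrev Slot (P : Params) : Type := P.Site × Bool

/-- The cyclic successor in the chain. -/
def next (P : Params) (p : P.Slot) : P.Slot :=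
  if p.2 then ((if p.1.2 = -1 then p.1.1 + 1 else p.1.1, p.1.2 + 1), false) else (p.1, true)

/-- Vertical edges that close a column around the torus. -/
def IsWrap (P : Params) (e : P.Edge) : Prop := e.2 = true ∧ e.1.2 = -1

/-- The endpoint of an edge from which the other one is reached along the chain. -/
noncomputable def first (P : Params) (e : P.Edge) : P.Site :=
  if P.IsWrap e then P.head e else P.tail e

/-- The number of sites by which the endpoints of an edge are apart in the chain. -/
noncomputable def sep (P : Params) (e : P.Edge) : ℕ :=
  if P.IsWrap e then P.L - 1 else if e.2 then 1 else P.L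

end Params

/-! ### States of anyons on the torus

A basis state assigns to every position `p` of the chain the label `x p` of the chain line entering
`p`, the charge `a p` at `p`, and the vertex `x p × a p → x (next p)`. -/

abbrev Config (𝒜 : AnyonData A) (P : Params) : Type _ :=
  (P.Slot → A) × (P.Slot → A) × (P.Slot → 𝒜.Idx)

def Config.Valid {𝒜 : AnyonData A} {P : Params} (s : Config 𝒜 P) : Prop :=
  ∀ p, (s.2.2 p : ℕ) < 𝒜.N (s.1 p) (s.2.1 p) (s.1 (P.next p))

/-- Operators (and density operators), as matrices in the basis of configurations. -/
abbrev Op (𝒜 : AnyonData A) (P : Params) : Type _ := Matrix (Config 𝒜 P) (Config 𝒜 P) ℂ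

/-- A local operator on two adjacent charges that preserves their total charge: `G a b e κ a' b' κ'`
is the amplitude from the vertex `(a b → e, κ)` to the vertex `(a' b' → e, κ')`. -/
abbrev PairOp (A : Type*) : Type _ := A → A → A → ℕ → A → A → ℕ → ℂ

/-- The action of a two-anyon operator on the adjacent positions `p`, `next p`, through `F`-moves. -/
noncomputable def lift (𝒜 : AnyonData A) (P : Params) (G : PairOp A) (p : P.Slot) : Op 𝒜 P :=
  fun s' s =>
    let q := P.next p
    if s.Valid ∧ s'.Valid ∧ (∀ u, u ≠ q → s'.1 u = s.1 u) ∧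
        (∀ u, u ≠ p → u ≠ q → s'.2.1 u = s.2.1 u ∧ s'.2.2 u = s.2.2 u) then
      ∑ e, ∑ κ ∈ Finset.range (𝒜.N (s.2.1 p) (s.2.1 q) e),
        ∑ κ' ∈ Finset.range (𝒜.N (s'.2.1 p) (s'.2.1 q) e),
        ∑ m ∈ Finset.range (𝒜.N (s.1 p) e (s.1 (P.next q))),
          𝒜.F (s.1 p) (s.2.1 p) (s.2.1 q) (s.1 (P.next q)) (s.1 q) (s.2.2 p) (s.2.2 q) e κ m *
          G (s.2.1 p) (s.2.1 q) e κ (s'.2.1 p) (s'.2.1 q) κ' *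
          conj (𝒜.F (s.1 p) (s'.2.1 p) (s'.2.1 q) (s.1 (P.next q)) (s'.1 q)
            (s'.2.2 p) (s'.2.2 q) e κ' m)
    else 0

/-- The exchange of two adjacent anyons. -/
noncomputable def exchange (𝒜 : AnyonData A) : PairOp A :=
  fun a b e κ a' b' κ' => if a' = b ∧ b' = a then 𝒜.R a b e κ κ' else 0

/-- The monodromy of the anyon at `p` with the chain line entering `p`: the anyon is carried once
around the torus in the direction of the columns. -/
noncomputable def wind (𝒜 : AnyonData A) (P : Params) (p : P.Slot) : Op 𝒜 P :=
  fun s' s =>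
    if s.Valid ∧ s'.Valid ∧ s'.1 = s.1 ∧ s'.2.1 = s.2.1 ∧ (∀ u, u ≠ p → s'.2.2 u = s.2.2 u) then
      ∑ l ∈ Finset.range (𝒜.N (s.2.1 p) (s.1 p) (s.1 (P.next p))),
        𝒜.R (s.1 p) (s.2.1 p) (s.1 (P.next p)) (s.2.2 p) l *
        𝒜.R (s.2.1 p) (s.1 p) (s.1 (P.next p)) l (s'.2.2 p)
    else 0

/-- Carries the anyon at `p` past the following `d` positions of the chain, along a straight line in
the plane of the lattice: on one side of the positions in its own column and on the other side of
those in the next column. If `wrap` holds, the line first leaves the column of `p` at its southern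
end and re-enters at its northern end. -/
noncomputable def carry (𝒜 : AnyonData A) (P : Params) (p : P.Slot) (wrap : Prop) : ℕ → Op 𝒜 P
  | 0 => if wrap then (wind 𝒜 P p)ᴴ else 1
  | d + 1 =>
    (if ¬ wrap ∧ (P.next^[d + 1] p).1.1 = p.1.1 then lift 𝒜 P (exchange 𝒜) (P.next^[d] p)
      else (lift 𝒜 P (exchange 𝒜) (P.next^[d] p))ᴴ) * carry 𝒜 P p wrap d

/-- The action of a two-anyon operator on the anyons at `p` and at the `d`-th position after `p`. -/
noncomputable def liftAlong (𝒜 : AnyonData A) (P : Params) (G : PairOp A) (p : P.Slot)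
    (wrap : Prop) (d : ℕ) : Op 𝒜 P :=
  (carry 𝒜 P p wrap (d - 1))ᴴ * lift 𝒜 P G (P.next^[d - 1] p) * carry 𝒜 P p wrap (d - 1)

/-! Processes in which anyons on a position are fused are families of two-anyon operators, indexed by
the resulting charges and by the fusion vertices (which are not observed). -/

abbrev KIdx (𝒜 : AnyonData A) : Type _ := A × A × 𝒜.Idx × 𝒜.Idx

/-- Creates from the vacuum a pair `u`, `ū` between two anyons `a`, `b`, and fuses `u` with `a` and
`ū` with `b`. -/
noncomputable def pairKraus (𝒜 : AnyonData A) (u : A) (k : KIdx 𝒜) : PairOp A :=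
  fun a b e κ a' b' κ' =>
    let ū := 𝒜.dual u
    if a' = k.1 ∧ b' = k.2.1 ∧ (k.2.2.1 : ℕ) < 𝒜.N a u a' ∧ (k.2.2.2 : ℕ) < 𝒜.N ū b b' then
      ∑ β ∈ Finset.range (𝒜.N a' ū a),
        conj (𝒜.F a u ū a a' k.2.2.1 β 𝒜.vac 0 0) * 𝒜.F a' ū b e a β κ b' k.2.2.2 κ'
    else 0

/-- Moves the second anyon onto the first one and fuses the two. -/
noncomputable def ontoFirst (𝒜 : AnyonData A) (k : KIdx 𝒜) : PairOp A :=
  fun _ _ e κ a' b' κ' =>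
    if a' = e ∧ b' = 𝒜.vac ∧ κ' = 0 ∧ k.1 = e ∧ k.2.1 = 𝒜.vac ∧
      (k.2.2.1 : ℕ) = κ ∧ (k.2.2.2 : ℕ) = 0 then 1 else 0

/-- Moves the first anyon onto the second one and fuses the two. -/
noncomputable def ontoSecond (𝒜 : AnyonData A) (k : KIdx 𝒜) : PairOp A :=
  fun _ _ e κ a' b' κ' =>
    if a' = 𝒜.vac ∧ b' = e ∧ κ' = 0 ∧ k.1 = 𝒜.vac ∧ k.2.1 = e ∧
      (k.2.2.1 : ℕ) = 0 ∧ (k.2.2.2 : ℕ) = κ then 1 else 0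

/-- Displaces a charge `q` from the first anyon to the second one (if `fwd`), or from the second to
the first one. If the anyon to be displaced has not the charge `q`, a pair `q`, `q̄` is created from
the vacuum, `q̄` is put at the source and `q` is displaced. -/
noncomputable def moveKraus (𝒜 : AnyonData A) (q : A) (fwd : Prop) (k : KIdx 𝒜) : PairOp A :=
  fun a b =>
    if fwd then
      (if a = q then ontoSecond 𝒜 k a b else pairKraus 𝒜 (𝒜.dual q) k a b)
    else
      (if b = q then ontoFirst 𝒜 k a b else pairKraus 𝒜 q k a b)

/-- The effect on a density operator of a process along the chain from `p` to its `d`-th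
successor. -/
noncomputable def channel (𝒜 : AnyonData A) (P : Params) (K : KIdx 𝒜 → PairOp A) (p : P.Slot)
    (wrap : Prop) (d : ℕ) (ρ : Op 𝒜 P) : Op 𝒜 P :=
  ∑ k, liftAlong 𝒜 P (K k) p wrap d * ρ * (liftAlong 𝒜 P (K k) p wrap d)ᴴ

/-- The charge `c` is put on the tail and `c̄` on the head of the edge `e`. -/
noncomputable def createPair (𝒜 : AnyonData A) (P : Params) (e : P.Edge) (c : A) :
    Op 𝒜 P → Op 𝒜 P :=
  channel 𝒜 P (pairKraus 𝒜 (if P.first e = P.tail e then c else 𝒜.dual c)) (P.first e, false)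
    (P.IsWrap e) (2 * P.sep e)

/-- The elementary operator `M_r^v(q)` displacing the charge `q` of the resident anyon of `r` to the
neighbouring site `r + v`, where it is not fused yet with the resident anyon. -/
noncomputable def displace (𝒜 : AnyonData A) (P : Params) (r : P.Site) (v : ℤ × ℤ) (q : A) :
    Op 𝒜 P → Op 𝒜 P :=
  let e := P.edgeAt r v
  if P.first e = r then
    channel 𝒜 P (moveKraus 𝒜 q True) (r, false) (P.IsWrap e) (2 * P.sep e + 1)
  else
    channel 𝒜 P (moveKraus 𝒜 q False) (P.first e, true) (P.IsWrap e) (2 * P.sep e - 1)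

/-- At every site the resident anyon and the arrived ones are fused. -/
noncomputable def fuseAll (𝒜 : AnyonData A) (P : Params) (ρ : Op 𝒜 P) : Op 𝒜 P :=
  (Finset.univ : Finset P.Site).toList.foldl
    (fun ρ r => channel 𝒜 P (ontoFirst 𝒜) (r, false) False 1 ρ) ρ

/-- The projector onto the total charge `c r` at every site `r`. -/
noncomputable def collapse (𝒜 : AnyonData A) (P : Params) (c : P.Site → A) : Op 𝒜 P :=
  Matrix.diagonal fun s =>
    if ∀ r, s.2.1 (r, false) = c r ∧ s.2.1 (r, true) = 𝒜.vac then 1 else 0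

/-- The ground state with amplitude `ψ x` on the configuration without anyons in which the chain
line carries the label `x`. -/
noncomputable def groundState (𝒜 : AnyonData A) (P : Params) (ψ : A → ℂ) : Config 𝒜 P → ℂ :=
  fun s => ∑ x, if ∀ p, s.1 p = x ∧ s.2.1 p = 𝒜.vac ∧ (s.2.2 p : ℕ) = 0 then ψ x else 0

/-! ### Errors -/

/-- `charge e t c`: during `(t, t + 1/2)` a pair `c`, `c̄` is put on the edge `e`.
`meas r t w`: at time `t + 1/2` the charge `w q` is reported at `r` if the true charge is `q`. -/
inductive Err (A : Type*) (P : Params)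
  | charge (e : P.Edge) (t : ℕ) (c : A)
  | meas (r : P.Site) (t : ℕ) (w : A → A)

namespace Err

variable {P : Params}

def IsCharge : Err A P → Prop
  | charge _ _ _ => True
  | meas _ _ _ => False

/-- The time step in which the error occurs. -/
def step : Err A P → ℕ
  | charge _ t _ => t
  | meas _ t _ => t

/-- The time coordinate. -/
noncomputable def time : Err A P → ℝ
  | charge _ t _ => t
  | meas _ t _ => t + 1 / 2

/-- The sites on which the error acts. -/
def sites : Err A P → Set P.Site
  | charge e _ _ => {P.tail e, P.head e}
  | meas r _ _ => {r}

/-- Spatial coordinates: the midpoint of the edge, or the site. -/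
noncomputable def pos : Err A P → ℝ × ℝ
  | charge e _ _ => (e.1.1.val + (if e.2 then 0 else 1 / 2), e.1.2.val + (if e.2 then 1 / 2 else 0))
  | meas r _ _ => (r.1.val, r.2.val)

/-- The error lies in the box `[x, x + l) × [y, y + m) × [t, t + d)` (on the torus). -/
def InBox (x y t l m d : ℝ) (e : Err A P) : Prop :=
  (∃ i : ℤ, x ≤ e.pos.1 + i * P.L ∧ e.pos.1 + i * P.L < x + l) ∧
  (∃ i : ℤ, y ≤ e.pos.2 + i * P.L ∧ e.pos.2 + i * P.L < y + m) ∧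
  t ≤ e.time ∧ e.time < t + d

/-- The error lies in the closed box `[x, x + 1] × [y, y + 1] × [t, t]` (on the torus). -/
def InUnitBox (x y t : ℝ) (e : Err A P) : Prop :=
  (∃ i : ℤ, x ≤ e.pos.1 + i * P.L ∧ e.pos.1 + i * P.L ≤ x + 1) ∧
  (∃ i : ℤ, y ≤ e.pos.2 + i * P.L ∧ e.pos.2 + i * P.L ≤ y + 1) ∧
  e.time = t

end Err

/-- Two sets of errors are `(l, m, d)`-linked. -/
def Linked {P : Params} (l m d : ℝ) (S T : Set (Err A P)) : Prop :=
  ∃ x y t : ℝ, (∃ e ∈ S, e.InBox x y t l m d) ∧ (∃ e ∈ T, e.InBox x y t l m d)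

def Separated {P : Params} (l m d : ℝ) (S T : Set (Err A P)) : Prop := ¬ Linked l m d S T

/-- Candidate level-`0` errors: non-empty, not mixing charge and measurement errors, and contained in
a space-time box `[x, x + 1] × [y, y + 1] × [t, t]` with a lattice site `(x, y)`. -/
def candidateZero {P : Params} (ℰ : Set (Err A P)) : Set (Set (Err A P)) :=
  {S | S.Nonempty ∧ S ⊆ ℰ ∧ ((∀ e ∈ S, e.IsCharge) ∨ (∀ e ∈ S, ¬ e.IsCharge)) ∧
    ∃ (x y : ℤ) (t : ℝ), ∀ e ∈ S, e.InUnitBox x y t}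

/-- The actual errors among the candidates `𝒮` of some level, where `noise` is the noise of the
lower levels and `W`, `T` are the spatial and temporal scales of the level; `crit` is the additional
condition on actual errors. -/
def actualOf (P : Params) (ℰ noise : Set (Err A P)) (𝒮 : Set (Set (Err A P))) (W T : ℝ)
    (crit : Set (Err A P) → Prop) : Set (Set (Err A P)) :=
  {S ∈ 𝒮 | crit S ∧ Separated (P.a * W) (P.a * W) (P.b * T) S (ℰ \ (S ∪ noise))}

/-- Candidate errors of level `k + 1`, from the candidates and the noise of level `k`. -/
def candidateSucc (P : Params) (ℰ : Set (Err A P)) (k : ℕ) (𝒮 : Set (Set (Err A P)))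
    (noise : Set (Err A P)) : Set (Set (Err A P)) :=
  {S | S.Nonempty ∧ S ⊆ ℰ \ noise ∧
    (∃ x y t : ℝ, ∀ e ∈ S,
      e.InBox x y t ((P.Q : ℝ) ^ (k + 1)) ((P.Q : ℝ) ^ (k + 1)) ((P.U : ℝ) ^ (k + 1))) ∧
    ∃ S₁ ∈ 𝒮, ∃ S₂ ∈ 𝒮, S₁ ⊆ S ∧ S₂ ⊆ S ∧ Disjoint S₁ S₂ ∧
      Linked (P.a * (P.Q : ℝ) ^ k) (P.a * (P.Q : ℝ) ^ k) (P.b * (P.U : ℝ) ^ k) S₁ S₂}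

/-- No two of the candidates inside `S` are well separated on the scale of the previous level `k`. -/
def NoSeparatedPair (P : Params) (k : ℕ) (𝒮 : Set (Set (Err A P))) (S : Set (Err A P)) : Prop :=
  ¬ ∃ S₁ ∈ 𝒮, ∃ S₂ ∈ 𝒮, S₁ ⊆ S ∧ S₂ ⊆ S ∧
    Separated (4 * (P.a + 2) * (P.Q : ℝ) ^ k) (4 * (P.a + 2) * (P.Q : ℝ) ^ k)
      (4 * (P.b + 2) * (P.U : ℝ) ^ k) S₁ S₂

/-- Candidate errors, actual errors and noise of level `k`. -/
def levels (P : Params) (ℰ : Set (Err A P)) :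
    ℕ → Set (Set (Err A P)) × Set (Set (Err A P)) × Set (Err A P)
  | 0 =>
    let cand := candidateZero ℰ
    let act := actualOf P ℰ ∅ cand 1 1 (fun _ => True)
    (cand, act, ⋃₀ act)
  | k + 1 =>
    let prev := levels P ℰ k
    let cand := candidateSucc P ℰ k prev.1 prev.2.2
    let act := actualOf P ℰ prev.2.2 cand ((P.Q : ℝ) ^ (k + 1)) ((P.U : ℝ) ^ (k + 1))
      (NoSeparatedPair P k cand)
    (cand, act, ⋃₀ act ∪ prev.2.2)

/-- `S` is a level-`k` actual error of the error set `ℰ`. -/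
def IsActual {P : Params} (ℰ : Set (Err A P)) (k : ℕ) (S : Set (Err A P)) : Prop :=
  S ∈ (levels P ℰ k).2.1

/-- All actual errors of `ℰ`. -/
def actuals {P : Params} (ℰ : Set (Err A P)) : Set (Set (Err A P)) := {S | ∃ k, IsActual ℰ k S}

/-- The error sets under consideration: at every time at most one nontrivial error process on each
edge and at most one wrong report at each site, and every error is part of an actual error of some
level. -/
structure IsErrorSet (𝒜 : AnyonData A) {P : Params} (ℰ : Set (Err A P)) : Prop where
  charge_ne : ∀ e t c, Err.charge e t c ∈ ℰ → c ≠ 𝒜.vac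
  charge_unique : ∀ e t c c', Err.charge e t c ∈ ℰ → Err.charge e t c' ∈ ℰ → c = c'
  meas_ne : ∀ r t w, Err.meas r t w ∈ ℰ → ∀ q, w q ≠ q
  meas_unique : ∀ r t w w', Err.meas r t w ∈ ℰ → Err.meas r t w' ∈ ℰ → w = w'
  covered : ∀ e ∈ ℰ, ∃ S ∈ actuals ℰ, e ∈ S

/-! ### The decoder -/

/-- First entry `(v, o)` of the list for which `s v` holds decides; otherwise the default. -/
noncomputable def cascade (s : ℤ × ℤ → Prop) :
    List ((ℤ × ℤ) × Option (ℤ × ℤ)) → Option (ℤ × ℤ) → Option (ℤ × ℤ)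
  | [], d => d
  | (v, o) :: l, d => if s v then o else cascade s l d

/-- The transition rules of a colony site with coordinates `X`, `Y` inside its colony and nontrivial
charge: the direction of the displacement, if any. `s v` means that the neighbour in direction `v`
reports a nontrivial charge. -/
noncomputable def rule (Q X Y : ℕ) (s : ℤ × ℤ → Prop) : Option (ℤ × ℤ) :=
  let H := Q / 2
  let west : List ((ℤ × ℤ) × Option (ℤ × ℤ)) :=
    if X = 0 then
      [((-1, 1), some (-1, 0)), ((-1, 0), some (-1, 0)), ((-1, -1), some (-1, 0))]
    else []
  let south : List ((ℤ × ℤ) × Option (ℤ × ℤ)) :=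
    if Y = 0 then
      [((-1, -1), some (0, -1)), ((0, -1), some (0, -1)), ((1, -1), some (0, -1))]
    else []
  let inner : List ((ℤ × ℤ) × Option (ℤ × ℤ)) × Option (ℤ × ℤ) :=
    if X < H ∧ Y < H then
      ([((0, -1), none), ((-1, 0), none), ((-1, -1), none), ((0, 1), some (0, 1)),
        ((-1, 1), some (0, 1)), ((1, 0), some (1, 0)), ((1, -1), some (1, 0))], some (0, 1))
    else if X < H ∧ Y = H then
      ([((0, -1), none), ((-1, 0), none), ((0, 1), none), ((-1, -1), none), ((-1, 1), none)],
        some (1, 0))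
    else if X < H ∧ H < Y then
      ([((-1, 0), none), ((0, 1), none), ((-1, 1), none), ((1, 0), some (1, 0)),
        ((1, 1), some (1, 0)), ((0, -1), some (0, -1)), ((-1, -1), some (0, -1))], some (1, 0))
    else if X = H ∧ H < Y then
      ([((-1, 0), none), ((0, 1), none), ((1, 0), none), ((-1, 1), none), ((1, 1), none)],
        some (0, -1))
    else if H < X ∧ H < Y then
      ([((0, 1), none), ((1, 0), none), ((1, 1), none), ((0, -1), some (0, -1)),
        ((1, -1), some (0, -1)), ((-1, 0), some (-1, 0)), ((-1, 1), some (-1, 0))], some (0, -1))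
    else if H < X ∧ Y = H then
      ([((0, 1), none), ((1, 0), none), ((0, -1), none), ((1, 1), none), ((1, -1), none)],
        some (-1, 0))
    else if H < X ∧ Y < H then
      ([((1, 0), none), ((0, -1), none), ((1, -1), none), ((-1, 0), some (-1, 0)),
        ((-1, -1), some (-1, 0)), ((0, 1), some (0, 1)), ((1, 1), some (0, 1))], some (-1, 0))
    else if X = H ∧ Y < H then
      ([((1, 0), none), ((0, -1), none), ((-1, 0), none), ((1, -1), none), ((-1, -1), none)],
        some (0, 1))
    else ([], none)
  cascade s (west ++ south ++ inner.1) inner.2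

/-- The number `f_n b`. -/
noncomputable def nThr (𝒜 : AnyonData A) (P : Params) : ℕ := 4 * (3 * 𝒜.diam + 1) * P.Q + 1

/-- The number `f_c b`. -/
noncomputable def cThr (𝒜 : AnyonData A) (P : Params) : ℕ := P.b - nThr 𝒜 P

/-- The threshold fraction `f_c`. -/
noncomputable def fc (𝒜 : AnyonData A) (P : Params) : ℝ := ((P.b : ℝ) - nThr 𝒜 P) / P.b

/-- The charge declared for a bin of `b` reports starting with number `i`: the nontrivial charge
reported most often, if at least `thr` reports of the bin are nontrivial. -/
noncomputable def binCharge (𝒜 : AnyonData A) (b thr : ℕ) (s : ℕ → A) (i : ℕ) : A :=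
  haveI : Nonempty A := ⟨𝒜.vac⟩
  if thr ≤ ((Finset.range b).filter fun β => s (i + β) ≠ 𝒜.vac).card then
    Classical.epsilon fun q => q ≠ 𝒜.vac ∧ ∀ q', q' ≠ 𝒜.vac →
      ((Finset.range b).filter fun β => s (i + β) = q').card ≤
        ((Finset.range b).filter fun β => s (i + β) = q).card
  else 𝒜.vac

/-- The level-`k` syndromes of a colony for the successive level-`k` working periods, from the level-`0`
syndromes `s` at the physical site at its centre: a working period consists of `b` bins of `b`
working periods of the previous level, and the last nontrivial charge declared for a bin is reported
if at least `thr` bins are nontrivial. -/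
noncomputable def levelSyndrome (𝒜 : AnyonData A) (b thr : ℕ) (s : ℕ → A) : ℕ → ℕ → A
  | 0 => s
  | k + 1 => fun τ =>
    let bin : ℕ → A := fun β => binCharge 𝒜 b thr (levelSyndrome 𝒜 b thr s k) (τ * b ^ 2 + β * b)
    if thr ≤ ((Finset.range b).filter fun β => bin β ≠ 𝒜.vac).card then
      bin (Nat.findGreatest (fun β => β < b ∧ bin β ≠ 𝒜.vac) b)
    else 𝒜.vac

section Decoder

variable (𝒜 : AnyonData A) {P : Params} (ℰ : Set (Err A P))

/-- Charge histories: `h j r` is the charge at the site `r` at time `j / 2`. -/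
abbrev History (A : Type*) (P : Params) : Type _ := ℕ → P.Site → A

/-- The level-`0` syndrome reported at `r` at time `t + 1/2`. -/
noncomputable def syndrome (h : History A P) (r : P.Site) (t : ℕ) : A :=
  if hw : ∃ w, Err.meas r t w ∈ ℰ then hw.choose (h (2 * t + 1) r) else h (2 * t + 1) r

/-- The charge displaced by the level-`k` rule at `r`, applied at time `t + 1/2`. -/
noncomputable def ruleCharge (h : History A P) (k t : ℕ) (r : P.Site) : A :=
  levelSyndrome 𝒜 P.b (cThr 𝒜 P) (syndrome ℰ h r) k ((t + 1) / P.U ^ k - 1)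

/-- The direction of the level-`k` transition rule applied at time `t + 1/2` to the colony with
centre `r`, if one is applied. -/
noncomputable def appliedRule (h : History A P) (k t : ℕ) (r : P.Site) : Option (ℤ × ℤ) :=
  if k < P.n ∧ P.IsCentre k r ∧ (t + 1) % P.U ^ k = 0 ∧ ruleCharge 𝒜 ℰ h k t r ≠ 𝒜.vac then
    rule P.Q (r.1.val / P.Q ^ k % P.Q) (r.2.val / P.Q ^ k % P.Q) fun v =>
      levelSyndrome 𝒜 P.b (nThr 𝒜 P) (syndrome ℰ h (P.shift r (P.Q ^ k) v)) k
        ((t + 1) / P.U ^ k - 1) ≠ 𝒜.vac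
  else none

/-- Applies the charge errors of time step `t`, on the edges in the given order. -/
noncomputable def noiseStep (order : List P.Edge) (t : ℕ) (ρ : Op 𝒜 P) : Op 𝒜 P :=
  order.foldl (fun ρ e =>
    if hc : ∃ c, Err.charge e t c ∈ ℰ then createPair 𝒜 P e hc.choose ρ else ρ) ρ

/-- Applies the level-`k` transition rules of time step `t`: all charges are displaced
simultaneously, site by site along their paths, and after each elementary displacement the anyons at
every site are fused. -/
noncomputable def levelStep (h : History A P) (k t : ℕ) (ρ : Op 𝒜 P) : Op 𝒜 P :=
  (List.range (P.Q ^ k)).foldl (fun ρ i =>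
    fuseAll 𝒜 P ((Finset.univ : Finset P.Site).toList.foldl (fun ρ r =>
      match appliedRule 𝒜 ℰ h k t r with
      | some v => displace 𝒜 P (P.shift r i v) v (ruleCharge 𝒜 ℰ h k t r) ρ
      | none => ρ) ρ)) ρ

/-- Applies the transition rules of all levels, in increasing order. -/
noncomputable def ruleStep (h : History A P) (t : ℕ) (ρ : Op 𝒜 P) : Op 𝒜 P :=
  (List.range P.n).foldl (fun ρ k => levelStep 𝒜 ℰ h k t ρ) ρ

end Decoder

/-- The initial ground state, and the order in which the edges are visited by the noise in each time
step. -/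
structure Env (A : Type*) [Fintype A] (P : Params) where
  ψ : A → ℂ
  norm_ψ : ∑ x, ‖ψ x‖ ^ 2 = 1
  order : ℕ → List P.Edge
  nodup_order : ∀ t, (order t).Nodup
  mem_order : ∀ t e, e ∈ order t

section Evolution

variable (𝒜 : AnyonData A) {P : Params} (𝒱 : Env A P)

/-- The unnormalized density operator at time `j / 2`, for the charge history `h`. -/
noncomputable def evolve (ℰ : Set (Err A P)) (h : History A P) : ℕ → Op 𝒜 P
  | 0 => collapse 𝒜 P (h 0) *
      Matrix.vecMulVec (groundState 𝒜 P 𝒱.ψ) (star (groundState 𝒜 P 𝒱.ψ)) * collapse 𝒜 P (h 0)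
  | j + 1 => collapse 𝒜 P (h (j + 1)) *
      (if j % 2 = 0 then noiseStep 𝒜 ℰ (𝒱.order (j / 2)) (j / 2) (evolve ℰ h j)
        else ruleStep 𝒜 ℰ h (j / 2) (evolve ℰ h j)) * collapse 𝒜 P (h (j + 1))

/-- The probability of the charge history `h` up to time `j / 2`. -/
noncomputable def histProb (ℰ : Set (Err A P)) (h : History A P) (j : ℕ) : ℝ :=
  (Matrix.trace (evolve 𝒜 𝒱 ℰ h j)).re

/-- The charge history `h` is a possible one up to time `j / 2`. -/
def Possible (ℰ : Set (Err A P)) (h : History A P) (j : ℕ) : Prop := 0 < histProb 𝒜 𝒱 ℰ h j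

/-- The probability that the site `r` has the charge `q` at time `j / 2`. -/
noncomputable def chargeProb (ℰ : Set (Err A P)) (j : ℕ) (r : P.Site) (q : A) : ℝ :=
  ∑ g : Fin (j + 1) → P.Site → A,
    if g (Fin.last j) r = q then
      histProb 𝒜 𝒱 ℰ (fun i => if hi : i < j + 1 then g ⟨i, hi⟩ else fun _ => 𝒜.vac) j
    else 0

/-! ### Causal regions and causally-linked clusters

Here `𝓐` is a collection of actual errors. Points in space-time are pairs of a site and twice the
time coordinate. -/

/-- The causal region at time `t` of the actual error `E`. -/
def causalRegion (𝓐 : Set (Set (Err A P))) (E : Set (Err A P)) (t : ℕ) : Set (P.Site × ℕ) :=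
  {p | p.2 ≤ 2 * t ∧ ∃ 𝓕 ⊆ 𝓐, ∃ q,
    chargeProb 𝒜 𝒱 (⋃₀ 𝓕) p.2 p.1 q ≠ chargeProb 𝒜 𝒱 (⋃₀ (𝓕 \ {E})) p.2 p.1 q}

def clusterStep (𝓐 : Set (Set (Err A P))) (E : Set (Err A P)) (t : ℕ) :
    ℕ → Set (Set (Err A P))
  | 0 => {E}
  | i + 1 => {E' ∈ 𝓐 | ∃ E'' ∈ clusterStep 𝓐 E t i,
      (causalRegion 𝒜 𝒱 𝓐 E'' t ∩ causalRegion 𝒜 𝒱 𝓐 E' t).Nonempty}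

/-- The causally-linked cluster of `E` at time `t`. -/
def cluster (𝓐 : Set (Set (Err A P))) (E : Set (Err A P)) (t : ℕ) : Set (Set (Err A P)) :=
  ⋃ i, clusterStep 𝒜 𝒱 𝓐 E t i

/-- The actual errors of `ℰ` of level smaller than the one of `E`, together with `E`. -/
def restricted (ℰ : Set (Err A P)) (E : Set (Err A P)) : Set (Set (Err A P)) :=
  {E' | ∃ k' k, IsActual ℰ k' E' ∧ IsActual ℰ k E ∧ k' < k} ∪ {E}

/-- The union of the causally-linked clusters at time `t` of the actual errors of level at least
`k`. -/
def coarseCluster (ℰ : Set (Err A P)) (k t : ℕ) : Set (Set (Err A P)) :=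
  {E' | ∃ E, (∃ m, k ≤ m ∧ IsActual ℰ m E) ∧ E' ∈ cluster 𝒜 𝒱 (actuals ℰ) E t}

/-! ### Trajectories -/

/-- The locations at time `t` of an error `e`, for the charge history `h` under the error set `ℰ`;
`lev k` means that `k` is at most the level of the causally-linked cluster of `e`. -/
inductive Loc (ℰ : Set (Err A P)) (h : History A P) (lev : ℕ → Prop) (e : Err A P) :
    ℕ → P.Site → Prop
  | start (r : P.Site) (hr : r ∈ e.sites) : Loc ℰ h lev e e.step r
  | stay (t : ℕ) (r : P.Site) (hr : Loc ℰ h lev e t r) (hc : h (2 * (t + 1)) r ≠ 𝒜.vac) :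
      Loc ℰ h lev e (t + 1) r
  | moved (k t t' : ℕ) (r : P.Site) (v : ℤ × ℤ) (hk : lev k) (ht : t' ≤ t)
      (htU : t - t' < P.U ^ k) (hr : Loc ℰ h lev e t' r) (hv : appliedRule 𝒜 ℰ h k t r = some v)
      (hc : h (2 * (t + 1)) (P.shift r (P.Q ^ k) v) ≠ 𝒜.vac) :
      Loc ℰ h lev e (t + 1) (P.shift r (P.Q ^ k) v)
  | left (k t t' : ℕ) (r : P.Site) (v : ℤ × ℤ) (hk : lev k) (ht : t' ≤ t)
      (htU : t - t' < P.U ^ k) (hr : Loc ℰ h lev e t' r) (hv : appliedRule 𝒜 ℰ h k t r = some v)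
      (hc : h (2 * (t + 1)) r ≠ 𝒜.vac) :
      Loc ℰ h lev e (t + 1) r

/-- The trajectory domain up to time `t` of a collection `𝒞` of actual errors (a union of
causally-linked clusters at time `tc`) within the collection `𝓐` of actual errors: the union, over
all sub-collections of `𝒞` that are removed and over all fusion histories that are possible for the
remaining errors, of the trajectories of the errors that remain in `𝒞`. The levels of actual errors
are those in `ℰ`. -/
def trajDomain (ℰ : Set (Err A P)) (𝓐 𝒞 : Set (Set (Err A P))) (tc t : ℕ) : Set (P.Site × ℕ) :=
  {p | p.2 ≤ t ∧ ∃ 𝒟 ⊆ 𝒞, ∃ h : History A P, Possible 𝒜 𝒱 (⋃₀ (𝓐 \ 𝒟)) h (2 * t) ∧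
    ∃ E ∈ 𝒞 \ 𝒟, ∃ e ∈ E,
      Loc 𝒜 (⋃₀ (𝓐 \ 𝒟)) h
        (fun k => ∃ E' ∈ cluster 𝒜 𝒱 𝓐 E tc, ∃ m, k ≤ m ∧ IsActual ℰ m E') e p.2 p.1}

end Evolution

/-! ### Locality, faithfulness, successfulness -/

/-- The trajectory domain of the restricted cluster of a level-`k'` actual error, `k' ≤ k`, is always
contained in a block of `2 × 2` level-`k'` colonies. -/
def KLocal (𝒜 : AnyonData A) (P : Params) (k : ℕ) : Prop :=
  ∀ (𝒱 : Env A P) (ℰ : Set (Err A P)), IsErrorSet 𝒜 ℰ →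
    ∀ (t k' : ℕ) (E : Set (Err A P)), k' ≤ k → IsActual ℰ k' E →
      ∃ r : P.Site, ∀ p ∈ trajDomain 𝒜 𝒱 ℰ (restricted ℰ E)
        (cluster 𝒜 𝒱 (restricted ℰ E) E t) t t, p.1 ∈ P.block k' r

/-- The level-`k` colony of `r` or one of its eight neighbours overlaps, during the time steps in
`[t₁, t₂)`, with an actual error of level at least `k`. -/
def Overlaps {P : Params} (ℰ : Set (Err A P)) (k : ℕ) (r : P.Site) (t₁ t₂ : ℕ) : Prop :=
  ∃ m E, k ≤ m ∧ IsActual ℰ m E ∧ ∃ e ∈ E, t₁ ≤ e.step ∧ e.step < t₂ ∧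
    ∃ s ∈ e.sites, ∃ v ∈ Params.nbhd, P.SameColony k (P.shift r (P.Q ^ k) v) s

/-- If a level-`k'` colony and its neighbours, `k' ≤ k`, do not overlap with errors of level `k'` or
greater for a working period, then from some time `t_c ≤ (1 - f_c) b U ^ (k' - 1) + τ U ^ k'` of the
working period on the trajectory domain of the coarse-grained cluster meets the colony at most in the
physical site at its centre. -/
def KFaithful (𝒜 : AnyonData A) (P : Params) (k : ℕ) : Prop :=
  ∀ (𝒱 : Env A P) (ℰ : Set (Err A P)), IsErrorSet 𝒜 ℰ →
    ∀ (k' τ : ℕ) (r : P.Site), k' ≤ k → P.IsCentre k' r →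
      ¬ Overlaps ℰ k' r (τ * P.U ^ k') ((τ + 1) * P.U ^ k') →
      ∃ tc : ℕ, τ * P.U ^ k' ≤ tc ∧
        (tc : ℝ) ≤ (1 - fc 𝒜 P) * P.b * (P.U : ℝ) ^ ((k' : ℤ) - 1) + τ * (P.U : ℝ) ^ k' ∧
        ∀ t, tc ≤ t → t < (τ + 1) * P.U ^ k' → ∀ s : P.Site,
          (s, t) ∈ trajDomain 𝒜 𝒱 ℰ (actuals ℰ) (coarseCluster 𝒜 𝒱 ℰ k tc) tc t →
          P.SameColony k' r s → s = r

/-- `FusesTo 𝒜 l y`: the charges in the list `l` can fuse to `y`; no charges fuse to the vacuum. -/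
inductive FusesTo (𝒜 : AnyonData A) : List A → A → Prop
  | nil : FusesTo 𝒜 [] 𝒜.vac
  | cons (q x y : A) (l : List A) (hl : FusesTo 𝒜 l x) (hN : 0 < 𝒜.N x q y) :
      FusesTo 𝒜 (q :: l) y

section Success

variable (𝒜 : AnyonData A) {P : Params} (ℰ : Set (Err A P)) (h : History A P)

/-- The level-`0` rule `M_r^v` is applied at time `t + 1/2` and is active: the syndrome of `r` is
nontrivial, and the syndromes of `r` and of its eight neighbours are valid. -/
def ActiveZero (r : P.Site) (v : ℤ × ℤ) (t : ℕ) : Prop :=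
  syndrome ℰ h r t ≠ 𝒜.vac ∧
  (∀ u ∈ Params.nbhd, syndrome ℰ h (P.shift r 1 u) t = h (2 * t + 1) (P.shift r 1 u)) ∧
  appliedRule 𝒜 ℰ h 0 t r = some v

/-- The level-`0` rule applied to `r` at time `t + 1/2` leaves the vacuum at `r`: at time `t + 1` the
site `r` contains nothing but the charges that the rules applied to other sites have displaced into
it in the same time step. In particular `r` contains the vacuum if there are none. -/
def SuccessZero (r : P.Site) (t : ℕ) : Prop :=
  ∃ l : List P.Site, l.Nodup ∧
    (∀ r', r' ∈ l ↔ ∃ v', appliedRule 𝒜 ℰ h 0 t r' = some v' ∧ P.shift r' 1 v' = r) ∧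
    FusesTo 𝒜 (l.map (ruleCharge 𝒜 ℰ h 0 t)) (h (2 * (t + 1)) r)

/-- A transition rule of level higher than `0`, applied at time `t + 1/2`, acts on `r` or on one of
its eight neighbours. -/
def HigherRule (r : P.Site) (t : ℕ) : Prop :=
  ∃ (k : ℕ) (r' : P.Site) (v : ℤ × ℤ), 0 < k ∧ appliedRule 𝒜 ℰ h k t r' = some v ∧
    ∃ i ≤ P.Q ^ k, ∃ u ∈ Params.nbhd, P.shift r' i v = P.shift r 1 u

end Success

/-- In the absence of actual errors and of transition rules of level higher than `0` on a site and
its neighbours, an active level-`0` rule is successful after at most `diam` successive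
applications. -/
def ZeroSuccessful (𝒜 : AnyonData A) (P : Params) : Prop :=
  ∀ (𝒱 : Env A P) (ℰ : Set (Err A P)), IsErrorSet 𝒜 ℰ →
    ∀ (h : History A P) (r : P.Site) (v : ℤ × ℤ) (τ : ℕ),
      Possible 𝒜 𝒱 ℰ h (2 * (τ + 𝒜.diam)) →
      ¬ Overlaps ℰ 0 r τ (τ + 𝒜.diam) →
      (∀ j < 𝒜.diam, ¬ HigherRule 𝒜 ℰ h r (τ + j)) →
      ActiveZero 𝒜 ℰ h r v τ →
      ∃ j < 𝒜.diam, (∀ i ≤ j, ActiveZero 𝒜 ℰ h r v (τ + i)) ∧ SuccessZero 𝒜 ℰ h r (τ + j)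

/-- In the presence of a single level-`0` actual error `E`, all anyons stay in a fixed `2 × 2` block of
sites, and two time steps after their appearance there are no anyons: from time `t + 2` on, if `E`
consists of charge errors at time `t`, and from time `t + 3` on, if `E` consists of measurement errors
at time `t + 1/2`. -/
def ZeroCorrected (𝒜 : AnyonData A) (P : Params) : Prop :=
  ∀ (𝒱 : Env A P) (ℰ : Set (Err A P)), IsErrorSet 𝒜 ℰ →
    ∀ E : Set (Err A P), IsActual ℰ 0 E →
      ∃ r : P.Site, ∀ (h : History A P) (j : ℕ), Possible 𝒜 𝒱 E h j →
        (∀ s, h j s ≠ 𝒜.vac → s ∈ P.block 0 r) ∧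
        ∀ e ∈ E, (e.IsCharge → 2 * (e.step + 2) ≤ j → ∀ s, h j s = 𝒜.vac) ∧
          (¬ e.IsCharge → 2 * (e.step + 3) ≤ j → ∀ s, h j s = 𝒜.vac)

end Definitions

end AnyonDecoder

/-! Faithfulness at level `0` is immediate, since a level-`0` colony is a single site.
Successfulness holds already at the first application: an active rule displaces the true charge of
its site, so the whole anyon leaves and only arriving charges remain (`Outcome.success`).
Non-cyclicity makes the diameter finite, and a nontrivial charge then makes it at least one
(`diam_pos`).

The substance is the fate of a single level-`0` error, `exists_block`. Locality and correction both
follow from it, because the restricted error set of such an error contains nothing else, and a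
trajectory consists of error sites and of sites with nontrivial charge. Two facts decide this fate.

The first is combinatorial. If at least two sites of a `2 × 2` block report charges, the rules keep
the charges in the block; if at least two sites are still occupied after one step, the next step
sends all charges to a single site (`square_of_reached`, `reached_unique`). The rules only ask
whether a coordinate is zero, below, at or above the middle of the colony, so this is a finite check
(`gathers_classPairs`).

The second is that processes inside a block never leave exactly one nontrivial charge
(`not_single_charge`). Together: after two steps at most one site is occupied, hence none. Wrong
reports in the vacuum only delay this by one step, since the rules acting on them create charges
with trivial total charge in one block.

On a torus the second fact does not follow from the fusion rules alone: a chain line `X` admits a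
lone charge `a` whenever `N X a X > 0`. But every ground state is a superposition of closed strings
fused into the chain with trivial line (`stringOp`). By the pentagon equation, operators on adjacent
positions commute with these strings (`lift_mul_stringOp`). The state therefore always arises by
fusing strings into states whose line entering one chosen position, the south end of the western
column of the block, is trivial, and in such states a lone charge must be trivial (`charge_eq_vac`).

Displacements across the seam between the last row and row `0` contain a monodromy with the chain
line and do not commute with the strings. For a block on the seam, the windings of all positions in
row `0` are split off from the state. By the hexagon equations, moving an operation inside the block
past these windings turns it into one that commutes with the strings (`transport_edge`). The
invariant carried through the evolution is that the range of the density operator lies in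
`neutralSpace`.

Rules of higher level stay silent, since nontrivial reports occur in at most three time steps, fewer
than the threshold `cThr` requires (`appliedRule_eq_none`). -/

namespace AnyonDecoder

open scoped Matrix ComplexConjugate

/-! ### Fusion trees with three leaves and the `F`-move as a unitary matrix -/

section Trees

open scoped Classical

variable {A : Type*} [Fintype A]

lemma AnyonData.N_le_idx (𝒜 : AnyonData A) (a b c : A) :
    𝒜.N a b c ≤ ∑ a, ∑ b, ∑ c, 𝒜.N a b c :=
  (Finset.single_le_sum (f := fun c => 𝒜.N a b c) (fun _ _ => Nat.zero_le _)
    (Finset.mem_univ c)).trans <|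
  (Finset.single_le_sum (f := fun b => ∑ c, 𝒜.N a b c) (fun _ _ => Nat.zero_le _)
    (Finset.mem_univ b)).trans <|
  Finset.single_le_sum (f := fun a => ∑ b, ∑ c, 𝒜.N a b c) (fun _ _ => Nat.zero_le _)
    (Finset.mem_univ a)

/-- The axioms number fusion vertices by naturals below a multiplicity that depends on the labels,
while trees and configurations carry vertices in the single finite type `Idx`. This converts sums of
the one kind into sums of the other. -/
lemma sum_range_idx (𝒜 : AnyonData A) (a b c : A) (g : ℕ → ℂ) :
    ∑ n ∈ Finset.range (𝒜.N a b c), g n =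
      ∑ i : 𝒜.Idx, if (i : ℕ) < 𝒜.N a b c then g i else 0 := by
  rw [Fin.sum_univ_eq_sum_range (fun i => if i < 𝒜.N a b c then g i else 0), ← Finset.sum_filter]
  congr 1
  ext i
  have := 𝒜.N_le_idx a b c
  simp only [Finset.mem_range, Finset.mem_filter]
  omega

/-- A binary tree with three leaves, a root `tot`, an inner edge `mid` and two vertices. -/
@[ext] structure Tree (𝒜 : AnyonData A) where
  l1 : A
  l2 : A
  l3 : A
  mid : A
  tot : A
  α : 𝒜.Idx
  β : 𝒜.Idx

variable (𝒜 : AnyonData A)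

def Tree.equivProd : Tree 𝒜 ≃ A × A × A × A × A × 𝒜.Idx × 𝒜.Idx where
  toFun t := (t.l1, t.l2, t.l3, t.mid, t.tot, t.α, t.β)
  invFun p := ⟨p.1, p.2.1, p.2.2.1, p.2.2.2.1, p.2.2.2.2.1, p.2.2.2.2.2.1, p.2.2.2.2.2.2⟩
  left_inv _ := rfl
  right_inv _ := rfl

noncomputable instance : Fintype (Tree 𝒜) := Fintype.ofEquiv _ (Tree.equivProd 𝒜).symm

/-- Trees `(l1 l2 → mid, α), (mid l3 → tot, β)`. -/
abbrev LT : Type _ :=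
  {t : Tree 𝒜 // (t.α : ℕ) < 𝒜.N t.l1 t.l2 t.mid ∧ (t.β : ℕ) < 𝒜.N t.mid t.l3 t.tot}

/-- Trees `(l2 l3 → mid, α), (l1 mid → tot, β)`. -/
abbrev RT : Type _ :=
  {t : Tree 𝒜 // (t.α : ℕ) < 𝒜.N t.l2 t.l3 t.mid ∧ (t.β : ℕ) < 𝒜.N t.l1 t.mid t.tot}

variable {𝒜}

lemma sum_tree (g : Tree 𝒜 → ℂ) :
    ∑ t, g t = ∑ a, ∑ b, ∑ c, ∑ m, ∑ d, ∑ i, ∑ j, g ⟨a, b, c, m, d, i, j⟩ := by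
  rw [← (Tree.equivProd 𝒜).symm.sum_comp]
  simp only [Fintype.sum_prod_type]
  rfl

lemma sum_LT (g : A → A → A → A → A → ℕ → ℕ → ℂ) :
    ∑ t : LT 𝒜, g t.1.l1 t.1.l2 t.1.l3 t.1.mid t.1.tot t.1.α t.1.β =
      ∑ a, ∑ b, ∑ c, ∑ d, ∑ e, ∑ α ∈ Finset.range (𝒜.N a b e),
        ∑ β ∈ Finset.range (𝒜.N e c d), g a b c e d α β := by
  have h := Finset.sum_subtype_eq_sum_filter (s := (Finset.univ : Finset (Tree 𝒜)))
    (f := fun t : Tree 𝒜 => g t.l1 t.l2 t.l3 t.mid t.tot t.α t.β)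
    (p := fun t : Tree 𝒜 => (t.α : ℕ) < 𝒜.N t.l1 t.l2 t.mid ∧ (t.β : ℕ) < 𝒜.N t.mid t.l3 t.tot)
  rw [show (Finset.subtype (fun t : Tree 𝒜 => (t.α : ℕ) < 𝒜.N t.l1 t.l2 t.mid ∧
    (t.β : ℕ) < 𝒜.N t.mid t.l3 t.tot) Finset.univ) = Finset.univ by ext; simp] at h
  rw [h, Finset.sum_filter, sum_tree]
  refine Finset.sum_congr rfl fun a _ => Finset.sum_congr rfl fun b _ =>
    Finset.sum_congr rfl fun c _ => ?_
  rw [Finset.sum_comm]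
  refine Finset.sum_congr rfl fun d _ => Finset.sum_congr rfl fun e _ => ?_
  rw [sum_range_idx]
  refine Finset.sum_congr rfl fun i _ => ?_
  split_ifs with hi
  · rw [sum_range_idx]
    simp [hi]
  · simp [hi]

lemma sum_RT (g : A → A → A → A → A → ℕ → ℕ → ℂ) :
    ∑ t : RT 𝒜, g t.1.l1 t.1.l2 t.1.l3 t.1.mid t.1.tot t.1.α t.1.β =
      ∑ a, ∑ b, ∑ c, ∑ d, ∑ f, ∑ α ∈ Finset.range (𝒜.N b c f),
        ∑ β ∈ Finset.range (𝒜.N a f d), g a b c f d α β := by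
  have h := Finset.sum_subtype_eq_sum_filter (s := (Finset.univ : Finset (Tree 𝒜)))
    (f := fun t : Tree 𝒜 => g t.l1 t.l2 t.l3 t.mid t.tot t.α t.β)
    (p := fun t : Tree 𝒜 => (t.α : ℕ) < 𝒜.N t.l2 t.l3 t.mid ∧ (t.β : ℕ) < 𝒜.N t.l1 t.mid t.tot)
  rw [show (Finset.subtype (fun t : Tree 𝒜 => (t.α : ℕ) < 𝒜.N t.l2 t.l3 t.mid ∧
    (t.β : ℕ) < 𝒜.N t.l1 t.mid t.tot) Finset.univ) = Finset.univ by ext; simp] at h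
  rw [h, Finset.sum_filter, sum_tree]
  refine Finset.sum_congr rfl fun a _ => Finset.sum_congr rfl fun b _ =>
    Finset.sum_congr rfl fun c _ => ?_
  rw [Finset.sum_comm]
  refine Finset.sum_congr rfl fun d _ => Finset.sum_congr rfl fun e _ => ?_
  rw [sum_range_idx]
  refine Finset.sum_congr rfl fun i _ => ?_
  split_ifs with hi
  · rw [sum_range_idx]
    simp [hi]
  · simp [hi]

/-- An entry of a product of tree matrices sums over all left trees, whereas the axioms sum over one
inner edge and two vertices. With the leaves and the root fixed the two sums agree. The analogous
lemmas below treat right trees, and sums in which the inner edge and one vertex are fixed as well.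
-/
lemma sum_LT_fix (a b c d : A) (g : A → ℕ → ℕ → ℂ) (G : LT 𝒜 → ℂ)
    (h0 : ∀ t, G t ≠ 0 → t.1.l1 = a ∧ t.1.l2 = b ∧ t.1.l3 = c ∧ t.1.tot = d)
    (hG : ∀ t : LT 𝒜, t.1.l1 = a → t.1.l2 = b → t.1.l3 = c → t.1.tot = d →
      G t = g t.1.mid t.1.α t.1.β) :
    ∑ t, G t = ∑ e, ∑ α ∈ Finset.range (𝒜.N a b e), ∑ β ∈ Finset.range (𝒜.N e c d), g e α β := by
  have : ∀ t, G t = if t.1.l1 = a then if t.1.l2 = b then if t.1.l3 = c then if t.1.tot = d then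
      g t.1.mid t.1.α t.1.β else 0 else 0 else 0 else 0 := by
    intro t
    split_ifs with h1 h2 h3 h4
    · exact hG t h1 h2 h3 h4
    all_goals
      by_contra hc
      have := h0 t hc
      tauto
  rw [Finset.sum_congr rfl fun t _ => this t]
  rw [sum_LT fun l1 l2 l3 m z i j => if l1 = a then if l2 = b then if l3 = c then if z = d then
      g m i j else 0 else 0 else 0 else 0]
  rw [Finset.sum_eq_single a (by intro x _ hx; simp [hx]) (by simp),
    Finset.sum_eq_single b (by intro x _ hx; simp [hx]) (by simp),
    Finset.sum_eq_single c (by intro x _ hx; simp [hx]) (by simp),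
    Finset.sum_eq_single d (by intro x _ hx; simp [hx]) (by simp)]
  simp

lemma sum_RT_fix (a b c d : A) (g : A → ℕ → ℕ → ℂ) (G : RT 𝒜 → ℂ)
    (h0 : ∀ t, G t ≠ 0 → t.1.l1 = a ∧ t.1.l2 = b ∧ t.1.l3 = c ∧ t.1.tot = d)
    (hG : ∀ t : RT 𝒜, t.1.l1 = a → t.1.l2 = b → t.1.l3 = c → t.1.tot = d →
      G t = g t.1.mid t.1.α t.1.β) :
    ∑ t, G t = ∑ f, ∑ α ∈ Finset.range (𝒜.N b c f), ∑ β ∈ Finset.range (𝒜.N a f d), g f α β := by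
  have : ∀ t, G t = if t.1.l1 = a then if t.1.l2 = b then if t.1.l3 = c then if t.1.tot = d then
      g t.1.mid t.1.α t.1.β else 0 else 0 else 0 else 0 := by
    intro t
    split_ifs with h1 h2 h3 h4
    · exact hG t h1 h2 h3 h4
    all_goals
      by_contra hc
      have := h0 t hc
      tauto
  rw [Finset.sum_congr rfl fun t _ => this t]
  rw [sum_RT fun l1 l2 l3 m z i j => if l1 = a then if l2 = b then if l3 = c then if z = d then
      g m i j else 0 else 0 else 0 else 0]
  rw [Finset.sum_eq_single a (by intro x _ hx; simp [hx]) (by simp),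
    Finset.sum_eq_single b (by intro x _ hx; simp [hx]) (by simp),
    Finset.sum_eq_single c (by intro x _ hx; simp [hx]) (by simp),
    Finset.sum_eq_single d (by intro x _ hx; simp [hx]) (by simp)]
  simp

variable (𝒜)

/-- The `F`-move. -/
noncomputable def mF : Matrix (LT 𝒜) (RT 𝒜) ℂ := fun t r =>
  if r.1.l1 = t.1.l1 ∧ r.1.l2 = t.1.l2 ∧ r.1.l3 = t.1.l3 ∧ r.1.tot = t.1.tot then
    𝒜.F t.1.l1 t.1.l2 t.1.l3 t.1.tot t.1.mid t.1.α t.1.β r.1.mid r.1.α r.1.β else 0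

/-- The exchange of the first two leaves. -/
noncomputable def mB1 : Matrix (LT 𝒜) (LT 𝒜) ℂ := fun t t' =>
  if t'.1.l1 = t.1.l2 ∧ t'.1.l2 = t.1.l1 ∧ t'.1.l3 = t.1.l3 ∧ t'.1.mid = t.1.mid ∧
      t'.1.tot = t.1.tot ∧ t'.1.β = t.1.β then
    𝒜.R t.1.l1 t.1.l2 t.1.mid t.1.α t'.1.α else 0

/-- The exchange of the last two leaves. -/
noncomputable def mB2 : Matrix (RT 𝒜) (RT 𝒜) ℂ := fun r r' =>
  if r'.1.l1 = r.1.l1 ∧ r'.1.l2 = r.1.l3 ∧ r'.1.l3 = r.1.l2 ∧ r'.1.mid = r.1.mid ∧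
      r'.1.tot = r.1.tot ∧ r'.1.β = r.1.β then
    𝒜.R r.1.l2 r.1.l3 r.1.mid r.1.α r'.1.α else 0

/-- The exchange of the first leaf with the pair of the other two. -/
noncomputable def mC : Matrix (RT 𝒜) (LT 𝒜) ℂ := fun r t =>
  if t.1.l1 = r.1.l2 ∧ t.1.l2 = r.1.l3 ∧ t.1.l3 = r.1.l1 ∧ t.1.mid = r.1.mid ∧
      t.1.tot = r.1.tot ∧ t.1.α = r.1.α then
    𝒜.R r.1.l1 r.1.mid r.1.tot r.1.β t.1.β else 0

/-- The exchange of the pair of the first two leaves with the last one. -/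
noncomputable def mC' : Matrix (LT 𝒜) (RT 𝒜) ℂ := fun t r =>
  if t.1.l1 = r.1.l2 ∧ t.1.l2 = r.1.l3 ∧ t.1.l3 = r.1.l1 ∧ t.1.mid = r.1.mid ∧
      t.1.tot = r.1.tot ∧ t.1.α = r.1.α then
    𝒜.R t.1.mid t.1.l3 t.1.tot t.1.β r.1.β else 0

variable {𝒜}

/-- The `F`-move is block diagonal in the leaves and the root; inside a block its unitarity is the
axiom, and between blocks all terms vanish. -/
lemma mF_mul_conjTranspose (h : 𝒜.IsModular) : mF 𝒜 * (mF 𝒜)ᴴ = 1 := by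
  ext t t'
  rw [Matrix.mul_apply, Matrix.one_apply]
  by_cases hl : t'.1.l1 = t.1.l1 ∧ t'.1.l2 = t.1.l2 ∧ t'.1.l3 = t.1.l3 ∧ t'.1.tot = t.1.tot
  · obtain ⟨h1, h2, h3, h4⟩ := hl
    have hu := h.F_unitary_left t.1.l1 t.1.l2 t.1.l3 t.1.tot t.1.mid t'.1.mid t.1.α t.1.β t'.1.α
      t'.1.β t.2.1 t.2.2 (by rw [← h1, ← h2]; exact t'.2.1) (by rw [← h3, ← h4]; exact t'.2.2)
    rw [sum_RT_fix t.1.l1 t.1.l2 t.1.l3 t.1.tot (fun f μ ν =>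
      𝒜.F t.1.l1 t.1.l2 t.1.l3 t.1.tot t.1.mid t.1.α t.1.β f μ ν *
      conj (𝒜.F t.1.l1 t.1.l2 t.1.l3 t.1.tot t'.1.mid t'.1.α t'.1.β f μ ν)), hu]
    · congr 1
      simp only [Subtype.ext_iff, Tree.ext_iff, Fin.ext_iff, eq_iff_iff]
      rw [h1, h2, h3, h4]
      tauto
    · intro r hr
      by_contra hc
      exact hr (by simp [mF, hc])
    · intro r r1 r2 r3 r4
      simp [mF, r1, r2, r3, r4, h1, h2, h3, h4]
  · rw [if_neg (by rintro rfl; simp at hl)]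
    refine Finset.sum_eq_zero fun r _ => ?_
    simp only [mF, Matrix.conjTranspose_apply]
    split_ifs with q1 q2 <;> simp_all

lemma mF_conjTranspose_mul (h : 𝒜.IsModular) : (mF 𝒜)ᴴ * mF 𝒜 = 1 := by
  ext r r'
  rw [Matrix.mul_apply, Matrix.one_apply]
  by_cases hl : r'.1.l1 = r.1.l1 ∧ r'.1.l2 = r.1.l2 ∧ r'.1.l3 = r.1.l3 ∧ r'.1.tot = r.1.tot
  · obtain ⟨h1, h2, h3, h4⟩ := hl
    have hu := h.F_unitary_right r.1.l1 r.1.l2 r.1.l3 r.1.tot r.1.mid r'.1.mid r.1.α r.1.β r'.1.α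
      r'.1.β r.2.1 r.2.2 (by rw [← h2, ← h3]; exact r'.2.1) (by rw [← h1, ← h4]; exact r'.2.2)
    rw [sum_LT_fix r.1.l1 r.1.l2 r.1.l3 r.1.tot (fun e α β =>
      conj (𝒜.F r.1.l1 r.1.l2 r.1.l3 r.1.tot e α β r.1.mid r.1.α r.1.β) *
      𝒜.F r.1.l1 r.1.l2 r.1.l3 r.1.tot e α β r'.1.mid r'.1.α r'.1.β), hu]
    · congr 1
      simp only [Subtype.ext_iff, Tree.ext_iff, Fin.ext_iff, eq_iff_iff]
      rw [h1, h2, h3, h4]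
      tauto
    · intro t ht
      by_contra hc
      refine ht ?_
      have : ¬ (r.1.l1 = t.1.l1 ∧ r.1.l2 = t.1.l2 ∧ r.1.l3 = t.1.l3 ∧ r.1.tot = t.1.tot) := by
        rintro ⟨q1, q2, q3, q4⟩; simp_all
      simp [mF, this]
    · intro t r1 r2 r3 r4
      simp [mF, r1, r2, r3, r4, h1, h2, h3, h4]
  · rw [if_neg (by rintro rfl; simp at hl)]
    refine Finset.sum_eq_zero fun t _ => ?_
    simp only [mF, Matrix.conjTranspose_apply]
    split_ifs with q1 q2 <;> simp_all

end Trees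

end AnyonDecoder

/-! ### Exchanges on trees: unitarity, naturality and the hexagons as matrix identities -/

namespace AnyonDecoder

open scoped Matrix ComplexConjugate

section TreeMoves

open scoped Classical

variable {A : Type*} [Fintype A] {𝒜 : AnyonData A}

lemma sum_LT_alpha (a b c e d : A) (β : 𝒜.Idx) (hβ : (β : ℕ) < 𝒜.N e c d) (g : ℕ → ℂ)
    (G : LT 𝒜 → ℂ)
    (h0 : ∀ t, G t ≠ 0 → t.1.l1 = a ∧ t.1.l2 = b ∧ t.1.l3 = c ∧ t.1.mid = e ∧ t.1.tot = d ∧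
      t.1.β = β)
    (hG : ∀ t : LT 𝒜, t.1.l1 = a → t.1.l2 = b → t.1.l3 = c → t.1.mid = e → t.1.tot = d →
      t.1.β = β → G t = g t.1.α) :
    ∑ t, G t = ∑ α ∈ Finset.range (𝒜.N a b e), g α := by
  rw [sum_LT_fix a b c d (fun e' α β' => if e' = e then if β' = β then g α else 0 else 0) G]
  · rw [Finset.sum_eq_single e (by intro x _ hx; simp [hx]) (by simp)]
    refine Finset.sum_congr rfl fun α _ => ?_
    simp [hβ]
  · intro t ht
    have := h0 t ht
    tauto
  · intro t h1 h2 h3 h4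
    split_ifs with h5 h6
    · exact hG t h1 h2 h3 h5 h4 (Fin.ext h6)
    · by_contra hc
      exact h6 (congrArg _ (h0 t hc).2.2.2.2.2)
    · by_contra hc
      exact h5 (h0 t hc).2.2.2.1

lemma sum_LT_beta (a b c e d : A) (α : 𝒜.Idx) (hα : (α : ℕ) < 𝒜.N a b e) (g : ℕ → ℂ)
    (G : LT 𝒜 → ℂ)
    (h0 : ∀ t, G t ≠ 0 → t.1.l1 = a ∧ t.1.l2 = b ∧ t.1.l3 = c ∧ t.1.mid = e ∧ t.1.tot = d ∧
      t.1.α = α)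
    (hG : ∀ t : LT 𝒜, t.1.l1 = a → t.1.l2 = b → t.1.l3 = c → t.1.mid = e → t.1.tot = d →
      t.1.α = α → G t = g t.1.β) :
    ∑ t, G t = ∑ β ∈ Finset.range (𝒜.N e c d), g β := by
  rw [sum_LT_fix a b c d (fun e' α' β => if e' = e then if α' = α then g β else 0 else 0) G]
  · rw [Finset.sum_eq_single e (by intro x _ hx; simp [hx]) (by simp)]
    rw [Finset.sum_eq_single (α : ℕ) (by intro x _ hx; simp [hx]) (by simp [hα])]
    simp
  · intro t ht
    have := h0 t ht
    tauto
  · intro t h1 h2 h3 h4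
    split_ifs with h5 h6
    · exact hG t h1 h2 h3 h5 h4 (Fin.ext h6)
    · by_contra hc
      exact h6 (congrArg _ (h0 t hc).2.2.2.2.2)
    · by_contra hc
      exact h5 (h0 t hc).2.2.2.1

lemma sum_RT_alpha (a b c f d : A) (β : 𝒜.Idx) (hβ : (β : ℕ) < 𝒜.N a f d) (g : ℕ → ℂ)
    (G : RT 𝒜 → ℂ)
    (h0 : ∀ t, G t ≠ 0 → t.1.l1 = a ∧ t.1.l2 = b ∧ t.1.l3 = c ∧ t.1.mid = f ∧ t.1.tot = d ∧
      t.1.β = β)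
    (hG : ∀ t : RT 𝒜, t.1.l1 = a → t.1.l2 = b → t.1.l3 = c → t.1.mid = f → t.1.tot = d →
      t.1.β = β → G t = g t.1.α) :
    ∑ t, G t = ∑ α ∈ Finset.range (𝒜.N b c f), g α := by
  rw [sum_RT_fix a b c d (fun e' α β' => if e' = f then if β' = β then g α else 0 else 0) G]
  · rw [Finset.sum_eq_single f (by intro x _ hx; simp [hx]) (by simp)]
    refine Finset.sum_congr rfl fun α _ => ?_
    simp [hβ]
  · intro t ht
    have := h0 t ht
    tauto
  · intro t h1 h2 h3 h4
    split_ifs with h5 h6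
    · exact hG t h1 h2 h3 h5 h4 (Fin.ext h6)
    · by_contra hc
      exact h6 (congrArg _ (h0 t hc).2.2.2.2.2)
    · by_contra hc
      exact h5 (h0 t hc).2.2.2.1

lemma sum_RT_beta (a b c f d : A) (α : 𝒜.Idx) (hα : (α : ℕ) < 𝒜.N b c f) (g : ℕ → ℂ)
    (G : RT 𝒜 → ℂ)
    (h0 : ∀ t, G t ≠ 0 → t.1.l1 = a ∧ t.1.l2 = b ∧ t.1.l3 = c ∧ t.1.mid = f ∧ t.1.tot = d ∧
      t.1.α = α)
    (hG : ∀ t : RT 𝒜, t.1.l1 = a → t.1.l2 = b → t.1.l3 = c → t.1.mid = f → t.1.tot = d →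
      t.1.α = α → G t = g t.1.β) :
    ∑ t, G t = ∑ β ∈ Finset.range (𝒜.N a f d), g β := by
  rw [sum_RT_fix a b c d (fun e' α' β => if e' = f then if α' = α then g β else 0 else 0) G]
  · rw [Finset.sum_eq_single f (by intro x _ hx; simp [hx]) (by simp)]
    rw [Finset.sum_eq_single (α : ℕ) (by intro x _ hx; simp [hx]) (by simp [hα])]
    simp
  · intro t ht
    have := h0 t ht
    tauto
  · intro t h1 h2 h3 h4
    split_ifs with h5 h6
    · exact hG t h1 h2 h3 h5 h4 (Fin.ext h6)
    · by_contra hc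
      exact h6 (congrArg _ (h0 t hc).2.2.2.2.2)
    · by_contra hc
      exact h5 (h0 t hc).2.2.2.1

lemma mB1_mul_conjTranspose (h : 𝒜.IsModular) : mB1 𝒜 * (mB1 𝒜)ᴴ = 1 := by
  ext t t'
  rw [Matrix.mul_apply, Matrix.one_apply]
  by_cases hl : t'.1.l1 = t.1.l1 ∧ t'.1.l2 = t.1.l2 ∧ t'.1.l3 = t.1.l3 ∧ t'.1.mid = t.1.mid ∧
      t'.1.tot = t.1.tot ∧ t'.1.β = t.1.β
  · obtain ⟨h1, h2, h3, h4, h5, h6⟩ := hl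
    have hu := h.R_unitary_left t.1.l1 t.1.l2 t.1.mid t.1.α t'.1.α t.2.1
      (by rw [← h1, ← h2, ← h4]; exact t'.2.1)
    rw [sum_LT_alpha t.1.l2 t.1.l1 t.1.l3 t.1.mid t.1.tot t.1.β t.2.2 (fun ν =>
      𝒜.R t.1.l1 t.1.l2 t.1.mid t.1.α ν * conj (𝒜.R t.1.l1 t.1.l2 t.1.mid t'.1.α ν)), hu]
    · congr 1
      simp only [Subtype.ext_iff, Tree.ext_iff, Fin.ext_iff, eq_iff_iff]
      rw [h1, h2, h3, h4, h5, h6]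
      tauto
    · intro r hr
      by_contra hc
      exact hr (by simp [mB1, hc])
    · intro r r1 r2 r3 r4 r5 r6
      simp [mB1, r1, r2, r3, r4, r5, r6, h1, h2, h3, h4, h5, h6]
  · rw [if_neg (by rintro rfl; simp at hl)]
    refine Finset.sum_eq_zero fun r _ => ?_
    simp only [mB1, Matrix.conjTranspose_apply]
    split_ifs with q1 q2 <;> simp_all

lemma mB2_mul_conjTranspose (h : 𝒜.IsModular) : mB2 𝒜 * (mB2 𝒜)ᴴ = 1 := by
  ext t t'
  rw [Matrix.mul_apply, Matrix.one_apply]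
  by_cases hl : t'.1.l1 = t.1.l1 ∧ t'.1.l2 = t.1.l2 ∧ t'.1.l3 = t.1.l3 ∧ t'.1.mid = t.1.mid ∧
      t'.1.tot = t.1.tot ∧ t'.1.β = t.1.β
  · obtain ⟨h1, h2, h3, h4, h5, h6⟩ := hl
    have hu := h.R_unitary_left t.1.l2 t.1.l3 t.1.mid t.1.α t'.1.α t.2.1
      (by rw [← h2, ← h3, ← h4]; exact t'.2.1)
    rw [sum_RT_alpha t.1.l1 t.1.l3 t.1.l2 t.1.mid t.1.tot t.1.β t.2.2 (fun ν =>
      𝒜.R t.1.l2 t.1.l3 t.1.mid t.1.α ν * conj (𝒜.R t.1.l2 t.1.l3 t.1.mid t'.1.α ν)), hu]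
    · congr 1
      simp only [Subtype.ext_iff, Tree.ext_iff, Fin.ext_iff, eq_iff_iff]
      rw [h1, h2, h3, h4, h5, h6]
      tauto
    · intro r hr
      by_contra hc
      exact hr (by simp [mB2, hc])
    · intro r r1 r2 r3 r4 r5 r6
      simp [mB2, r1, r2, r3, r4, r5, r6, h1, h2, h3, h4, h5, h6]
  · rw [if_neg (by rintro rfl; simp at hl)]
    refine Finset.sum_eq_zero fun r _ => ?_
    simp only [mB2, Matrix.conjTranspose_apply]
    split_ifs with q1 q2 <;> simp_all

/-- Exchanging the first two leaves changes only the vertex of the pair, and carrying the pair past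
the third leaf changes only the root vertex. Each side therefore has one nonzero term, and the terms
agree. This naturality later becomes the Yang–Baxter relation. -/
lemma mB1_mul_mC' : mB1 𝒜 * mC' 𝒜 = mC' 𝒜 * mB2 𝒜 := by
  ext t r
  rw [Matrix.mul_apply, Matrix.mul_apply]
  by_cases hl : r.1.l1 = t.1.l3 ∧ r.1.l2 = t.1.l2 ∧ r.1.l3 = t.1.l1 ∧ r.1.mid = t.1.mid ∧
      r.1.tot = t.1.tot
  · obtain ⟨h1, h2, h3, h4, h5⟩ := hl
    have hb : (t.1.β : ℕ) < 𝒜.N t.1.mid t.1.l3 t.1.tot := t.2.2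
    have ha : (t.1.α : ℕ) < 𝒜.N t.1.l1 t.1.l2 t.1.mid := t.2.1
    have hb' := r.2.2
    have ha' := r.2.1
    rw [h2, h3, h4] at ha'
    rw [h1, h4, h5] at hb'
    let t1 : LT 𝒜 := ⟨⟨t.1.l2, t.1.l1, t.1.l3, t.1.mid, t.1.tot, r.1.α, t.1.β⟩, ha', hb⟩
    let r1 : RT 𝒜 := ⟨⟨t.1.l3, t.1.l1, t.1.l2, t.1.mid, t.1.tot, t.1.α, r.1.β⟩, ha, hb'⟩
    rw [Finset.sum_eq_single t1, Finset.sum_eq_single r1]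
    · simp [mB1, mB2, mC', t1, r1, h1, h2, h3, h4, h5, mul_comm]
    · intro b _ hb
      by_contra hc
      apply hb
      simp only [mC', mB2] at hc
      split_ifs at hc with q1 q2 <;> simp_all [Subtype.ext_iff, Tree.ext_iff, r1]
    · simp
    · intro b _ hb
      by_contra hc
      apply hb
      simp only [mC', mB1] at hc
      split_ifs at hc with q1 q2 <;> simp_all [Subtype.ext_iff, Tree.ext_iff, t1]
    · simp
  · rw [Finset.sum_eq_zero, Finset.sum_eq_zero]
    · intro b _
      simp only [mC', mB2]
      split_ifs with q1 q2 <;> simp_all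
    · intro b _
      simp only [mC', mB1]
      split_ifs with q1 q2 <;> simp_all

/-- The two-step products are computed separately, so that each side of a hexagon becomes a product
of two matrices whose entries `sum_RT_fix` and `sum_LT_alpha` can match with the axiom. -/
lemma mC_mul_mF (r1 r : RT 𝒜) : (mC 𝒜 * mF 𝒜) r1 r =
    if r.1.l1 = r1.1.l2 ∧ r.1.l2 = r1.1.l3 ∧ r.1.l3 = r1.1.l1 ∧ r.1.tot = r1.1.tot then
      ∑ ν ∈ Finset.range (𝒜.N r1.1.mid r1.1.l1 r1.1.tot),
        𝒜.R r1.1.l1 r1.1.mid r1.1.tot r1.1.β ν *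
        𝒜.F r1.1.l2 r1.1.l3 r1.1.l1 r1.1.tot r1.1.mid r1.1.α ν r.1.mid r.1.α r.1.β
    else 0 := by
  rw [Matrix.mul_apply]
  split_ifs with hl
  · obtain ⟨h1, h2, h3, h4⟩ := hl
    rw [sum_LT_beta r1.1.l2 r1.1.l3 r1.1.l1 r1.1.mid r1.1.tot r1.1.α r1.2.1 (fun ν =>
      𝒜.R r1.1.l1 r1.1.mid r1.1.tot r1.1.β ν *
        𝒜.F r1.1.l2 r1.1.l3 r1.1.l1 r1.1.tot r1.1.mid r1.1.α ν r.1.mid r.1.α r.1.β)]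
    · intro t ht
      by_contra hc
      exact ht (by simp [mC, hc])
    · intro t q1 q2 q3 q4 q5 q6
      simp [mC, mF, q1, q2, q3, q4, q5, q6, h1, h2, h3, h4]
  · refine Finset.sum_eq_zero fun t _ => ?_
    simp only [mC, mF]
    split_ifs with q1 q2 <;> simp_all

lemma mC'H_mul_mF (r1 r : RT 𝒜) : ((mC' 𝒜)ᴴ * mF 𝒜) r1 r =
    if r.1.l1 = r1.1.l2 ∧ r.1.l2 = r1.1.l3 ∧ r.1.l3 = r1.1.l1 ∧ r.1.tot = r1.1.tot then
      ∑ ν ∈ Finset.range (𝒜.N r1.1.mid r1.1.l1 r1.1.tot),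
        conj (𝒜.R r1.1.mid r1.1.l1 r1.1.tot ν r1.1.β) *
        𝒜.F r1.1.l2 r1.1.l3 r1.1.l1 r1.1.tot r1.1.mid r1.1.α ν r.1.mid r.1.α r.1.β
    else 0 := by
  rw [Matrix.mul_apply]
  split_ifs with hl
  · obtain ⟨h1, h2, h3, h4⟩ := hl
    rw [sum_LT_beta r1.1.l2 r1.1.l3 r1.1.l1 r1.1.mid r1.1.tot r1.1.α r1.2.1 (fun ν =>
      conj (𝒜.R r1.1.mid r1.1.l1 r1.1.tot ν r1.1.β) *
        𝒜.F r1.1.l2 r1.1.l3 r1.1.l1 r1.1.tot r1.1.mid r1.1.α ν r.1.mid r.1.α r.1.β)]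
    · intro t ht
      by_contra hc
      exact ht (by simp [mC', hc])
    · intro t q1 q2 q3 q4 q5 q6
      simp [mC', mF, q1, q2, q3, q4, q5, q6, h1, h2, h3, h4]
  · refine Finset.sum_eq_zero fun t _ => ?_
    simp only [mC', mF, Matrix.conjTranspose_apply]
    split_ifs with q1 q2 <;> simp_all

lemma mF_mul_mB2 (t : LT 𝒜) (r : RT 𝒜) : (mF 𝒜 * mB2 𝒜) t r =
    if r.1.l1 = t.1.l1 ∧ r.1.l2 = t.1.l3 ∧ r.1.l3 = t.1.l2 ∧ r.1.tot = t.1.tot then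
      ∑ σ ∈ Finset.range (𝒜.N t.1.l2 t.1.l3 r.1.mid),
        𝒜.F t.1.l1 t.1.l2 t.1.l3 t.1.tot t.1.mid t.1.α t.1.β r.1.mid σ r.1.β *
        𝒜.R t.1.l2 t.1.l3 r.1.mid σ r.1.α
    else 0 := by
  rw [Matrix.mul_apply]
  split_ifs with hl
  · obtain ⟨h1, h2, h3, h4⟩ := hl
    rw [sum_RT_alpha t.1.l1 t.1.l2 t.1.l3 r.1.mid t.1.tot r.1.β (by rw [← h1, ← h4]; exact r.2.2)
      (fun σ => 𝒜.F t.1.l1 t.1.l2 t.1.l3 t.1.tot t.1.mid t.1.α t.1.β r.1.mid σ r.1.β *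
        𝒜.R t.1.l2 t.1.l3 r.1.mid σ r.1.α)]
    · intro t ht
      simp only [mF, mB2] at ht
      split_ifs at ht with q1 q2 <;> simp_all
    · intro t q1 q2 q3 q4 q5 q6
      simp [mB2, mF, q1, q2, q3, q4, q5, q6, h1, h2, h3, h4]
  · refine Finset.sum_eq_zero fun t _ => ?_
    simp only [mB2, mF]
    split_ifs with q1 q2 <;> simp_all

lemma mF_mul_mB2H (t : LT 𝒜) (r : RT 𝒜) : (mF 𝒜 * (mB2 𝒜)ᴴ) t r =
    if r.1.l1 = t.1.l1 ∧ r.1.l2 = t.1.l3 ∧ r.1.l3 = t.1.l2 ∧ r.1.tot = t.1.tot then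
      ∑ σ ∈ Finset.range (𝒜.N t.1.l2 t.1.l3 r.1.mid),
        𝒜.F t.1.l1 t.1.l2 t.1.l3 t.1.tot t.1.mid t.1.α t.1.β r.1.mid σ r.1.β *
        conj (𝒜.R t.1.l3 t.1.l2 r.1.mid r.1.α σ)
    else 0 := by
  rw [Matrix.mul_apply]
  split_ifs with hl
  · obtain ⟨h1, h2, h3, h4⟩ := hl
    rw [sum_RT_alpha t.1.l1 t.1.l2 t.1.l3 r.1.mid t.1.tot r.1.β (by rw [← h1, ← h4]; exact r.2.2)
      (fun σ => 𝒜.F t.1.l1 t.1.l2 t.1.l3 t.1.tot t.1.mid t.1.α t.1.β r.1.mid σ r.1.β *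
        conj (𝒜.R t.1.l3 t.1.l2 r.1.mid r.1.α σ))]
    · intro t ht
      simp only [mF, mB2, Matrix.conjTranspose_apply] at ht
      split_ifs at ht with q1 q2 <;> simp_all
    · intro t q1 q2 q3 q4 q5 q6
      simp [mB2, mF, q1, q2, q3, q4, q5, q6, h1, h2, h3, h4]
  · refine Finset.sum_eq_zero fun t _ => ?_
    simp only [mB2, mF, Matrix.conjTranspose_apply]
    split_ifs with q1 q2 <;> simp_all

/-- Rows are the trees before a move and columns those after it, so products of tree matrices are
read from left to right. -/
lemma hexagon_matrix (h : 𝒜.IsModular) :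
    mF 𝒜 * (mC 𝒜 * mF 𝒜) = mB1 𝒜 * (mF 𝒜 * mB2 𝒜) := by
  ext t r
  rw [Matrix.mul_apply, Matrix.mul_apply]
  by_cases hl : r.1.l1 = t.1.l2 ∧ r.1.l2 = t.1.l3 ∧ r.1.l3 = t.1.l1 ∧ r.1.tot = t.1.tot
  · obtain ⟨h1, h2, h3, h4⟩ := hl
    have hx := h.hexagon t.1.l1 t.1.l2 t.1.l3 t.1.tot t.1.mid r.1.mid t.1.α t.1.β r.1.α r.1.β
      t.2.1 t.2.2 (by rw [← h2, ← h3]; exact r.2.1) (by rw [← h1, ← h4]; exact r.2.2)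
    rw [sum_RT_fix t.1.l1 t.1.l2 t.1.l3 t.1.tot (fun f μ ν =>
      ∑ ν' ∈ Finset.range (𝒜.N f t.1.l1 t.1.tot),
        𝒜.F t.1.l1 t.1.l2 t.1.l3 t.1.tot t.1.mid t.1.α t.1.β f μ ν * 𝒜.R t.1.l1 f t.1.tot ν ν' *
        𝒜.F t.1.l2 t.1.l3 t.1.l1 t.1.tot f μ ν' r.1.mid r.1.α r.1.β), hx,
      sum_LT_alpha t.1.l2 t.1.l1 t.1.l3 t.1.mid t.1.tot t.1.β t.2.2 (fun α' =>
        ∑ σ' ∈ Finset.range (𝒜.N t.1.l1 t.1.l3 r.1.mid),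
          𝒜.R t.1.l1 t.1.l2 t.1.mid t.1.α α' *
          𝒜.F t.1.l2 t.1.l1 t.1.l3 t.1.tot t.1.mid α' t.1.β r.1.mid σ' r.1.β *
          𝒜.R t.1.l1 t.1.l3 r.1.mid σ' r.1.α)]
    · intro t1 ht
      by_contra hc
      exact ht (by simp [mB1, hc])
    · intro t1 q1 q2 q3 q4 q5 q6
      rw [mF_mul_mB2]
      simp [mB1, q1, q2, q3, q4, q5, q6, h1, h2, h3, h4, Finset.mul_sum, mul_assoc]
    · intro t1 ht
      by_contra hc
      exact ht (by simp [mF, hc])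
    · intro t1 q1 q2 q3 q4
      rw [mC_mul_mF]
      simp [mF, q1, q2, q3, q4, h1, h2, h3, h4, Finset.mul_sum, mul_assoc]
  · rw [Finset.sum_eq_zero, Finset.sum_eq_zero]
    · intro b _
      rw [mF_mul_mB2]
      simp only [mB1]
      split_ifs with q1 q2 <;> simp_all
    · intro b _
      rw [mC_mul_mF]
      simp only [mF]
      split_ifs with q1 q2 <;> simp_all

lemma hexagon_inv_matrix (h : 𝒜.IsModular) :
    mF 𝒜 * ((mC' 𝒜)ᴴ * mF 𝒜) = (mB1 𝒜)ᴴ * (mF 𝒜 * (mB2 𝒜)ᴴ) := by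
  ext t r
  rw [Matrix.mul_apply, Matrix.mul_apply]
  by_cases hl : r.1.l1 = t.1.l2 ∧ r.1.l2 = t.1.l3 ∧ r.1.l3 = t.1.l1 ∧ r.1.tot = t.1.tot
  · obtain ⟨h1, h2, h3, h4⟩ := hl
    have hx := h.hexagon_inv t.1.l1 t.1.l2 t.1.l3 t.1.tot t.1.mid r.1.mid t.1.α t.1.β r.1.α r.1.β
      t.2.1 t.2.2 (by rw [← h2, ← h3]; exact r.2.1) (by rw [← h1, ← h4]; exact r.2.2)
    rw [sum_RT_fix t.1.l1 t.1.l2 t.1.l3 t.1.tot (fun f μ ν =>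
      ∑ ν' ∈ Finset.range (𝒜.N f t.1.l1 t.1.tot),
        𝒜.F t.1.l1 t.1.l2 t.1.l3 t.1.tot t.1.mid t.1.α t.1.β f μ ν *
        conj (𝒜.R f t.1.l1 t.1.tot ν' ν) *
        𝒜.F t.1.l2 t.1.l3 t.1.l1 t.1.tot f μ ν' r.1.mid r.1.α r.1.β), hx,
      sum_LT_alpha t.1.l2 t.1.l1 t.1.l3 t.1.mid t.1.tot t.1.β t.2.2 (fun α' =>
        ∑ σ' ∈ Finset.range (𝒜.N t.1.l1 t.1.l3 r.1.mid),
          conj (𝒜.R t.1.l2 t.1.l1 t.1.mid α' t.1.α) *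
          𝒜.F t.1.l2 t.1.l1 t.1.l3 t.1.tot t.1.mid α' t.1.β r.1.mid σ' r.1.β *
          conj (𝒜.R t.1.l3 t.1.l1 r.1.mid r.1.α σ'))]
    · intro t1 ht
      simp only [mB1, Matrix.conjTranspose_apply] at ht
      split_ifs at ht with q1 <;> simp_all
    · intro t1 q1 q2 q3 q4 q5 q6
      rw [mF_mul_mB2H]
      simp [mB1, q1, q2, q3, q4, q5, q6, h1, h2, h3, h4, Finset.mul_sum, mul_assoc]
    · intro t1 ht
      by_contra hc
      exact ht (by simp [mF, hc])
    · intro t1 q1 q2 q3 q4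
      rw [mC'H_mul_mF]
      simp [mF, q1, q2, q3, q4, h1, h2, h3, h4, Finset.mul_sum, mul_assoc]
  · rw [Finset.sum_eq_zero, Finset.sum_eq_zero]
    · intro b _
      rw [mF_mul_mB2H]
      simp only [mB1, Matrix.conjTranspose_apply]
      split_ifs with q1 q2 <;> simp_all
    · intro b _
      rw [mC'H_mul_mF]
      simp only [mF]
      split_ifs with q1 q2 <;> simp_all

end TreeMoves

end AnyonDecoder

/-! ### Braid relations, monodromies and strings on trees -/

namespace AnyonDecoder

open scoped Matrix ComplexConjugate

section TreeAlgebra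

open scoped Classical

variable {A : Type*} [Fintype A] {𝒜 : AnyonData A}

variable (𝒜) in
/-- The action of an operator on the last two leaves. -/
noncomputable def mG (G : PairOp A) : Matrix (RT 𝒜) (RT 𝒜) ℂ := fun r r' =>
  if r'.1.l1 = r.1.l1 ∧ r'.1.mid = r.1.mid ∧ r'.1.tot = r.1.tot ∧ r'.1.β = r.1.β then
    G r.1.l2 r.1.l3 r.1.mid r.1.α r'.1.l2 r'.1.l3 r'.1.α else 0

variable (𝒜) in
/-- An operator that does not act on the last two leaves. -/
noncomputable def mRoot (g : A → A → A → ℕ → A → A → ℕ → ℂ) : Matrix (RT 𝒜) (RT 𝒜) ℂ := fun r r' =>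
  if r'.1.l2 = r.1.l2 ∧ r'.1.l3 = r.1.l3 ∧ r'.1.mid = r.1.mid ∧ r'.1.α = r.1.α then
    g r.1.mid r.1.l1 r.1.tot r.1.β r'.1.l1 r'.1.tot r'.1.β else 0

lemma mRoot_conjTranspose (g : A → A → A → ℕ → A → A → ℕ → ℂ) :
    (mRoot 𝒜 g)ᴴ = mRoot 𝒜 fun m x z n x' z' n' => conj (g m x' z' n' x z n) := by
  ext r r'
  simp only [mRoot, Matrix.conjTranspose_apply]
  split_ifs with h1 h2 <;> simp_all

/-- One factor changes the last two leaves and their vertex, the other the first leaf, the root and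
the root vertex, and both keep the inner edge that they share. Hence each product has a single
intermediate tree. -/
lemma mG_mul_mRoot (G : PairOp A) (g : A → A → A → ℕ → A → A → ℕ → ℂ) :
    mG 𝒜 G * mRoot 𝒜 g = mRoot 𝒜 g * mG 𝒜 G := by
  ext r r'
  rw [Matrix.mul_apply, Matrix.mul_apply]
  by_cases hm : r'.1.mid = r.1.mid
  · have h1 := r.2.1
    have h2 := r.2.2
    have h3 := r'.2.1
    have h4 := r'.2.2
    rw [hm] at h3 h4
    let r1 : RT 𝒜 := ⟨⟨r.1.l1, r'.1.l2, r'.1.l3, r.1.mid, r.1.tot, r'.1.α, r.1.β⟩, h3, h2⟩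
    let r2 : RT 𝒜 := ⟨⟨r'.1.l1, r.1.l2, r.1.l3, r.1.mid, r'.1.tot, r.1.α, r'.1.β⟩, h1, h4⟩
    rw [Finset.sum_eq_single r1, Finset.sum_eq_single r2]
    · simp [mG, mRoot, r1, r2, hm, mul_comm]
    · intro b _ hb
      by_contra hc
      apply hb
      simp only [mG, mRoot] at hc
      split_ifs at hc with q1 q2 <;> simp_all [Subtype.ext_iff, Tree.ext_iff, r2]
    · simp
    · intro b _ hb
      by_contra hc
      apply hb
      simp only [mG, mRoot] at hc
      split_ifs at hc with q1 q2 <;> simp_all [Subtype.ext_iff, Tree.ext_iff, r1]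
    · simp
  · rw [Finset.sum_eq_zero, Finset.sum_eq_zero]
    · intro b _
      simp only [mG, mRoot]
      split_ifs with q1 q2 <;> simp_all
    · intro b _
      simp only [mG, mRoot]
      split_ifs with q1 q2 <;> simp_all

/-- Taking the first leaf once around the pair does not touch the vertex of the pair. This monodromy
is thus an operator at the root, and commutes with everything done inside the pair. -/
lemma mC_mul_mC' : mC 𝒜 * mC' 𝒜 = mRoot 𝒜 fun m x z n x' z' n' =>
    if x' = x ∧ z' = z then
      ∑ l ∈ Finset.range (𝒜.N m x z), 𝒜.R x m z n l * 𝒜.R m x z l n' else 0 := by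
  ext r r'
  rw [Matrix.mul_apply]
  simp only [mRoot]
  split_ifs with h1 h2
  · obtain ⟨h1, h3, h4, h5⟩ := h1
    obtain ⟨h6, h7⟩ := h2
    rw [sum_LT_beta r.1.l2 r.1.l3 r.1.l1 r.1.mid r.1.tot r.1.α r.2.1 (fun l =>
      𝒜.R r.1.l1 r.1.mid r.1.tot r.1.β l * 𝒜.R r.1.mid r.1.l1 r.1.tot l r'.1.β)]
    · intro t ht
      by_contra hc
      exact ht (by simp [mC, hc])
    · intro t q1 q2 q3 q4 q5 q6
      simp [mC, mC', q1, q2, q3, q4, q5, q6, h1, h3, h4, h5, h6, h7]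
  · refine Finset.sum_eq_zero fun t _ => ?_
    simp only [mC, mC']
    split_ifs with q1 q2 <;> simp_all
  · refine Finset.sum_eq_zero fun t _ => ?_
    simp only [mC, mC']
    split_ifs with q1 q2 <;> simp_all

lemma mB2_eq_mG : mB2 𝒜 = mG 𝒜 (exchange 𝒜) := by
  ext r r'
  simp only [mB2, mG, exchange]
  split_ifs with h1 h2 h3 <;> first | rfl | (exfalso; tauto)

variable (𝒜) in
/-- An operator on the last two leaves, on left trees. -/
noncomputable def mL (G : PairOp A) : Matrix (LT 𝒜) (LT 𝒜) ℂ := mF 𝒜 * mG 𝒜 G * (mF 𝒜)ᴴ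

variable (𝒜) in
/-- The exchange of the last two leaves, on left trees. -/
noncomputable abbrev mE : Matrix (LT 𝒜) (LT 𝒜) ℂ := mL 𝒜 (exchange 𝒜)

lemma mE_eq : mE 𝒜 = mF 𝒜 * mB2 𝒜 * (mF 𝒜)ᴴ := by rw [mE, mL, mB2_eq_mG]

section

variable (h : 𝒜.IsModular)
include h

lemma mF_cancel_left {n : Type*} [Fintype n] (M : Matrix (RT 𝒜) n ℂ) :
    (mF 𝒜)ᴴ * (mF 𝒜 * M) = M := by
  rw [← Matrix.mul_assoc, mF_conjTranspose_mul h, Matrix.one_mul]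

lemma mF_cancel_left' {n : Type*} [Fintype n] (M : Matrix (LT 𝒜) n ℂ) :
    mF 𝒜 * ((mF 𝒜)ᴴ * M) = M := by
  rw [← Matrix.mul_assoc, mF_mul_conjTranspose h, Matrix.one_mul]

/-- Passing a composite anyon is a product of elementary exchanges: the hexagon is solved for the
composite crossing, which is possible because `mF` is unitary. -/
lemma mC_eq : mC 𝒜 = (mF 𝒜)ᴴ * mB1 𝒜 * mF 𝒜 * mB2 𝒜 * (mF 𝒜)ᴴ := by
  have hx := hexagon_matrix h
  calc mC 𝒜 = (mF 𝒜)ᴴ * (mF 𝒜 * (mC 𝒜 * mF 𝒜)) * (mF 𝒜)ᴴ := by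
        rw [mF_cancel_left h, Matrix.mul_assoc, mF_mul_conjTranspose h, Matrix.mul_one]
    _ = _ := by rw [hx]; simp only [Matrix.mul_assoc]

lemma mC'_eq : mC' 𝒜 = mE 𝒜 * mB1 𝒜 * mF 𝒜 := by
  have hx := hexagon_inv_matrix h
  have : (mC' 𝒜)ᴴ = (mF 𝒜)ᴴ * (mB1 𝒜)ᴴ * (mF 𝒜 * (mB2 𝒜)ᴴ * (mF 𝒜)ᴴ) := by
    calc (mC' 𝒜)ᴴ = (mF 𝒜)ᴴ * (mF 𝒜 * ((mC' 𝒜)ᴴ * mF 𝒜)) * (mF 𝒜)ᴴ := by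
          rw [mF_cancel_left h, Matrix.mul_assoc, mF_mul_conjTranspose h, Matrix.mul_one]
      _ = _ := by rw [hx]; simp only [Matrix.mul_assoc]
  have := congrArg Matrix.conjTranspose this
  simp only [Matrix.conjTranspose_mul, Matrix.conjTranspose_conjTranspose] at this
  rw [this, mE_eq]
  simp only [Matrix.mul_assoc]

/-- The monodromy of the last leaf with the first two. -/
lemma mC'_mul_mC : mC' 𝒜 * mC 𝒜 = mE 𝒜 * (mB1 𝒜 * mB1 𝒜) * mE 𝒜 := by
  rw [mC'_eq h, mC_eq h, mE_eq]
  simp only [Matrix.mul_assoc, mF_cancel_left' h]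

/-- The hexagon expression of `mC'` is substituted into the naturality relation `mB1_mul_mC'`, and
the `F`-move is cancelled. -/
lemma yang_baxter : mB1 𝒜 * mE 𝒜 * mB1 𝒜 = mE 𝒜 * mB1 𝒜 * mE 𝒜 := by
  have hx := mB1_mul_mC' (𝒜 := 𝒜)
  rw [mC'_eq h] at hx
  have := congrArg (· * (mF 𝒜)ᴴ) hx
  simp only [Matrix.mul_assoc, mF_mul_conjTranspose h, Matrix.mul_one] at this
  rw [Matrix.mul_assoc, Matrix.mul_assoc, this]
  congr 2
  rw [mE_eq, Matrix.mul_assoc]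

lemma mF_mC_mC' : mF 𝒜 * (mC 𝒜 * mC' 𝒜) * (mF 𝒜)ᴴ = mB1 𝒜 * mE 𝒜 * mE 𝒜 * mB1 𝒜 := by
  rw [mC_eq h, mC'_eq h, mE_eq]
  simp only [Matrix.mul_assoc, mF_cancel_left' h, mF_cancel_left h, mF_mul_conjTranspose h,
    Matrix.mul_one]

/-- The braid word is the monodromy of the first leaf with the pair of the other two, written on
left trees, and on right trees it acts only at the root. -/
lemma mL_comm_pairMonodromy (G : PairOp A) :
    mL 𝒜 G * (mB1 𝒜 * mE 𝒜 * mE 𝒜 * mB1 𝒜) = mB1 𝒜 * mE 𝒜 * mE 𝒜 * mB1 𝒜 * mL 𝒜 G := by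
  rw [← mF_mC_mC' h, mC_mul_mC']
  simp only [mL, Matrix.mul_assoc, mF_cancel_left h]
  rw [← Matrix.mul_assoc (mG 𝒜 G), mG_mul_mRoot, Matrix.mul_assoc]

lemma mE_mul_conjTranspose : mE 𝒜 * (mE 𝒜)ᴴ = 1 := by
  rw [mE_eq]
  simp only [Matrix.conjTranspose_mul, Matrix.conjTranspose_conjTranspose, Matrix.mul_assoc,
    mF_cancel_left h]
  rw [← Matrix.mul_assoc (mB2 𝒜), mB2_mul_conjTranspose h, Matrix.one_mul, mF_mul_conjTranspose h]

lemma mE_conjTranspose_mul : (mE 𝒜)ᴴ * mE 𝒜 = 1 := mul_eq_one_comm.mp (mE_mul_conjTranspose h)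

/-- Both anyons of a pair are carried around the chain line. -/
lemma monodromy_pair (G : PairOp A) :
    (mB1 𝒜 * mB1 𝒜) * (mC' 𝒜 * mC 𝒜) * mL 𝒜 G =
      (mE 𝒜 * mE 𝒜 * mL 𝒜 G * (mE 𝒜)ᴴ * (mE 𝒜)ᴴ) * ((mB1 𝒜 * mB1 𝒜) * (mC' 𝒜 * mC 𝒜)) := by
  set b := mB1 𝒜
  set e := mE 𝒜
  set N := b * e * e * b with hN
  have hyb : b * e * b = e * b * e := yang_baxter h
  -- Winding the two leaves one after the other around the first line amounts to a double exchange
  -- of the leaves times the monodromy `N` of the line with the pair. As `N` commutes with operators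
  -- inside the pair, only a conjugation by the double exchange survives.
  have hD : (b * b) * (mC' 𝒜 * mC 𝒜) = e * e * N := by
    have hc : e * N = N * e := mL_comm_pairMonodromy h (exchange 𝒜)
    rw [mC'_mul_mC h]
    calc b * b * (e * (b * b) * e) = b * (b * e * b) * (b * e) := by simp only [Matrix.mul_assoc]
      _ = b * (e * b * e) * (b * e) := by rw [hyb]
      _ = b * e * (b * e * b) * e := by simp only [Matrix.mul_assoc]
      _ = b * e * (e * b * e) * e := by rw [hyb]
      _ = N * e * e := by rw [hN]; simp only [Matrix.mul_assoc]
      _ = e * e * N := by rw [← hc, Matrix.mul_assoc, ← hc, Matrix.mul_assoc]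
  have hu : (mE 𝒜)ᴴ * mE 𝒜 = 1 := mE_conjTranspose_mul h
  rw [hD, Matrix.mul_assoc, ← mL_comm_pairMonodromy h G]
  have : (mE 𝒜)ᴴ * (mE 𝒜)ᴴ * (e * e * N) = N := by
    calc (mE 𝒜)ᴴ * (mE 𝒜)ᴴ * (e * e * N) = (mE 𝒜)ᴴ * ((mE 𝒜)ᴴ * mE 𝒜) * mE 𝒜 * N := by
          simp only [Matrix.mul_assoc, e]
      _ = N := by rw [hu, Matrix.mul_one, hu, Matrix.one_mul]
  calc e * e * (mL 𝒜 G * N) = e * e * mL 𝒜 G * N := by simp only [Matrix.mul_assoc]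
    _ = e * e * mL 𝒜 G * ((mE 𝒜)ᴴ * (mE 𝒜)ᴴ * (e * e * N)) := by rw [this]
    _ = _ := by simp only [Matrix.mul_assoc, e]

end

/-! ### Fusing a string into a tree from the left -/

variable (𝒜) in
/-- Two adjacent tensors of the string operator. -/
noncomputable def mW (X : A) (i j : ℕ) : Matrix (LT 𝒜) (LT 𝒜) ℂ := fun t' t =>
  if t'.1.l2 = t.1.l2 ∧ t'.1.l3 = t.1.l3 ∧ i < 𝒜.N X t.1.l1 t'.1.l1 ∧ j < 𝒜.N X t.1.tot t'.1.tot then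
    ∑ ρ ∈ Finset.range (𝒜.N X t.1.mid t'.1.mid),
      𝒜.F X t.1.l1 t.1.l2 t'.1.mid t'.1.l1 i t'.1.α t.1.mid t.1.α ρ *
      𝒜.F X t.1.mid t.1.l3 t'.1.tot t'.1.mid ρ t'.1.β t.1.tot t.1.β j
  else 0

/-- A string fused into the line of a left tree passes two vertices. In this form the pentagon says
that on right trees the same string meets only the root vertex. -/
lemma pentagon_matrix (h : 𝒜.IsModular) (X : A) (i j : ℕ) :
    mF 𝒜 * mRoot 𝒜 (fun m x' z' n' x z n => if i < 𝒜.N X x x' ∧ j < 𝒜.N X z z' then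
      𝒜.F X x m z' x' i n' z n j else 0) = mW 𝒜 X i j * mF 𝒜 := by
  ext t r
  rw [Matrix.mul_apply, Matrix.mul_apply]
  by_cases hl : t.1.l2 = r.1.l2 ∧ t.1.l3 = r.1.l3 ∧ i < 𝒜.N X r.1.l1 t.1.l1 ∧
      j < 𝒜.N X r.1.tot t.1.tot
  · obtain ⟨h1, h2, h3, h4⟩ := hl
    have hx := h.pentagon X r.1.l1 r.1.l2 r.1.l3 t.1.tot t.1.l1 t.1.mid r.1.mid r.1.tot i t.1.α
      t.1.β r.1.α r.1.β j h3 (by rw [← h1]; exact t.2.1) (by rw [← h2]; exact t.2.2) r.2.1 r.2.2 h4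
    rw [sum_RT_beta t.1.l1 r.1.l2 r.1.l3 r.1.mid t.1.tot r.1.α r.2.1 (fun ε =>
      𝒜.F t.1.l1 r.1.l2 r.1.l3 t.1.tot t.1.mid t.1.α t.1.β r.1.mid r.1.α ε *
      𝒜.F X r.1.l1 r.1.mid t.1.tot t.1.l1 i ε r.1.tot r.1.β j), hx,
      sum_LT_fix r.1.l1 r.1.l2 r.1.l3 r.1.tot (fun m σ τ =>
        (∑ ρ ∈ Finset.range (𝒜.N X m t.1.mid),
        𝒜.F X r.1.l1 r.1.l2 t.1.mid t.1.l1 i t.1.α m σ ρ *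
        𝒜.F X m r.1.l3 t.1.tot t.1.mid ρ t.1.β r.1.tot τ j) *
        𝒜.F r.1.l1 r.1.l2 r.1.l3 r.1.tot m σ τ r.1.mid r.1.α r.1.β)]
    · refine Finset.sum_congr rfl fun m _ => Finset.sum_congr rfl fun σ _ => ?_
      rw [Finset.sum_comm]
      simp only [Finset.sum_mul]
    · intro t' ht
      simp only [mW, mF] at ht
      split_ifs at ht with q1 q2 <;> simp_all
    · intro t' q1 q2 q3 q4
      simp [mF, mW, q1, q2, q3, q4, h1, h2, h3, h4]
    · intro r' ht
      simp only [mRoot, mF] at ht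
      split_ifs at ht with q1 q2 <;> simp_all
    · intro r' q1 q2 q3 q4 q5 q6
      simp [mRoot, mF, q1, q2, q3, q4, q5, q6, h1, h2, h3, h4]
  · rw [Finset.sum_eq_zero, Finset.sum_eq_zero]
    · intro b _
      simp only [mW, mF]
      split_ifs with q1 q2 <;> simp_all
    · intro b _
      simp only [mRoot, mF]
      split_ifs with q1 q2 q3
      · exact absurd ⟨by rw [q2.1, q1.2.1], by rw [q2.2.1, q1.2.2.1],
          by rw [← q1.1]; exact q3.1, by rw [← q1.2.2.2]; exact q3.2⟩ hl
      all_goals simp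

/-- On right trees the string acts at the root, so it commutes with operators inside the pair of the
last two leaves. The adjoint is the form in which the tensors enter `stringOp`. -/
lemma mL_mul_mW (h : 𝒜.IsModular) (G : PairOp A) (X : A) (i j : ℕ) :
    mL 𝒜 G * (mW 𝒜 X i j)ᴴ = (mW 𝒜 X i j)ᴴ * mL 𝒜 G := by
  have hp := congrArg (· * (mF 𝒜)ᴴ) (pentagon_matrix h X i j)
  simp only [Matrix.mul_assoc, mF_mul_conjTranspose h, Matrix.mul_one] at hp
  rw [← hp]
  simp only [Matrix.conjTranspose_mul, Matrix.conjTranspose_conjTranspose, mRoot_conjTranspose, mL,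
    Matrix.mul_assoc, mF_cancel_left h]
  rw [← Matrix.mul_assoc (mG 𝒜 G), mG_mul_mRoot, Matrix.mul_assoc]

end TreeAlgebra

end AnyonDecoder

/-! ### Arithmetic of the positions along the chain -/

namespace AnyonDecoder

open scoped Matrix ComplexConjugate

namespace Params

variable (P : Params)

lemma twenty_le_L : 20 ≤ P.L := by
  have h1 := P.le_Q
  have h2 := P.three_le_a
  have h3 : P.Q ^ 1 ≤ P.Q ^ P.n := Nat.pow_le_pow_right (by omega) P.n_pos
  simp only [pow_one] at h3
  unfold L
  omega

/-- The positions of the chain, counted from the south end of the column `x`. -/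
def slotAt (x : ZMod P.L) (n : ℕ) : P.Slot :=
  ((x + ((n / (2 * P.L) : ℕ) : ZMod P.L), ((n / 2 : ℕ) : ZMod P.L)), decide (n % 2 = 1))

lemma next_slotAt (x : ZMod P.L) (n : ℕ) : P.next (P.slotAt x n) = P.slotAt x (n + 1) := by
  have hL := P.twenty_le_L
  have hd : ∀ m, m / (2 * P.L) = m / 2 / P.L := fun m => (Nat.div_div_eq_div_mul m 2 P.L).symm
  rcases Nat.mod_two_eq_zero_or_one n with h | h
  · have h1 : (n + 1) / 2 = n / 2 := by omega
    have h2 : (n + 1) % 2 = 1 := by omega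
    simp [next, slotAt, hd, h, h1, h2]
  · have h1 : (n + 1) / 2 = n / 2 + 1 := by omega
    have h2 : (n + 1) % 2 = 0 := by omega
    have h3 : (((n / 2 : ℕ) : ZMod P.L) = -1) ↔ P.L ∣ n / 2 + 1 := by
      rw [eq_neg_iff_add_eq_zero, ← ZMod.natCast_eq_zero_iff]
      push_cast
      rfl
    by_cases hw : P.L ∣ n / 2 + 1
    · have h4 := h3.2 hw
      have h5 : (n / 2 + 1) / P.L = n / 2 / P.L + 1 := by
        rw [Nat.succ_div, if_pos hw]
      simp [next, slotAt, hd, h, h1, h2, h4, h5]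
      ring
    · have h5 : (n / 2 + 1) / P.L = n / 2 / P.L := by
        rw [Nat.succ_div, if_neg hw, Nat.add_zero]
      simp [next, slotAt, hd, h, h1, h2, mt h3.1 hw, h5]

lemma next_iterate_slotAt (x : ZMod P.L) (n d : ℕ) :
    P.next^[d] (P.slotAt x n) = P.slotAt x (n + d) := by
  induction d with
  | zero => rfl
  | succ d ih => rw [Function.iterate_succ_apply', ih, next_slotAt]; rfl

/-- The chain closes after `2 * L * L` positions: `L` columns of `L` sites with two slots each. -/
lemma slotAt_injOn (x : ZMod P.L) {n m : ℕ} (hn : n < 2 * P.L * P.L) (hm : m < 2 * P.L * P.L)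
    (h : P.slotAt x n = P.slotAt x m) : n = m := by
  have hL := P.twenty_le_L
  simp only [slotAt, Prod.mk.injEq, add_right_inj, ZMod.natCast_eq_natCast_iff', decide_eq_decide]
    at h
  obtain ⟨⟨h1, h2⟩, h3⟩ := h
  rw [Nat.mod_eq_of_lt (Nat.div_lt_of_lt_mul hn), Nat.mod_eq_of_lt (Nat.div_lt_of_lt_mul hm),
    ← Nat.div_div_eq_div_mul, ← Nat.div_div_eq_div_mul] at h1
  have h4 := Nat.div_add_mod (n / 2) P.L
  have h5 := Nat.div_add_mod (m / 2) P.L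
  rw [h1, h2] at h4
  omega

lemma eq_slotAt (p : P.Slot) :
    p = P.slotAt p.1.1 (2 * p.1.2.val + if p.2 then 1 else 0) := by
  obtain ⟨⟨x, y⟩, c⟩ := p
  have hL := P.twenty_le_L
  have hy := ZMod.val_lt y
  have h1 : (2 * y.val + if c then 1 else 0) / 2 = y.val := by cases c <;> simp ; omega
  have h2 : (2 * y.val + if c then 1 else 0) / (2 * P.L) = 0 := by
    apply Nat.div_eq_of_lt; cases c <;> simp <;> omega
  have h3 : (2 * y.val + if c then 1 else 0) % 2 = if c then 1 else 0 := by
    cases c <;> simp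
  simp only [slotAt, h1, h2, h3]
  cases c <;> simp

lemma eq_slotAt' (p : P.Slot) : ∃ n < 2 * P.L, p = P.slotAt p.1.1 n := by
  refine ⟨_, ?_, P.eq_slotAt p⟩
  have hy := ZMod.val_lt p.1.2
  split_ifs <;> omega

/-- The bound `2 * L + 1` is the longest distance over which an anyon is displaced: one column, plus
the offset between the two slots of a site. -/
lemma next_iterate_ne (p : P.Slot) {i j : ℕ} (hij : i < j) (hj : j ≤ 2 * P.L + 1) :
    P.next^[i] p ≠ P.next^[j] p := by
  obtain ⟨n, hn, hp⟩ := P.eq_slotAt' p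
  have hL := P.twenty_le_L
  rw [hp, next_iterate_slotAt, next_iterate_slotAt]
  intro h
  have := P.slotAt_injOn p.1.1 (by nlinarith) (by nlinarith) h
  omega

lemma next_ne (p : P.Slot) : P.next p ≠ p := by
  have := P.next_iterate_ne p (i := 0) (j := 1) (by omega) (by omega)
  exact fun h => this h.symm

lemma next_next_ne (p : P.Slot) : P.next (P.next p) ≠ p := by
  have := P.next_iterate_ne p (i := 0) (j := 2) (by omega) (by have := P.twenty_le_L; omega)
  exact fun h => this h.symm

lemma next_injective : Function.Injective P.next := by
  rw [Finite.injective_iff_surjective]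
  intro p
  obtain ⟨n, hn, hp⟩ := P.eq_slotAt' p
  rcases n with _ | n
  · refine ⟨P.slotAt (p.1.1 - 1) (2 * P.L - 1), ?_⟩
    have hL := P.twenty_le_L
    rw [next_slotAt, hp, Nat.sub_add_cancel (by omega)]
    have h1 : (2 * P.L) / 2 = P.L := by omega
    have h2 : (2 * P.L) / (2 * P.L) = 1 := Nat.div_self (by omega)
    simp [slotAt, h1, h2]
  · exact ⟨P.slotAt p.1.1 n, by rw [next_slotAt, ← hp]⟩

end Params

/-! ### Operators on two adjacent positions as matrices on trees -/

section LocalOperators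

open scoped Classical

variable {A : Type*} [Fintype A] {𝒜 : AnyonData A} {P : Params}

/-- The configurations differ at most in what lies between the lines entering `p` and leaving
`next p`. -/
def Agree (p : P.Slot) (s s' : Config 𝒜 P) : Prop :=
  (∀ u, u ≠ P.next p → s'.1 u = s.1 u) ∧
    ∀ u, u ≠ p → u ≠ P.next p → s'.2.1 u = s.2.1 u ∧ s'.2.2 u = s.2.2 u

lemma Agree.symm {p : P.Slot} {s s' : Config 𝒜 P} (h : Agree p s s') : Agree p s' s :=
  ⟨fun u hu => (h.1 u hu).symm, fun u h1 h2 => ⟨(h.2 u h1 h2).1.symm, (h.2 u h1 h2).2.symm⟩⟩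

lemma Agree.trans {p : P.Slot} {s s' s'' : Config 𝒜 P} (h : Agree p s s') (h' : Agree p s' s'') :
    Agree p s s'' :=
  ⟨fun u hu => (h'.1 u hu).trans (h.1 u hu), fun u h1 h2 =>
    ⟨(h'.2 u h1 h2).1.trans (h.2 u h1 h2).1, (h'.2 u h1 h2).2.trans (h.2 u h1 h2).2⟩⟩

/-- The part of a configuration at `p` and `next p`. -/
def loc (p : P.Slot) (s : Config 𝒜 P) (hs : s.Valid) : LT 𝒜 :=
  ⟨⟨s.1 p, s.2.1 p, s.2.1 (P.next p), s.1 (P.next p), s.1 (P.next (P.next p)), s.2.2 p,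
    s.2.2 (P.next p)⟩, hs p, hs (P.next p)⟩

/-- The configuration with another part at `p` and `next p`. -/
noncomputable def setLoc (p : P.Slot) (s : Config 𝒜 P) (t : LT 𝒜) : Config 𝒜 P :=
  (Function.update s.1 (P.next p) t.1.mid,
    Function.update (Function.update s.2.1 p t.1.l2) (P.next p) t.1.l3,
    Function.update (Function.update s.2.2 p t.1.α) (P.next p) t.1.β)

lemma agree_setLoc (p : P.Slot) (s : Config 𝒜 P) (t : LT 𝒜) : Agree p s (setLoc p s t) := by
  refine ⟨fun u hu => ?_, fun u h1 h2 => ?_⟩ <;> simp_all [setLoc]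

lemma valid_setLoc (p : P.Slot) (s : Config 𝒜 P) (t : LT 𝒜) (hs : s.Valid)
    (h1 : t.1.l1 = s.1 p) (h2 : t.1.tot = s.1 (P.next (P.next p))) : (setLoc p s t).Valid := by
  intro u
  have hq := P.next_ne p
  have hz := P.next_ne (P.next p)
  have hp := P.next_next_ne p
  by_cases hu : u = p
  · subst hu
    simp only [setLoc, Function.update_self, Function.update_of_ne hq.symm]
    rw [← h1]
    exact t.2.1
  by_cases hu' : u = P.next p
  · subst hu'
    simp only [setLoc, Function.update_self, Function.update_of_ne hz]
    rw [← h2]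
    exact t.2.2
  have hn : P.next u ≠ P.next p := fun h => hu (P.next_injective h)
  simp only [setLoc, Function.update_of_ne hu, Function.update_of_ne hu', Function.update_of_ne hn]
  exact hs u

lemma loc_setLoc (p : P.Slot) (s : Config 𝒜 P) (t : LT 𝒜) (hv : (setLoc p s t).Valid)
    (h1 : t.1.l1 = s.1 p) (h2 : t.1.tot = s.1 (P.next (P.next p))) :
    loc p (setLoc p s t) hv = t := by
  have hq := P.next_ne p
  have hz := P.next_ne (P.next p)
  apply Subtype.ext
  ext <;> simp [loc, setLoc, hq.symm, hz, h1, h2]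

lemma setLoc_loc (p : P.Slot) (s s' : Config 𝒜 P) (hv : s'.Valid) (h : Agree p s s') :
    setLoc p s (loc p s' hv) = s' := by
  have hq := P.next_ne p
  refine Prod.ext (funext fun u => ?_) (Prod.ext (funext fun u => ?_) (funext fun u => ?_))
  · by_cases hu : u = P.next p
    · subst hu; simp [setLoc, loc]
    · simp [setLoc, hu, h.1 u hu]
  all_goals
    by_cases hu : u = P.next p
    · subst hu; simp [setLoc, loc]
    · by_cases hu' : u = p
      · subst hu'; simp [setLoc, loc, hu]
      · have := h.2 u hu' hu
        simp [setLoc, hu, hu', this.1, this.2]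

/-- The operator acting on the part of configurations at `p` and `next p`. -/
noncomputable def locOp (p : P.Slot) (M : Matrix (LT 𝒜) (LT 𝒜) ℂ) : Op 𝒜 P := fun s' s =>
  if h : s.Valid ∧ s'.Valid ∧ Agree p s s' then M (loc p s h.1) (loc p s' h.2.1) else 0

/-- Matrices that preserve the first leaf and the root. -/
def Pres {p q : Tree 𝒜 → Prop} (M : Matrix (Subtype p) (Subtype q) ℂ) : Prop :=
  ∀ t t', M t t' ≠ 0 → t'.1.l1 = t.1.l1 ∧ t'.1.tot = t.1.tot

lemma Pres.mul {p q r : Tree 𝒜 → Prop} [Fintype (Subtype q)] {M : Matrix (Subtype p) (Subtype q) ℂ}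
    {M' : Matrix (Subtype q) (Subtype r) ℂ} (h : Pres M) (h' : Pres M') : Pres (M * M') := by
  intro t t' ht
  rw [Matrix.mul_apply] at ht
  obtain ⟨t1, -, h1⟩ := Finset.exists_ne_zero_of_sum_ne_zero ht
  have h2 := h _ _ (left_ne_zero_of_mul h1)
  have h3 := h' _ _ (right_ne_zero_of_mul h1)
  exact ⟨h3.1.trans h2.1, h3.2.trans h2.2⟩

lemma Pres.conjTranspose {p q : Tree 𝒜 → Prop} {M : Matrix (Subtype p) (Subtype q) ℂ}
    (h : Pres M) : Pres Mᴴ := by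
  intro t t' ht
  have := h t' t (by simpa [Matrix.conjTranspose_apply] using ht)
  exact ⟨this.1.symm, this.2.symm⟩

lemma pres_mF : Pres (mF 𝒜) := by
  intro t r h
  simp only [mF] at h
  split_ifs at h with h1
  · exact ⟨h1.1, h1.2.2.2⟩
  · exact absurd rfl h

lemma pres_mG (G : PairOp A) : Pres (mG 𝒜 G) := by
  intro t r h
  simp only [mG] at h
  split_ifs at h with h1
  · exact ⟨h1.1, h1.2.2.1⟩
  · exact absurd rfl h

lemma pres_mL (G : PairOp A) : Pres (mL 𝒜 G) :=
  (pres_mF.mul (pres_mG G)).mul pres_mF.conjTranspose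

lemma locOp_conjTranspose (p : P.Slot) (M : Matrix (LT 𝒜) (LT 𝒜) ℂ) :
    (locOp p M)ᴴ = (locOp p Mᴴ : Op 𝒜 P) := by
  ext s' s
  simp only [locOp, Matrix.conjTranspose_apply]
  split_ifs with h1 h2 h2
  · rfl
  · exact absurd ⟨h1.2.1, h1.1, h1.2.2.symm⟩ h2
  · exact absurd ⟨h2.2.1, h2.1, h2.2.2.symm⟩ h1
  · simp

lemma Agree.loc_l1 {p : P.Slot} {s s' : Config 𝒜 P} (h : Agree p s s') : s'.1 p = s.1 p :=
  h.1 p (P.next_ne p).symm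

lemma Agree.loc_tot {p : P.Slot} {s s' : Config 𝒜 P} (h : Agree p s s') :
    s'.1 (P.next (P.next p)) = s.1 (P.next (P.next p)) :=
  h.1 _ (P.next_ne (P.next p))

lemma loc_congr (p : P.Slot) {s s' : Config 𝒜 P} (h : s = s') (hs : s.Valid) (hs' : s'.Valid) :
    loc p s hs = loc p s' hs' := by
  subst h
  rfl

lemma locOp_pos {p : P.Slot} {M : Matrix (LT 𝒜) (LT 𝒜) ℂ} {s s' : Config 𝒜 P} (h : s.Valid)
    (h' : s'.Valid) (ha : Agree p s s') : locOp p M s' s = M (loc p s h) (loc p s' h') :=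
  dif_pos ⟨h, h', ha⟩

lemma locOp_ne_zero {p : P.Slot} {M : Matrix (LT 𝒜) (LT 𝒜) ℂ} {s s' : Config 𝒜 P}
    (h : locOp p M s' s ≠ 0) : s.Valid ∧ s'.Valid ∧ Agree p s s' := by
  by_contra hc
  exact h (dif_neg hc)

/-- The order is reversed, as tree matrices have their input as row index and operators as column
index. Preservation of the first leaf and the root by the factor acting first lets every
intermediate tree fit into the unchanged surroundings. -/
lemma locOp_mul (p : P.Slot) {M M' : Matrix (LT 𝒜) (LT 𝒜) ℂ} (hM : Pres M') :
    locOp p M * locOp p M' = (locOp p (M' * M) : Op 𝒜 P) := by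
  ext s'' s
  rw [Matrix.mul_apply]
  by_cases h : s.Valid ∧ s''.Valid ∧ Agree p s s''
  · rw [locOp_pos h.1 h.2.1 h.2.2, Matrix.mul_apply]
    symm
    have hl : ∀ t : LT 𝒜, M' (loc p s h.1) t * M t (loc p s'' h.2.1) ≠ 0 →
        t.1.l1 = s.1 p ∧ t.1.tot = s.1 (P.next (P.next p)) := fun t ht =>
      hM _ _ (left_ne_zero_of_mul ht)
    have hv : ∀ t : LT 𝒜, M' (loc p s h.1) t * M t (loc p s'' h.2.1) ≠ 0 → (setLoc p s t).Valid :=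
      fun t ht => valid_setLoc p s t h.1 (hl t ht).1 (hl t ht).2
    refine Finset.sum_bij_ne_zero (fun t _ _ => setLoc p s t) (fun _ _ _ => Finset.mem_univ _)
      ?_ ?_ ?_
    · intro t _ ht t' _ ht' he
      rw [← loc_setLoc p s t (hv t ht) (hl t ht).1 (hl t ht).2,
        ← loc_setLoc p s t' (hv t' ht') (hl t' ht').1 (hl t' ht').2]
      exact loc_congr p he _ _
    · intro s' _ hs'
      have h1 := locOp_ne_zero (left_ne_zero_of_mul hs')
      have h2 := locOp_ne_zero (right_ne_zero_of_mul hs')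
      refine ⟨loc p s' h1.1, Finset.mem_univ _, ?_, setLoc_loc p s s' h1.1 h2.2.2⟩
      rw [locOp_pos h1.1 h1.2.1 h1.2.2, locOp_pos h2.1 h2.2.1 h2.2.2] at hs'
      rw [mul_comm]
      exact hs'
    · intro t _ ht
      have ha := agree_setLoc p s t
      rw [locOp_pos (hv t ht) h.2.1 (ha.symm.trans h.2.2), locOp_pos h.1 (hv t ht) ha,
        loc_setLoc p s t (hv t ht) (hl t ht).1 (hl t ht).2, mul_comm]
  · rw [locOp, dif_neg h]
    refine Finset.sum_eq_zero fun s' _ => ?_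
    by_contra hc
    have h1 := locOp_ne_zero (left_ne_zero_of_mul hc)
    have h2 := locOp_ne_zero (right_ne_zero_of_mul hc)
    exact h ⟨h2.1, h1.2.1, h2.2.2.trans h1.2.2⟩

variable (𝒜 P) in
/-- The projector onto valid configurations. -/
noncomputable def validProj : Op 𝒜 P := Matrix.diagonal fun s => if s.Valid then 1 else 0

/-- Local operators vanish on invalid configurations, so unitary tree moves become unitary only on
the valid ones, and `validProj` takes the place of the identity. -/
lemma locOp_one (p : P.Slot) : locOp p 1 = validProj 𝒜 P := by
  ext s' s
  simp only [locOp, validProj, Matrix.diagonal_apply]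
  by_cases he : s' = s
  · subst he
    by_cases hv : s'.Valid
    · rw [dif_pos ⟨hv, hv, fun _ _ => rfl, fun _ _ _ => ⟨rfl, rfl⟩⟩]
      simp [hv]
    · rw [dif_neg (fun h => hv h.1)]
      simp [hv]
  · rw [if_neg he]
    split_ifs with h
    · rw [Matrix.one_apply_ne]
      intro hl
      apply he
      rw [← setLoc_loc p s s' h.2.1 h.2.2, ← hl, setLoc_loc]
      exact ⟨fun _ _ => rfl, fun _ _ _ => ⟨rfl, rfl⟩⟩
    · rfl

lemma validProj_mul_locOp (p : P.Slot) (M : Matrix (LT 𝒜) (LT 𝒜) ℂ) :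
    validProj 𝒜 P * locOp p M = locOp p M := by
  ext s' s
  rw [validProj, Matrix.diagonal_mul]
  simp only [locOp]
  split_ifs with h1 h2 <;> simp_all

lemma locOp_mul_validProj (p : P.Slot) (M : Matrix (LT 𝒜) (LT 𝒜) ℂ) :
    locOp p M * validProj 𝒜 P = locOp p M := by
  ext s' s
  rw [validProj, Matrix.mul_diagonal]
  simp only [locOp]
  split_ifs with h1 h2 <;> simp_all

lemma mF_mul_mG (G : PairOp A) (t : LT 𝒜) (r : RT 𝒜) : (mF 𝒜 * mG 𝒜 G) t r =
    if r.1.l1 = t.1.l1 ∧ r.1.tot = t.1.tot then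
      ∑ κ ∈ Finset.range (𝒜.N t.1.l2 t.1.l3 r.1.mid),
        𝒜.F t.1.l1 t.1.l2 t.1.l3 t.1.tot t.1.mid t.1.α t.1.β r.1.mid κ r.1.β *
        G t.1.l2 t.1.l3 r.1.mid κ r.1.l2 r.1.l3 r.1.α
    else 0 := by
  rw [Matrix.mul_apply]
  split_ifs with hl
  · obtain ⟨h1, h4⟩ := hl
    rw [sum_RT_alpha t.1.l1 t.1.l2 t.1.l3 r.1.mid t.1.tot r.1.β (by rw [← h1, ← h4]; exact r.2.2)
      (fun σ => 𝒜.F t.1.l1 t.1.l2 t.1.l3 t.1.tot t.1.mid t.1.α t.1.β r.1.mid σ r.1.β *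
        G t.1.l2 t.1.l3 r.1.mid σ r.1.l2 r.1.l3 r.1.α)]
    · intro t ht
      simp only [mF, mG] at ht
      split_ifs at ht with q1 q2 <;> simp_all
    · intro t q1 q2 q3 q4 q5 q6
      simp [mG, mF, q1, q2, q3, q4, q5, q6, h1, h4]
  · refine Finset.sum_eq_zero fun t _ => ?_
    simp only [mG, mF]
    split_ifs with q1 q2 <;> simp_all

lemma lift_eq_locOp (G : PairOp A) (p : P.Slot) : lift 𝒜 P G p = locOp p (mL 𝒜 G) := by
  ext s' s
  simp only [lift, locOp]
  by_cases h : s.Valid ∧ s'.Valid ∧ Agree p s s'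
  · refine (if_pos h).trans ?_
    rw [dif_pos h, mL, Matrix.mul_apply]
    have h1 := h.2.2.loc_l1
    have h4 := h.2.2.loc_tot
    rw [sum_RT_fix (s'.1 p) (s'.2.1 p) (s'.2.1 (P.next p)) (s'.1 (P.next (P.next p)))
      (fun e κ' m => ∑ κ ∈ Finset.range (𝒜.N (s.2.1 p) (s.2.1 (P.next p)) e),
        𝒜.F (s.1 p) (s.2.1 p) (s.2.1 (P.next p)) (s.1 (P.next (P.next p))) (s.1 (P.next p))
          (s.2.2 p) (s.2.2 (P.next p)) e κ m *
        G (s.2.1 p) (s.2.1 (P.next p)) e κ (s'.2.1 p) (s'.2.1 (P.next p)) κ' *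
        conj (𝒜.F (s.1 p) (s'.2.1 p) (s'.2.1 (P.next p)) (s.1 (P.next (P.next p)))
          (s'.1 (P.next p)) (s'.2.2 p) (s'.2.2 (P.next p)) e κ' m))]
    · refine Finset.sum_congr rfl fun e _ => ?_
      rw [Finset.sum_comm]
      refine Finset.sum_congr rfl fun κ' _ => ?_
      rw [Finset.sum_comm, h1, h4]
    · intro r hr
      have := right_ne_zero_of_mul hr
      by_contra hc
      exact this (by simp [mF, loc, hc])
    · intro r q1 q2 q3 q4
      rw [mF_mul_mG]
      simp [loc, mF, q1, q2, q3, q4, h1, h4, Finset.sum_mul]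
  · rw [dif_neg h]
    exact if_neg h

lemma mB1_mul_mB1 (t t' : LT 𝒜) : (mB1 𝒜 * mB1 𝒜) t t' =
    if t'.1.l1 = t.1.l1 ∧ t'.1.l2 = t.1.l2 ∧ t'.1.l3 = t.1.l3 ∧ t'.1.mid = t.1.mid ∧
      t'.1.tot = t.1.tot ∧ t'.1.β = t.1.β then
      ∑ l ∈ Finset.range (𝒜.N t.1.l2 t.1.l1 t.1.mid),
        𝒜.R t.1.l1 t.1.l2 t.1.mid t.1.α l * 𝒜.R t.1.l2 t.1.l1 t.1.mid l t'.1.α else 0 := by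
  rw [Matrix.mul_apply]
  split_ifs with hl
  · obtain ⟨h1, h2, h3, h4, h5, h6⟩ := hl
    rw [sum_LT_alpha t.1.l2 t.1.l1 t.1.l3 t.1.mid t.1.tot t.1.β t.2.2
      (fun l => 𝒜.R t.1.l1 t.1.l2 t.1.mid t.1.α l * 𝒜.R t.1.l2 t.1.l1 t.1.mid l t'.1.α)]
    · intro t ht
      by_contra hc
      exact ht (by simp [mB1, hc])
    · intro t q1 q2 q3 q4 q5 q6
      simp [mB1, q1, q2, q3, q4, q5, q6, h1, h2, h3, h4, h5, h6]
  · refine Finset.sum_eq_zero fun t _ => ?_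
    simp only [mB1]
    split_ifs with q1 q2 <;> simp_all

lemma mC'_mul_mC_apply (t t' : LT 𝒜) : (mC' 𝒜 * mC 𝒜) t t' =
    if t'.1.l1 = t.1.l1 ∧ t'.1.l2 = t.1.l2 ∧ t'.1.l3 = t.1.l3 ∧ t'.1.mid = t.1.mid ∧
      t'.1.tot = t.1.tot ∧ t'.1.α = t.1.α then
      ∑ l ∈ Finset.range (𝒜.N t.1.l3 t.1.mid t.1.tot),
        𝒜.R t.1.mid t.1.l3 t.1.tot t.1.β l * 𝒜.R t.1.l3 t.1.mid t.1.tot l t'.1.β else 0 := by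
  rw [Matrix.mul_apply]
  split_ifs with hl
  · obtain ⟨h1, h2, h3, h4, h5, h6⟩ := hl
    rw [sum_RT_beta t.1.l3 t.1.l1 t.1.l2 t.1.mid t.1.tot t.1.α t.2.1
      (fun l => 𝒜.R t.1.mid t.1.l3 t.1.tot t.1.β l * 𝒜.R t.1.l3 t.1.mid t.1.tot l t'.1.β)]
    · intro r hr
      simp only [mC, mC'] at hr
      split_ifs at hr with q1 q2 <;> simp_all
    · intro t q1 q2 q3 q4 q5 q6
      simp [mC, mC', q1, q2, q3, q4, q5, q6, h1, h2, h3, h4, h5, h6]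
  · refine Finset.sum_eq_zero fun t _ => ?_
    simp only [mC, mC']
    split_ifs with q1 q2 <;> simp_all

lemma pres_mB1_mul_mB1 : Pres (mB1 𝒜 * mB1 𝒜) := by
  intro t t' h
  rw [mB1_mul_mB1] at h
  split_ifs at h with h1
  · exact ⟨h1.1, h1.2.2.2.2.1⟩
  · exact absurd rfl h

lemma pres_mC'_mul_mC : Pres (mC' 𝒜 * mC 𝒜) := by
  intro t t' h
  rw [mC'_mul_mC_apply] at h
  split_ifs at h with h1
  · exact ⟨h1.1, h1.2.2.2.2.1⟩
  · exact absurd rfl h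

lemma wind_eq_locOp (p : P.Slot) : wind 𝒜 P p = locOp p (mB1 𝒜 * mB1 𝒜) := by
  ext s' s
  simp only [wind, locOp]
  by_cases h : s.Valid ∧ s'.Valid ∧ Agree p s s'
  · rw [dif_pos h, mB1_mul_mB1]
    refine if_congr ?_ rfl rfl
    simp only [loc]
    refine ⟨fun ⟨_, _, h1, h2, h3⟩ => ?_, fun ⟨h1, h2, h3, h4, h5, h6⟩ =>
      ⟨h.1, h.2.1, funext fun u => ?_, funext fun u => ?_, fun u hu => ?_⟩⟩
    · rw [h1, h2]
      exact ⟨rfl, rfl, rfl, rfl, rfl, h3 _ (P.next_ne p)⟩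
    · by_cases hu : u = P.next p
      · rw [hu, h4]
      · exact h.2.2.1 u hu
    · by_cases hu : u = P.next p
      · rw [hu, h3]
      · by_cases hu' : u = p
        · rw [hu', h2]
        · exact (h.2.2.2 u hu' hu).1
    · by_cases hu' : u = P.next p
      · rw [hu', h6]
      · exact (h.2.2.2 u hu hu').2
  · rw [dif_neg h, if_neg]
    rintro ⟨h0, h0', h1, h2, h3⟩
    exact h ⟨h0, h0', fun u _ => by rw [h1], fun u hu _ => ⟨by rw [h2], h3 u hu⟩⟩

/-- In the tree at `p`, the line entering `next p` is the inner edge, the fusion product of the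
first two leaves. The winding at `next p` is therefore the monodromy of the last leaf with this
pair. -/
lemma wind_next_eq_locOp (p : P.Slot) :
    wind 𝒜 P (P.next p) = locOp p (mC' 𝒜 * mC 𝒜) := by
  ext s' s
  simp only [wind, locOp]
  by_cases h : s.Valid ∧ s'.Valid ∧ Agree p s s'
  · rw [dif_pos h, mC'_mul_mC_apply]
    refine if_congr ?_ rfl rfl
    simp only [loc]
    refine ⟨fun ⟨_, _, h1, h2, h3⟩ => ?_, fun ⟨h1, h2, h3, h4, h5, h6⟩ =>
      ⟨h.1, h.2.1, funext fun u => ?_, funext fun u => ?_, fun u hu => ?_⟩⟩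
    · rw [h1, h2]
      exact ⟨rfl, rfl, rfl, rfl, rfl, h3 _ (P.next_ne p).symm⟩
    · by_cases hu : u = P.next p
      · rw [hu, h4]
      · exact h.2.2.1 u hu
    · by_cases hu : u = P.next p
      · rw [hu, h3]
      · by_cases hu' : u = p
        · rw [hu', h2]
        · exact (h.2.2.2 u hu' hu).1
    · by_cases hu' : u = p
      · rw [hu', h6]
      · exact (h.2.2.2 u hu' hu).2
  · rw [dif_neg h, if_neg]
    rintro ⟨h0, h0', h1, h2, h3⟩
    exact h ⟨h0, h0', fun u _ => by rw [h1], fun u _ hu => ⟨by rw [h2], h3 u hu⟩⟩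

end LocalOperators

end AnyonDecoder

/-! ### Closed strings fused into the chain, and relations between exchanges and windings -/

namespace AnyonDecoder

open scoped Matrix ComplexConjugate

section StringOperators

open scoped Classical

variable {A : Type*} [Fintype A] {𝒜 : AnyonData A} {P : Params}

/-- The tensor of the string operator at the position `u`. -/
noncomputable def stringWeight (X : A) (s' s : Config 𝒜 P) (m : P.Slot → 𝒜.Idx) (u : P.Slot) : ℂ :=
  if (m u : ℕ) < 𝒜.N X (s.1 u) (s'.1 u) ∧
      (m (P.next u) : ℕ) < 𝒜.N X (s.1 (P.next u)) (s'.1 (P.next u)) then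
    conj (𝒜.F X (s.1 u) (s.2.1 u) (s'.1 (P.next u)) (s'.1 u) (m u) (s'.2.2 u) (s.1 (P.next u))
      (s.2.2 u) (m (P.next u)))
  else 0

/-- The operator that fuses a closed string of charge `X` parallel to the chain into the chain. -/
noncomputable def stringOp (𝒜 : AnyonData A) (P : Params) (X : A) : Op 𝒜 P := fun s' s =>
  if s.Valid ∧ s'.Valid ∧ s'.2.1 = s.2.1 then
    ∑ m : P.Slot → 𝒜.Idx, ∏ u, stringWeight X s' s m u else 0

lemma stringOp_ne_zero {X : A} {s' s : Config 𝒜 P} (h : stringOp 𝒜 P X s' s ≠ 0) :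
    s.Valid ∧ s'.Valid ∧ s'.2.1 = s.2.1 := by
  by_contra hc
  exact h (if_neg hc)

lemma sum_agree (p : P.Slot) (s : Config 𝒜 P) (hs : s.Valid) (f : Config 𝒜 P → ℂ) (g : LT 𝒜 → ℂ)
    (hf : ∀ s', f s' ≠ 0 → s'.Valid ∧ Agree p s s')
    (hg : ∀ t, g t ≠ 0 → t.1.l1 = s.1 p ∧ t.1.tot = s.1 (P.next (P.next p)))
    (hfg : ∀ s' (hv : s'.Valid), Agree p s s' → f s' = g (loc p s' hv)) :
    ∑ s', f s' = ∑ t, g t := by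
  symm
  have hv : ∀ t : LT 𝒜, g t ≠ 0 → (setLoc p s t).Valid :=
    fun t ht => valid_setLoc p s t hs (hg t ht).1 (hg t ht).2
  refine Finset.sum_bij_ne_zero (fun t _ _ => setLoc p s t) (fun _ _ _ => Finset.mem_univ _)
    ?_ ?_ ?_
  · intro t _ ht t' _ ht' he
    rw [← loc_setLoc p s t (hv t ht) (hg t ht).1 (hg t ht).2,
      ← loc_setLoc p s t' (hv t' ht') (hg t' ht').1 (hg t' ht').2]
    exact loc_congr p he _ _
  · intro s' _ hs'
    have h1 := hf s' hs'
    refine ⟨loc p s' h1.1, Finset.mem_univ _, ?_, setLoc_loc p s s' h1.1 h1.2⟩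
    rwa [hfg s' h1.1 h1.2] at hs'
  · intro t _ ht
    rw [hfg _ (hv t ht) (agree_setLoc p s t), loc_setLoc p s t (hv t ht) (hg t ht).1 (hg t ht).2]

lemma stringWeight_congr_left (X : A) (p : P.Slot) {s' s1 : Config 𝒜 P} (s : Config 𝒜 P)
    (m : P.Slot → 𝒜.Idx) (h : Agree p s' s1) (u : P.Slot) (h1 : u ≠ p) (h2 : u ≠ P.next p) :
    stringWeight X s1 s m u = stringWeight X s' s m u := by
  have hn : P.next u ≠ P.next p := fun he => h1 (P.next_injective he)
  simp only [stringWeight, h.1 u h2, h.1 _ hn, (h.2 u h1 h2).2]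

lemma stringWeight_congr_right (X : A) (p : P.Slot) {s s1 : Config 𝒜 P} (s' : Config 𝒜 P)
    (m : P.Slot → 𝒜.Idx) (h : Agree p s s1) (u : P.Slot) (h1 : u ≠ p) (h2 : u ≠ P.next p) :
    stringWeight X s' s1 m u = stringWeight X s' s m u := by
  have hn : P.next u ≠ P.next p := fun he => h1 (P.next_injective he)
  simp only [stringWeight, h.1 u h2, h.1 _ hn, (h.2 u h1 h2).2, (h.2 u h1 h2).1]

/-- Summing the bond label of the string between `p` and `next p` joins the two neighbouring tensors
into the tree operator of the pentagon. -/
lemma sum_stringWeight_update (X : A) (p : P.Slot) {s' s : Config 𝒜 P} (hs' : s'.Valid)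
    (hs : s.Valid) (m : P.Slot → 𝒜.Idx) (hp : s'.2.1 p = s.2.1 p)
    (hq : s'.2.1 (P.next p) = s.2.1 (P.next p)) :
    ∑ i, stringWeight X s' s (Function.update m (P.next p) i) p *
        stringWeight X s' s (Function.update m (P.next p) i) (P.next p) =
      conj (mW 𝒜 X (m p) (m (P.next (P.next p))) (loc p s' hs') (loc p s hs)) := by
  have h1 := (P.next_ne p).symm
  have h2 := P.next_ne (P.next p)
  simp only [stringWeight, mW, loc, hp, hq, Function.update_self, Function.update_of_ne h1,
    Function.update_of_ne h2, true_and]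
  split_ifs with hc
  · rw [sum_range_idx, map_sum]
    refine Finset.sum_congr rfl fun i _ => ?_
    by_cases hi : (i : ℕ) < 𝒜.N X (s.1 (P.next p)) (s'.1 (P.next p))
    · rw [if_pos ⟨hc.1, hi⟩, if_pos ⟨hi, hc.2⟩, if_pos hi, map_mul]
    · rw [if_neg fun h => hi h.2, if_neg hi, zero_mul, map_zero]
  · rw [map_zero]
    refine Finset.sum_eq_zero fun i _ => ?_
    split_ifs with q1 q2
    · exact absurd ⟨q1.1, q2.2⟩ hc
    all_goals simp

/-- To compare two sums over all bond labels, it is enough to sum a single bond with the others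
fixed. -/
lemma sum_update_congr {ι κ : Type*} [Fintype ι] [DecidableEq ι] [Fintype κ] (q : ι) (F G : (ι → κ) → ℂ)
    (h : ∀ m, ∑ i, F (Function.update m q i) = ∑ i, G (Function.update m q i)) :
    ∑ m, F m = ∑ m, G m := by
  have key : ∀ F : (ι → κ) → ℂ, ∑ m, F m =
      ∑ m' : {j // j ≠ q} → κ, ∑ i, F ((Equiv.funSplitAt q κ).symm (i, m')) := by
    intro F
    rw [← (Equiv.funSplitAt q κ).symm.sum_comp, Fintype.sum_prod_type, Finset.sum_comm]
  rw [key, key]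
  refine Finset.sum_congr rfl fun m' _ => ?_
  rcases isEmpty_or_nonempty κ with he | ⟨⟨k⟩⟩
  · simp
  have hu : ∀ i, (Equiv.funSplitAt q κ).symm (i, m') =
      Function.update ((Equiv.funSplitAt q κ).symm (k, m')) q i := by
    intro i
    ext j
    by_cases hj : j = q
    · subst hj; simp [Equiv.funSplitAt, Equiv.piSplitAt]
    · simp [Equiv.funSplitAt, Equiv.piSplitAt, hj]
  simpa only [← hu] using h ((Equiv.funSplitAt q κ).symm (k, m'))

/-- The two tensors next to the local operator form a product of tree matrices. Intermediate
configurations whose charges differ from those of `s` contribute to neither side, because `mW` keeps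
the second and third leaves. -/
lemma sum_locOp_mul_stringWeight (G : PairOp A) (p : P.Slot) (X : A) {s s' : Config 𝒜 P}
    (hs : s.Valid) (hs' : s'.Valid) (hch : ∀ u, u ≠ p → u ≠ P.next p → s'.2.1 u = s.2.1 u)
    (m : P.Slot → 𝒜.Idx) :
    ∑ i, ∑ s1, locOp p (mL 𝒜 G) s' s1 * (if s1.2.1 = s.2.1 then
        stringWeight X s1 s (Function.update m (P.next p) i) p *
        stringWeight X s1 s (Function.update m (P.next p) i) (P.next p) else 0) =
      ((mW 𝒜 X (m p) (m (P.next (P.next p))))ᴴ * mL 𝒜 G) (loc p s hs) (loc p s' hs') := by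
  rw [Finset.sum_comm, Matrix.mul_apply]
  refine sum_agree p s' hs' _ _ (fun s1 h0 => ?_) (fun t ht => ?_) (fun s1 hv ha => ?_)
  · obtain ⟨i, -, hi⟩ := Finset.exists_ne_zero_of_sum_ne_zero h0
    have := locOp_ne_zero (left_ne_zero_of_mul hi)
    exact ⟨this.1, this.2.2.symm⟩
  · have := pres_mL G _ _ (right_ne_zero_of_mul ht)
    exact ⟨this.1.symm, this.2.symm⟩
  · rw [← Finset.mul_sum, locOp_pos hv hs' ha.symm, mul_comm, Matrix.conjTranspose_apply]
    congr 1
    by_cases he : s1.2.1 = s.2.1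
    · rw [Finset.sum_congr rfl fun i _ => if_pos he,
        sum_stringWeight_update X p hv hs m (by rw [he]) (by rw [he])]
      rfl
    · rw [Finset.sum_congr rfl fun i _ => if_neg he, Finset.sum_const_zero, mW, if_neg, star_zero]
      rintro ⟨e1, e2, -⟩
      refine he (funext fun u => ?_)
      by_cases hu : u = P.next p
      · rw [hu]; exact e2
      · by_cases hu' : u = p
        · rw [hu']; exact e1
        · rw [(ha.2 u hu' hu).1, hch u hu' hu]

lemma sum_stringWeight_mul_locOp (G : PairOp A) (p : P.Slot) (X : A) {s s' : Config 𝒜 P}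
    (hs : s.Valid) (hs' : s'.Valid) (hch : ∀ u, u ≠ p → u ≠ P.next p → s'.2.1 u = s.2.1 u)
    (m : P.Slot → 𝒜.Idx) :
    ∑ i, ∑ s2, (if s'.2.1 = s2.2.1 then
        stringWeight X s' s2 (Function.update m (P.next p) i) p *
        stringWeight X s' s2 (Function.update m (P.next p) i) (P.next p) else 0) *
        locOp p (mL 𝒜 G) s2 s =
      (mL 𝒜 G * (mW 𝒜 X (m p) (m (P.next (P.next p))))ᴴ) (loc p s hs) (loc p s' hs') := by
  rw [Finset.sum_comm, Matrix.mul_apply]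
  refine sum_agree p s hs _ _ (fun s1 h0 => ?_) (fun t ht => ?_) (fun s1 hv ha => ?_)
  · obtain ⟨i, -, hi⟩ := Finset.exists_ne_zero_of_sum_ne_zero h0
    have := locOp_ne_zero (right_ne_zero_of_mul hi)
    exact ⟨this.2.1, this.2.2⟩
  · exact pres_mL G _ _ (left_ne_zero_of_mul ht)
  · rw [← Finset.sum_mul, locOp_pos hs hv ha, mul_comm, Matrix.conjTranspose_apply]
    congr 1
    by_cases he : s'.2.1 = s1.2.1
    · rw [Finset.sum_congr rfl fun i _ => if_pos he,
        sum_stringWeight_update X p hs' hv m (by rw [he]) (by rw [he])]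
      rfl
    · rw [Finset.sum_congr rfl fun i _ => if_neg he, Finset.sum_const_zero, mW, if_neg, star_zero]
      rintro ⟨e1, e2, -⟩
      refine he (funext fun u => ?_)
      by_cases hu : u = P.next p
      · rw [hu]; exact e2
      · by_cases hu' : u = p
        · rw [hu']; exact e1
        · rw [(ha.2 u hu' hu).1, hch u hu' hu]

/-- The tensors of the string operator away from `p` and `next p`. -/
noncomputable def stringRest (X : A) (p : P.Slot) (s' s : Config 𝒜 P) (m : P.Slot → 𝒜.Idx) : ℂ :=
  ∏ u ∈ (Finset.univ.erase p).erase (P.next p), stringWeight X s' s m u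

lemma prod_stringWeight (X : A) (p : P.Slot) (s' s : Config 𝒜 P) (m : P.Slot → 𝒜.Idx) :
    ∏ u, stringWeight X s' s m u = stringRest X p s' s m *
      (stringWeight X s' s m p * stringWeight X s' s m (P.next p)) := by
  rw [stringRest, ← Finset.mul_prod_erase _ _ (Finset.mem_univ p), ← Finset.mul_prod_erase _ _
    (Finset.mem_erase.2 ⟨P.next_ne p, Finset.mem_univ _⟩)]
  ring

lemma stringRest_update (X : A) (p : P.Slot) (s' s : Config 𝒜 P) (m : P.Slot → 𝒜.Idx)
    (i : 𝒜.Idx) : stringRest X p s' s (Function.update m (P.next p) i) = stringRest X p s' s m := by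
  refine Finset.prod_congr rfl fun u hu => ?_
  simp only [Finset.mem_erase, Finset.mem_univ, and_true] at hu
  have hn : P.next u ≠ P.next p := fun he => hu.2 (P.next_injective he)
  simp only [stringWeight, Function.update_of_ne hu.1, Function.update_of_ne hn]

lemma stringRest_congr_left (X : A) (p : P.Slot) {s' s1 : Config 𝒜 P} (s : Config 𝒜 P)
    (m : P.Slot → 𝒜.Idx) (h : Agree p s' s1) : stringRest X p s1 s m = stringRest X p s' s m := by
  refine Finset.prod_congr rfl fun u hu => ?_
  simp only [Finset.mem_erase, Finset.mem_univ, and_true] at hu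
  exact stringWeight_congr_left X p s m h u hu.2 hu.1

lemma stringRest_congr_right (X : A) (p : P.Slot) {s s1 : Config 𝒜 P} (s' : Config 𝒜 P)
    (m : P.Slot → 𝒜.Idx) (h : Agree p s s1) : stringRest X p s' s1 m = stringRest X p s' s m := by
  refine Finset.prod_congr rfl fun u hu => ?_
  simp only [Finset.mem_erase, Finset.mem_univ, and_true] at hu
  exact stringWeight_congr_right X p s' m h u hu.2 hu.1

lemma sum_locOp_mul_stringOp (G : PairOp A) (p : P.Slot) (X : A) {s s' : Config 𝒜 P}
    (hs : s.Valid) : ∑ s1, locOp p (mL 𝒜 G) s' s1 * stringOp 𝒜 P X s1 s =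
      ∑ m, stringRest X p s' s m * ∑ s1, locOp p (mL 𝒜 G) s' s1 * (if s1.2.1 = s.2.1 then
        stringWeight X s1 s m p * stringWeight X s1 s m (P.next p) else 0) := by
  simp only [Finset.mul_sum]
  refine Eq.trans ?_ Finset.sum_comm
  refine Finset.sum_congr rfl fun s1 _ => ?_
  by_cases h0 : locOp p (mL 𝒜 G) s' s1 = 0
  · simp [h0]
  have ha := locOp_ne_zero h0
  by_cases h1 : s1.2.1 = s.2.1
  · rw [stringOp, if_pos ⟨hs, ha.1, h1⟩, Finset.mul_sum]
    refine Finset.sum_congr rfl fun m _ => ?_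
    rw [prod_stringWeight X p, if_pos h1, stringRest_congr_left X p s m ha.2.2.symm]
    ring
  · rw [stringOp, if_neg (fun h => h1 h.2.2)]
    simp [h1]

lemma sum_stringOp_mul_locOp (G : PairOp A) (p : P.Slot) (X : A) {s s' : Config 𝒜 P}
    (hs' : s'.Valid) : ∑ s2, stringOp 𝒜 P X s' s2 * locOp p (mL 𝒜 G) s2 s =
      ∑ m, stringRest X p s' s m * ∑ s2, (if s'.2.1 = s2.2.1 then
        stringWeight X s' s2 m p * stringWeight X s' s2 m (P.next p) else 0) *
        locOp p (mL 𝒜 G) s2 s := by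
  simp only [Finset.mul_sum]
  refine Eq.trans ?_ Finset.sum_comm
  refine Finset.sum_congr rfl fun s2 _ => ?_
  by_cases h0 : locOp p (mL 𝒜 G) s2 s = 0
  · simp [h0]
  have ha := locOp_ne_zero h0
  by_cases h1 : s'.2.1 = s2.2.1
  · rw [stringOp, if_pos ⟨ha.2.1, hs', h1⟩, Finset.sum_mul]
    refine Finset.sum_congr rfl fun m _ => ?_
    rw [prod_stringWeight X p, if_pos h1, stringRest_congr_right X p s' m ha.2.2]
    ring
  · rw [stringOp, if_neg (fun h => h1 h.2.2)]
    simp [h1]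

/-- Only the tensors at `p` and `next p` see the local operator, and for them the pentagon applies
(`mL_mul_mW`). The remaining tensors depend on labels that the operator does not change and factor
out as `stringRest`. -/
lemma lift_mul_stringOp (h : 𝒜.IsModular) (G : PairOp A) (p : P.Slot) (X : A) :
    lift 𝒜 P G p * stringOp 𝒜 P X = stringOp 𝒜 P X * lift 𝒜 P G p := by
  rw [lift_eq_locOp]
  ext s' s
  rw [Matrix.mul_apply, Matrix.mul_apply]
  by_cases hc : s.Valid ∧ s'.Valid ∧ ∀ u, u ≠ p → u ≠ P.next p → s'.2.1 u = s.2.1 u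
  swap
  · rw [Finset.sum_eq_zero, Finset.sum_eq_zero]
    · intro s1 _
      by_contra h0
      have h1 := stringOp_ne_zero (left_ne_zero_of_mul h0)
      have h2 := locOp_ne_zero (right_ne_zero_of_mul h0)
      exact hc ⟨h2.1, h1.2.1, fun u a b => by rw [h1.2.2]; exact (h2.2.2.2 u a b).1⟩
    · intro s1 _
      by_contra h0
      have h1 := stringOp_ne_zero (right_ne_zero_of_mul h0)
      have h2 := locOp_ne_zero (left_ne_zero_of_mul h0)
      exact hc ⟨h1.1, h2.2.1, fun u a b => by rw [← h1.2.2]; exact (h2.2.2.2 u a b).1⟩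
  obtain ⟨hs, hs', hch⟩ := hc
  rw [sum_locOp_mul_stringOp G p X hs, sum_stringOp_mul_locOp G p X hs']
  refine sum_update_congr (P.next p) _ _ fun m => ?_
  simp only [stringRest_update, ← Finset.mul_sum]
  rw [sum_locOp_mul_stringWeight G p X hs hs' hch, sum_stringWeight_mul_locOp G p X hs hs' hch,
    mL_mul_mW h]

/-! ### Relations between exchanges and windings -/

lemma mG_conjTranspose (G : PairOp A) :
    (mG 𝒜 G)ᴴ = mG 𝒜 fun a b e κ a' b' κ' => conj (G a' b' e κ' a b κ) := by
  ext r r'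
  simp only [mG, Matrix.conjTranspose_apply]
  split_ifs with h1 h2 <;> simp_all

lemma mL_conjTranspose (G : PairOp A) :
    (mL 𝒜 G)ᴴ = mL 𝒜 fun a b e κ a' b' κ' => conj (G a' b' e κ' a b κ) := by
  rw [mL, mL, ← mG_conjTranspose]
  simp only [Matrix.conjTranspose_mul, Matrix.conjTranspose_conjTranspose, Matrix.mul_assoc]

lemma lift_conjTranspose (G : PairOp A) (p : P.Slot) :
    (lift 𝒜 P G p)ᴴ = lift 𝒜 P (fun a b e κ a' b' κ' => conj (G a' b' e κ' a b κ)) p := by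
  rw [lift_eq_locOp, lift_eq_locOp, locOp_conjTranspose, mL_conjTranspose]

lemma validProj_mul_wind (p : P.Slot) : validProj 𝒜 P * wind 𝒜 P p = wind 𝒜 P p := by
  rw [wind_eq_locOp, validProj_mul_locOp]

lemma wind_mul_validProj (p : P.Slot) : wind 𝒜 P p * validProj 𝒜 P = wind 𝒜 P p := by
  rw [wind_eq_locOp, locOp_mul_validProj]

lemma exchange_mul_conjTranspose (h : 𝒜.IsModular) (p : P.Slot) :
    lift 𝒜 P (exchange 𝒜) p * (lift 𝒜 P (exchange 𝒜) p)ᴴ = validProj 𝒜 P := by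
  rw [lift_eq_locOp, locOp_conjTranspose, locOp_mul p (pres_mL _).conjTranspose,
    mE_conjTranspose_mul h, locOp_one]

lemma exchange_conjTranspose_mul (h : 𝒜.IsModular) (p : P.Slot) :
    (lift 𝒜 P (exchange 𝒜) p)ᴴ * lift 𝒜 P (exchange 𝒜) p = validProj 𝒜 P := by
  rw [lift_eq_locOp, locOp_conjTranspose, locOp_mul p (pres_mL _),
    mE_mul_conjTranspose h, locOp_one]

lemma wind_conjTranspose_mul (h : 𝒜.IsModular) (p : P.Slot) :
    (wind 𝒜 P p)ᴴ * wind 𝒜 P p = validProj 𝒜 P := by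
  rw [wind_eq_locOp, locOp_conjTranspose, locOp_mul p pres_mB1_mul_mB1, Matrix.conjTranspose_mul,
    Matrix.mul_assoc, ← Matrix.mul_assoc (mB1 𝒜) (mB1 𝒜)ᴴ, mB1_mul_conjTranspose h, Matrix.one_mul,
    mB1_mul_conjTranspose h, locOp_one]

/-- A braid relation of the annulus: winding a position is the same as exchanging it with its
predecessor, winding there, and exchanging again in the same sense. -/
lemma wind_next (h : 𝒜.IsModular) (p : P.Slot) : wind 𝒜 P (P.next p) =
    lift 𝒜 P (exchange 𝒜) p * wind 𝒜 P p * lift 𝒜 P (exchange 𝒜) p := by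
  rw [lift_eq_locOp, wind_eq_locOp p, locOp_mul p pres_mB1_mul_mB1, locOp_mul p (pres_mL _),
    wind_next_eq_locOp, mC'_mul_mC h, Matrix.mul_assoc]

/-- If both positions are wound, an operator on them emerges conjugated by the double exchange. This
is again a product of local operators and thus harmless to strings. -/
lemma lift_mul_wind_pair (h : 𝒜.IsModular) (G : PairOp A) (p : P.Slot) :
    lift 𝒜 P G p * (wind 𝒜 P (P.next p) * wind 𝒜 P p) =
      (wind 𝒜 P (P.next p) * wind 𝒜 P p) *
      ((lift 𝒜 P (exchange 𝒜) p)ᴴ * (lift 𝒜 P (exchange 𝒜) p)ᴴ * lift 𝒜 P G p *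
        lift 𝒜 P (exchange 𝒜) p * lift 𝒜 P (exchange 𝒜) p) := by
  have hE := pres_mL (𝒜 := 𝒜) (exchange 𝒜)
  have hG := pres_mL (𝒜 := 𝒜) G
  rw [lift_eq_locOp, lift_eq_locOp, wind_eq_locOp p, wind_next_eq_locOp, locOp_conjTranspose,
    locOp_mul p pres_mB1_mul_mB1, locOp_mul p (pres_mB1_mul_mB1.mul pres_mC'_mul_mC),
    monodromy_pair h, locOp_mul p hE.conjTranspose, locOp_mul p hG, locOp_mul p hE, locOp_mul p hE,
    locOp_mul p]
  · simp only [Matrix.mul_assoc]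
  · exact hE.mul (hE.mul (hG.mul (hE.conjTranspose.mul hE.conjTranspose)))

/-- The winding at `u` changes only the vertex at `u`, with an amplitude depending on the charge at
`u` and on the lines entering `u` and `next u`. A local operator at `p` changes none of these. -/
lemma locOp_mul_wind (p u : P.Slot) (hu : u ≠ p) (hu' : u ≠ P.next p)
    (M : Matrix (LT 𝒜) (LT 𝒜) ℂ) :
    locOp p M * wind 𝒜 P u = wind 𝒜 P u * locOp p M := by
  have hn : P.next u ≠ P.next p := fun he => hu (P.next_injective he)
  ext s' s
  rw [Matrix.mul_apply, Matrix.mul_apply]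
  by_cases hc : s.Valid ∧ s'.Valid ∧ (∀ w, w ≠ P.next p → s'.1 w = s.1 w) ∧
    ∀ w, w ≠ p → w ≠ P.next p → s'.2.1 w = s.2.1 w ∧ (w ≠ u → s'.2.2 w = s.2.2 w)
  swap
  · rw [Finset.sum_eq_zero, Finset.sum_eq_zero]
    · intro s1 _
      by_contra h0
      have h2 := locOp_ne_zero (right_ne_zero_of_mul h0)
      have h1 := left_ne_zero_of_mul h0
      simp only [wind] at h1
      split_ifs at h1 with h3
      · refine hc ⟨h2.1, h3.2.1, fun w hw => by rw [h3.2.2.1, h2.2.2.1 w hw], fun w a b => ⟨?_, ?_⟩⟩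
        · rw [h3.2.2.2.1, (h2.2.2.2 w a b).1]
        · intro hwu
          rw [h3.2.2.2.2 w hwu, (h2.2.2.2 w a b).2]
      · exact h1 rfl
    · intro s1 _
      by_contra h0
      have h2 := locOp_ne_zero (left_ne_zero_of_mul h0)
      have h1 := right_ne_zero_of_mul h0
      simp only [wind] at h1
      split_ifs at h1 with h3
      · refine hc ⟨h3.1, h2.2.1, fun w hw => by rw [h2.2.2.1 w hw, h3.2.2.1],
          fun w a b => ⟨?_, ?_⟩⟩
        · rw [(h2.2.2.2 w a b).1, h3.2.2.2.1]
        · intro hwu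
          rw [(h2.2.2.2 w a b).2, h3.2.2.2.2 w hwu]
      · exact h1 rfl
  obtain ⟨hs, hs', hx, hav⟩ := hc
  -- The only intermediate configurations that contribute: the vertex at `u` changes first in `s1`
  -- and last in `s2`.
  let s1 : Config 𝒜 P := (s.1, s.2.1, Function.update s.2.2 u (s'.2.2 u))
  let s2 : Config 𝒜 P := (s'.1, s'.2.1, Function.update s'.2.2 u (s.2.2 u))
  have hxu : s'.1 u = s.1 u := hx u hu'
  have hxn : s'.1 (P.next u) = s.1 (P.next u) := hx _ hn
  have hau : s'.2.1 u = s.2.1 u := (hav u hu hu').1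
  have v1 : s1.Valid := by
    intro w
    by_cases hw : w = u
    · subst hw
      simp only [s1, Function.update_self, ← hxu, ← hxn, ← hau]
      exact hs' w
    · simp only [s1, Function.update_of_ne hw]
      exact hs w
  have v2 : s2.Valid := by
    intro w
    by_cases hw : w = u
    · subst hw
      simp only [s2, Function.update_self, hxu, hxn, hau]
      exact hs w
    · simp only [s2, Function.update_of_ne hw]
      exact hs' w
  have a1 : Agree p s1 s' := by
    refine ⟨hx, fun w a b => ⟨(hav w a b).1, ?_⟩⟩
    by_cases hw : w = u
    · subst hw; simp [s1]
    · simp only [s1, Function.update_of_ne hw]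
      exact (hav w a b).2 hw
  have a2 : Agree p s s2 := by
    refine ⟨hx, fun w a b => ⟨(hav w a b).1, ?_⟩⟩
    by_cases hw : w = u
    · subst hw; simp [s2]
    · simp only [s2, Function.update_of_ne hw]
      exact (hav w a b).2 hw
  rw [Finset.sum_eq_single s1, Finset.sum_eq_single s2]
  · rw [locOp_pos v1 hs' a1, locOp_pos hs v2 a2, mul_comm]
    congr 1
    · simp only [wind]
      rw [if_pos ⟨hs, v1, rfl, rfl, fun w hw => Function.update_of_ne hw _ _⟩,
        if_pos ⟨v2, hs', rfl, rfl, fun w hw => (Function.update_of_ne hw _ _).symm⟩]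
      simp only [s1, s2, Function.update_self, hxu, hxn, hau]
    · have e1 : loc p s1 v1 = loc p s hs := by
        apply Subtype.ext
        simp only [loc, s1, Function.update_of_ne hu.symm, Function.update_of_ne hu'.symm]
      have e2 : loc p s2 v2 = loc p s' hs' := by
        apply Subtype.ext
        simp only [loc, s2, Function.update_of_ne hu.symm, Function.update_of_ne hu'.symm]
      rw [e1, e2]
  · intro b _ hb
    by_contra h0
    apply hb
    have h2 := locOp_ne_zero (right_ne_zero_of_mul h0)
    have h1 := left_ne_zero_of_mul h0
    simp only [wind] at h1
    split_ifs at h1 with h3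
    · refine Prod.ext h3.2.2.1.symm (Prod.ext h3.2.2.2.1.symm (funext fun w => ?_))
      by_cases hw : w = u
      · subst hw
        simpa [s2] using (h2.2.2.2 w hu hu').2
      · simp only [s2, Function.update_of_ne hw]
        exact (h3.2.2.2.2 w hw).symm
    · exact absurd rfl h1
  · simp
  · intro b _ hb
    by_contra h0
    apply hb
    have h2 := locOp_ne_zero (left_ne_zero_of_mul h0)
    have h1 := right_ne_zero_of_mul h0
    simp only [wind] at h1
    split_ifs at h1 with h3
    · refine Prod.ext h3.2.2.1 (Prod.ext h3.2.2.2.1 (funext fun w => ?_))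
      by_cases hw : w = u
      · subst hw
        simpa [s1] using (h2.2.2.2 w hu hu').2.symm
      · simp only [s1, Function.update_of_ne hw]
        exact h3.2.2.2.2 w hw
    · exact absurd rfl h1
  · simp

lemma wind_commute (u w : P.Slot) : Commute (wind 𝒜 P u) (wind 𝒜 P w) := by
  by_cases h : u = w
  · subst h; exact Commute.refl _
  by_cases h' : u = P.next w
  · have hw : w ≠ P.next u := by
      rw [h']; exact (P.next_next_ne w).symm
    have := locOp_mul_wind (𝒜 := 𝒜) u w (Ne.symm h) hw (mB1 𝒜 * mB1 𝒜)
    rw [← wind_eq_locOp] at this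
    exact this
  · have := locOp_mul_wind (𝒜 := 𝒜) w u h h' (mB1 𝒜 * mB1 𝒜)
    rw [← wind_eq_locOp] at this
    exact this.symm

lemma lift_commute_wind (G : PairOp A) (p u : P.Slot) (hu : u ≠ p) (hu' : u ≠ P.next p) :
    Commute (lift 𝒜 P G p) (wind 𝒜 P u) := by
  rw [lift_eq_locOp]
  exact locOp_mul_wind p u hu hu' _

end StringOperators

end AnyonDecoder

/-! ### Moving operations past windings -/

namespace AnyonDecoder

open scoped Matrix ComplexConjugate

section Neutral

open scoped Classical

variable {A : Type*} [Fintype A] {𝒜 : AnyonData A} {P : Params}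

noncomputable instance instSemiringOp (𝒜 : AnyonData A) (P : Params) : Semiring (Op 𝒜 P) :=
  Matrix.semiring

/-- The product of the windings at the positions in `S`. -/
noncomputable def windSet (𝒜 : AnyonData A) (P : Params) (S : Finset P.Slot) : Op 𝒜 P :=
  S.noncommProd (wind 𝒜 P) fun _ _ _ _ _ => wind_commute _ _

lemma windSet_insert (S : Finset P.Slot) (p : P.Slot) (h : p ∉ S) :
    windSet 𝒜 P (insert p S) = wind 𝒜 P p * windSet 𝒜 P S :=
  Finset.noncommProd_insert_of_notMem _ _ _ _ h

lemma windSet_erase {S : Finset P.Slot} {p : P.Slot} (h : p ∈ S) :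
    windSet 𝒜 P S = wind 𝒜 P p * windSet 𝒜 P (S.erase p) := by
  rw [← windSet_insert _ _ (Finset.notMem_erase p S), Finset.insert_erase h]

lemma commute_windSet {S : Finset P.Slot} {O : Op 𝒜 P} (h : ∀ p ∈ S, Commute O (wind 𝒜 P p)) :
    Commute O (windSet 𝒜 P S) :=
  Finset.noncommProd_commute _ _ _ _ h

/-- The operator commutes with string operators, and does not change the chain line entering
`u₀`. -/
def Neutral (u₀ : P.Slot) (O : Op 𝒜 P) : Prop :=
  (∀ X, Commute O (stringOp 𝒜 P X)) ∧
    ∀ s' s, O s' s ≠ 0 → s.Valid → s'.Valid ∧ s'.1 u₀ = s.1 u₀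

lemma Neutral.mul {u₀ : P.Slot} {O O' : Op 𝒜 P} (h : Neutral u₀ O) (h' : Neutral u₀ O') :
    Neutral u₀ (O * O') := by
  refine ⟨fun X => (h.1 X).mul_left (h'.1 X), fun s'' s hne hs => ?_⟩
  rw [Matrix.mul_apply] at hne
  obtain ⟨s', -, hs'⟩ := Finset.exists_ne_zero_of_sum_ne_zero hne
  have h1 := h'.2 s' s (right_ne_zero_of_mul hs') hs
  have h2 := h.2 s'' s' (left_ne_zero_of_mul hs') h1.1
  exact ⟨h2.1, h2.2.trans h1.2⟩

lemma neutral_one (u₀ : P.Slot) : Neutral u₀ (1 : Op 𝒜 P) := by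
  refine ⟨fun X => Commute.one_left _, fun s' s h hs => ?_⟩
  have : s' = s := by
    by_contra hc
    exact h (Matrix.one_apply_ne hc)
  subst this
  exact ⟨hs, rfl⟩

lemma commute_diagonal {f : Config 𝒜 P → ℂ} {O : Op 𝒜 P}
    (h : ∀ s' s, O s' s ≠ 0 → f s' = f s) : Commute (Matrix.diagonal f) O := by
  ext s' s
  rw [Matrix.diagonal_mul, Matrix.mul_diagonal]
  by_cases h0 : O s' s = 0
  · simp [h0]
  · rw [h s' s h0, mul_comm]

/-- Strings change lines and vertices but no charges, so functions of the charges commute with them.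
-/
lemma neutral_diagonal (u₀ : P.Slot) {f : Config 𝒜 P → ℂ}
    (h : ∀ s' s : Config 𝒜 P, s'.Valid → s.Valid → s'.2.1 = s.2.1 → f s' = f s) :
    Neutral u₀ (Matrix.diagonal f : Op 𝒜 P) := by
  refine ⟨fun X => commute_diagonal fun s' s hne => ?_, fun s' s hne hs => ?_⟩
  · have := stringOp_ne_zero hne
    exact h s' s this.2.1 this.1 this.2.2
  · have : s' = s := by
      by_contra hc
      exact hne (Matrix.diagonal_apply_ne _ hc)
    subst this
    exact ⟨hs, rfl⟩

lemma neutral_validProj (u₀ : P.Slot) : Neutral u₀ (validProj 𝒜 P) :=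
  neutral_diagonal u₀ fun s' s h h' _ => by simp [h, h']

lemma neutral_lift (h : 𝒜.IsModular) {u₀ : P.Slot} (G : PairOp A) {p : P.Slot}
    (hp : u₀ ≠ P.next p) : Neutral u₀ (lift 𝒜 P G p) := by
  refine ⟨fun X => lift_mul_stringOp h G p X, fun s' s hne _ => ?_⟩
  rw [lift_eq_locOp] at hne
  have := locOp_ne_zero hne
  exact ⟨this.2.1, this.2.2.1 _ hp⟩

lemma neutral_lift_conjTranspose (h : 𝒜.IsModular) {u₀ : P.Slot} (G : PairOp A) {p : P.Slot}
    (hp : u₀ ≠ P.next p) : Neutral u₀ (lift 𝒜 P G p)ᴴ := by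
  rw [lift_conjTranspose]
  exact neutral_lift h _ hp

/-- Moving the operator `O` past the windings at `S` turns it into a neutral one, and `S` into
`S'`. -/
def Transport (u₀ : P.Slot) (S S' : Finset P.Slot) (O : Op 𝒜 P) : Prop :=
  ∃ O', Neutral u₀ O' ∧ O * windSet 𝒜 P S = windSet 𝒜 P S' * O'

lemma Transport.mul {u₀ : P.Slot} {S S' S'' : Finset P.Slot} {O O' : Op 𝒜 P}
    (h : Transport u₀ S' S'' O') (h' : Transport u₀ S S' O) : Transport u₀ S S'' (O' * O) := by
  obtain ⟨V', hV', e'⟩ := h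
  obtain ⟨V, hV, e⟩ := h'
  exact ⟨V' * V, hV'.mul hV, by rw [Matrix.mul_assoc, e, ← Matrix.mul_assoc, e', Matrix.mul_assoc]⟩

lemma transport_one (u₀ : P.Slot) (S : Finset P.Slot) : Transport u₀ S S (1 : Op 𝒜 P) :=
  ⟨1, neutral_one u₀, by rw [Matrix.one_mul, Matrix.mul_one]⟩

lemma wind_apply_ne_zero {p : P.Slot} {s' s : Config 𝒜 P} (h : wind 𝒜 P p s' s ≠ 0) :
    s.Valid ∧ s'.Valid ∧ s'.1 = s.1 ∧ s'.2.1 = s.2.1 := by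
  by_contra hc
  exact h (if_neg fun hh => hc ⟨hh.1, hh.2.1, hh.2.2.1, hh.2.2.2.1⟩)

lemma transport_diagonal (u₀ : P.Slot) (S : Finset P.Slot) {f : Config 𝒜 P → ℂ}
    (h : ∀ s' s : Config 𝒜 P, s'.Valid → s.Valid → s'.2.1 = s.2.1 → f s' = f s) :
    Transport u₀ S S (Matrix.diagonal f : Op 𝒜 P) :=
  ⟨_, neutral_diagonal u₀ h, commute_windSet fun p _ => commute_diagonal fun s' s hne => by
    have := wind_apply_ne_zero hne
    exact h s' s this.2.1 this.1 this.2.2.2⟩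

section Moves

variable (h : 𝒜.IsModular)
include h

/-- If both positions are wound, `lift_mul_wind_pair` conjugates the operator by the double
exchange; if neither is, the operator commutes with all windings in `S`. The mixed case is treated
only for exchanges, below. -/
lemma transport_lift {u₀ : P.Slot} {S : Finset P.Slot} (G : PairOp A) {p : P.Slot}
    (hu : u₀ ≠ P.next p) (hS : p ∈ S ↔ P.next p ∈ S) : Transport u₀ S S (lift 𝒜 P G p) := by
  by_cases hp : p ∈ S
  · have hq := hS.1 hp
    have hE := neutral_lift h (exchange 𝒜) hu
    have hE' := neutral_lift_conjTranspose h (exchange 𝒜) hu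
    refine ⟨_, (((hE'.mul hE').mul (neutral_lift h G hu)).mul hE).mul hE, ?_⟩
    have hp' : p ∈ S.erase (P.next p) := Finset.mem_erase.2 ⟨(P.next_ne p).symm, hp⟩
    have hc : ∀ G', Commute (lift 𝒜 P G' p) (windSet 𝒜 P ((S.erase (P.next p)).erase p)) := by
      intro G'
      refine commute_windSet fun u hu => lift_commute_wind G' p u ?_ ?_
      · exact Finset.ne_of_mem_erase hu
      · exact Finset.ne_of_mem_erase (Finset.mem_of_mem_erase hu)
    have hc' := hc (fun a b e κ a' b' κ' => conj (exchange 𝒜 a' b' e κ' a b κ))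
    rw [← lift_conjTranspose] at hc'
    have hcc := (((hc'.mul_left hc').mul_left (hc G)).mul_left (hc (exchange 𝒜))).mul_left
      (hc (exchange 𝒜))
    rw [windSet_erase hq, windSet_erase hp', ← Matrix.mul_assoc (wind 𝒜 P (P.next p)),
      ← Matrix.mul_assoc, lift_mul_wind_pair h, Matrix.mul_assoc, hcc.eq, ← Matrix.mul_assoc]
  · have hq := fun hh => hp (hS.2 hh)
    refine ⟨_, neutral_lift h G hu, commute_windSet fun u hmem => lift_commute_wind G p u ?_ ?_⟩
    · intro hh; exact hp (hh ▸ hmem)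
    · intro hh; exact hq (hh ▸ hmem)

lemma transport_lift_conjTranspose {u₀ : P.Slot} {S : Finset P.Slot} (G : PairOp A) {p : P.Slot}
    (hu : u₀ ≠ P.next p) (hS : p ∈ S ↔ P.next p ∈ S) : Transport u₀ S S (lift 𝒜 P G p)ᴴ := by
  rw [lift_conjTranspose]
  exact transport_lift h _ hu hS

/-- By `wind_next`, an exchange moves the winding from `p` to `next p` and turns into the inverse
exchange, which is neutral. A winding at `next p` is moved back by the inverse exchange instead, so
the sense of a crossing has to match the winding that it moves. -/
lemma transport_exchange_swap {u₀ : P.Slot} {S : Finset P.Slot} {p : P.Slot}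
    (hu : u₀ ≠ P.next p) (hp : p ∈ S) (hq : P.next p ∉ S) :
    Transport u₀ S (insert (P.next p) (S.erase p)) (lift 𝒜 P (exchange 𝒜) p) := by
  refine ⟨_, neutral_lift_conjTranspose h (exchange 𝒜) hu, ?_⟩
  have hc : Commute (lift 𝒜 P (exchange 𝒜) p)ᴴ (windSet 𝒜 P (S.erase p)) := by
    rw [lift_conjTranspose]
    refine commute_windSet fun u hu => lift_commute_wind _ p u (Finset.ne_of_mem_erase hu) ?_
    rintro rfl
    exact hq (Finset.mem_of_mem_erase hu)
  rw [windSet_erase hp, windSet_insert _ _ (fun hh => hq (Finset.mem_of_mem_erase hh)),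
    Matrix.mul_assoc, ← hc.eq, ← Matrix.mul_assoc, ← Matrix.mul_assoc, wind_next h,
    Matrix.mul_assoc (_ * wind 𝒜 P p), exchange_mul_conjTranspose h,
    Matrix.mul_assoc (lift 𝒜 P (exchange 𝒜) p) (wind 𝒜 P p) (validProj 𝒜 P), wind_mul_validProj,
    Matrix.mul_assoc]

lemma transport_exchange_conjTranspose_swap {u₀ : P.Slot} {S : Finset P.Slot} {p : P.Slot}
    (hu : u₀ ≠ P.next p) (hp : p ∉ S) (hq : P.next p ∈ S) :
    Transport u₀ S (insert p (S.erase (P.next p))) (lift 𝒜 P (exchange 𝒜) p)ᴴ := by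
  refine ⟨_, neutral_lift h (exchange 𝒜) hu, ?_⟩
  have hc : Commute (lift 𝒜 P (exchange 𝒜) p) (windSet 𝒜 P (S.erase (P.next p))) := by
    refine commute_windSet fun u hu => lift_commute_wind _ p u ?_ (Finset.ne_of_mem_erase hu)
    rintro rfl
    exact hp (Finset.mem_of_mem_erase hu)
  rw [windSet_erase hq, windSet_insert _ _ (fun hh => hp (Finset.mem_of_mem_erase hh)),
    Matrix.mul_assoc, ← hc.eq, ← Matrix.mul_assoc, ← Matrix.mul_assoc, wind_next h,
    ← Matrix.mul_assoc, ← Matrix.mul_assoc, exchange_conjTranspose_mul h, validProj_mul_wind]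

/-- The exchange of `p` and `next p`, or its inverse, moves the windings along. -/
lemma transport_exchange {u₀ : P.Slot} {S : Finset P.Slot} {p : P.Slot}
    (hu : u₀ ≠ P.next p) (hS : P.next p ∈ S → p ∈ S) :
    ∃ S', Transport u₀ S S' (lift 𝒜 P (exchange 𝒜) p) ∧
      Transport u₀ S' S (lift 𝒜 P (exchange 𝒜) p)ᴴ ∧ (P.next p ∈ S' ↔ p ∈ S) ∧
      ∀ u, u ≠ p → u ≠ P.next p → (u ∈ S' ↔ u ∈ S) := by
  have hqp := P.next_ne p
  by_cases hq : P.next p ∈ S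
  · exact ⟨S, transport_lift h _ hu ⟨fun _ => hq, hS⟩,
      transport_lift_conjTranspose h _ hu ⟨fun _ => hq, hS⟩, ⟨hS, fun _ => hq⟩,
      fun _ _ _ => Iff.rfl⟩
  by_cases hp : p ∈ S
  · refine ⟨_, transport_exchange_swap h hu hp hq, ?_, by simp [hp], fun u h1 h2 => by simp [h1, h2]⟩
    have := transport_exchange_conjTranspose_swap h (S := insert (P.next p) (S.erase p)) hu
      (by simp [hqp.symm]) (Finset.mem_insert_self _ _)
    rwa [Finset.erase_insert (fun hh => hq (Finset.mem_of_mem_erase hh)),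
      Finset.insert_erase hp] at this
  · have hi : p ∈ S ↔ P.next p ∈ S := iff_of_false hp hq
    exact ⟨S, transport_lift h _ hu hi, transport_lift_conjTranspose h _ hu hi, hi.symm,
      fun _ _ _ => Iff.rfl⟩

lemma transport_exchange_conjTranspose {u₀ : P.Slot} {S : Finset P.Slot} {p : P.Slot}
    (hu : u₀ ≠ P.next p) (hS : p ∈ S → P.next p ∈ S) :
    ∃ S', Transport u₀ S S' (lift 𝒜 P (exchange 𝒜) p)ᴴ ∧
      Transport u₀ S' S (lift 𝒜 P (exchange 𝒜) p) ∧ (P.next p ∈ S' ↔ p ∈ S) ∧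
      ∀ u, u ≠ p → u ≠ P.next p → (u ∈ S' ↔ u ∈ S) := by
  have hqp := P.next_ne p
  by_cases hp : p ∈ S
  · have hi : p ∈ S ↔ P.next p ∈ S := ⟨fun _ => hS hp, fun _ => hp⟩
    exact ⟨S, transport_lift_conjTranspose h _ hu hi, transport_lift h _ hu hi, hi.symm,
      fun _ _ _ => Iff.rfl⟩
  by_cases hq : P.next p ∈ S
  · refine ⟨_, transport_exchange_conjTranspose_swap h hu hp hq, ?_, by simp [hp, hqp],
      fun u h1 h2 => by simp [h1, h2]⟩
    have := transport_exchange_swap h (S := insert p (S.erase (P.next p))) hu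
      (Finset.mem_insert_self _ _) (by simp [hqp])
    rwa [Finset.erase_insert (fun hh => hp (Finset.mem_of_mem_erase hh)),
      Finset.insert_erase hq] at this
  · have hi : p ∈ S ↔ P.next p ∈ S := iff_of_false hp hq
    exact ⟨S, transport_lift_conjTranspose h _ hu hi, transport_lift h _ hu hi, hi.symm,
      fun _ _ _ => Iff.rfl⟩

lemma transport_wind_conjTranspose (u₀ : P.Slot) {S : Finset P.Slot} {p : P.Slot} (hp : p ∈ S) :
    Transport u₀ S (S.erase p) (wind 𝒜 P p)ᴴ := by
  refine ⟨_, neutral_validProj u₀, ?_⟩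
  rw [windSet_erase hp, ← Matrix.mul_assoc, wind_conjTranspose_mul h]
  exact commute_windSet fun u _ => (validProj_mul_wind u).trans (wind_mul_validProj u).symm

omit h in
lemma transport_wind (u₀ : P.Slot) {S : Finset P.Slot} {p : P.Slot} (hp : p ∉ S) :
    Transport u₀ S (insert p S) (wind 𝒜 P p) :=
  ⟨1, neutral_one u₀, by rw [windSet_insert _ _ hp, Matrix.mul_one]⟩

/-- The windings can be moved through `carry` if none of the crossings is of the wrong kind; `m`
means that the carried position is wound. -/
lemma transport_carry {u₀ : P.Slot} {S : Finset P.Slot} (p : P.Slot) (wrap m : Prop)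
    (hm : if wrap then p ∈ S ∧ ¬ m else (p ∈ S ↔ m)) (d : ℕ) (hd : d ≤ 2 * P.L)
    (hu : ∀ i < d, u₀ ≠ P.next^[i + 1] p)
    (hS : ∀ i < d, if ¬ wrap ∧ (P.next^[i + 1] p).1.1 = p.1.1 then P.next^[i + 1] p ∈ S → m
      else m → P.next^[i + 1] p ∈ S) :
    ∃ S', Transport u₀ S S' (carry 𝒜 P p wrap d) ∧ Transport u₀ S' S (carry 𝒜 P p wrap d)ᴴ ∧
      (P.next^[d] p ∈ S' ↔ m) ∧
      ∀ j, d < j → j ≤ 2 * P.L + 1 → (P.next^[j] p ∈ S' ↔ P.next^[j] p ∈ S) := by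
  induction d with
  | zero =>
    -- A wrapping path begins with an inverse winding, which consumes the winding at `p`. Hence `p`
    -- must be wound at first, while `m` is false.
    by_cases hw : wrap
    · rw [if_pos hw] at hm
      simp only [carry, if_pos hw]
      refine ⟨S.erase p, transport_wind_conjTranspose h u₀ hm.1, ?_, ?_, ?_⟩
      · rw [Matrix.conjTranspose_conjTranspose]
        have := transport_wind (𝒜 := 𝒜) u₀ (Finset.notMem_erase p S)
        rwa [Finset.insert_erase hm.1] at this
      · simp [hm.2]
      · intro j hj hj'
        have := P.next_iterate_ne p hj hj'
        simp only [Function.iterate_zero, id_eq] at this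
        simp [this.symm]
    · rw [if_neg hw] at hm
      simp only [carry, if_neg hw, Matrix.conjTranspose_one]
      exact ⟨S, transport_one _ _, transport_one _ _, hm, fun _ _ _ => Iff.rfl⟩
  | succ d ih =>
    obtain ⟨S', h1, h2, h3, h4⟩ := ih (by omega) (fun i hi => hu i (by omega))
      (fun i hi => hS i (by omega))
    have hu' := hu d (by omega)
    have hS' := hS d (by omega)
    have h5 := h4 (d + 1) (by omega) (by omega)
    have hne : ∀ j, d + 1 < j → j ≤ 2 * P.L + 1 →
        P.next^[j] p ≠ P.next^[d] p ∧ P.next^[j] p ≠ P.next (P.next^[d] p) := by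
      intro j hj hj'
      rw [← Function.iterate_succ_apply' P.next]
      exact ⟨(P.next_iterate_ne p (by omega) hj').symm, (P.next_iterate_ne p hj hj').symm⟩
    rw [← h5] at hS'
    rw [Function.iterate_succ_apply'] at hu' hS' ⊢
    by_cases hc : ¬ wrap ∧ (P.next^[d + 1] p).1.1 = p.1.1
    · have hc' := hc
      rw [Function.iterate_succ_apply'] at hc'
      rw [if_pos hc'] at hS'
      obtain ⟨S'', k1, k2, k3, k4⟩ := transport_exchange h hu' fun hh => h3.2 (hS' hh)
      refine ⟨S'', ?_, ?_, k3.trans h3, fun j hj hj' => ?_⟩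
      · simp only [carry]
        rw [if_pos hc]
        exact k1.mul h1
      · simp only [carry]
        rw [if_pos hc, Matrix.conjTranspose_mul]
        exact h2.mul k2
      · rw [k4 _ (hne j hj hj').1 (hne j hj hj').2, h4 j (by omega) hj']
    · have hc' := hc
      rw [Function.iterate_succ_apply'] at hc'
      rw [if_neg hc'] at hS'
      obtain ⟨S'', k1, k2, k3, k4⟩ := transport_exchange_conjTranspose h hu'
        fun hh => hS' (h3.1 hh)
      refine ⟨S'', ?_, ?_, k3.trans h3, fun j hj hj' => ?_⟩
      · simp only [carry]
        rw [if_neg hc]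
        exact k1.mul h1
      · simp only [carry]
        rw [if_neg hc, Matrix.conjTranspose_mul, Matrix.conjTranspose_conjTranspose]
        exact h2.mul k2
      · rw [k4 _ (hne j hj hj').1 (hne j hj hj').2, h4 j (by omega) hj']

/-- After the first anyon has been carried next to the second one, `hlast` makes both wound or both
unwound, so that `transport_lift` applies. Carrying back restores `S`. -/
lemma transport_liftAlong {u₀ : P.Slot} {S : Finset P.Slot} (G : PairOp A) (p : P.Slot)
    (wrap m : Prop) (hm : if wrap then p ∈ S ∧ ¬ m else (p ∈ S ↔ m)) (d : ℕ)
    (hd : d + 1 ≤ 2 * P.L + 1) (hu : ∀ i < d + 1, u₀ ≠ P.next^[i + 1] p)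
    (hS : ∀ i < d, if ¬ wrap ∧ (P.next^[i + 1] p).1.1 = p.1.1 then P.next^[i + 1] p ∈ S → m
      else m → P.next^[i + 1] p ∈ S) (hlast : P.next^[d + 1] p ∈ S ↔ m) :
    Transport u₀ S S (liftAlong 𝒜 P G p wrap (d + 1)) := by
  obtain ⟨S', h1, h2, h3, h4⟩ := transport_carry h p wrap m hm d (by omega)
    (fun i hi => hu i (by omega)) hS
  have hu' := hu d (by omega)
  have h5 := h4 (d + 1) (by omega) (by omega)
  rw [Function.iterate_succ_apply'] at hu' hlast h5
  simp only [liftAlong, Nat.add_sub_cancel]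
  exact (h2.mul (transport_lift h G hu' (by rw [h3, h5, hlast]))).mul h1

end Moves

end Neutral

end AnyonDecoder

/-! ### The invariant subspace: no lone charge, and all ground states belong to it -/

namespace AnyonDecoder

open scoped Matrix ComplexConjugate

section NeutralSpace

open scoped Classical

variable {A : Type*} [Fintype A] {𝒜 : AnyonData A} {P : Params}

namespace Params

variable (P)

lemma slotAt_add (x : ZMod P.L) (d n : ℕ) :
    P.slotAt (x + d) n = P.slotAt x (n + 2 * P.L * d) := by
  have hL := P.twenty_le_L
  have h1 : (n + 2 * P.L * d) / (2 * P.L) = n / (2 * P.L) + d :=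
    Nat.add_mul_div_left _ _ (by omega)
  have h2 : (n + 2 * P.L * d) / 2 = n / 2 + P.L * d := by
    rw [Nat.mul_assoc, Nat.add_mul_div_left _ _ (by omega)]
  have h3 : (n + 2 * P.L * d) % 2 = n % 2 := by
    rw [Nat.mul_assoc, Nat.add_mul_mod_self_left]
  simp only [slotAt, h1, h2, h3]
  push_cast
  simp [add_assoc, add_comm (d : ZMod P.L)]

/-- The chain is a single cycle. At least one step is taken, so that `p₀` itself is reached by a
full turn. -/
lemma exists_next_iterate (p₀ p : P.Slot) : ∃ k, p = P.next^[k + 1] p₀ := by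
  obtain ⟨n, hn, hp₀⟩ := P.eq_slotAt' p₀
  obtain ⟨m, -, hp⟩ := P.eq_slotAt' p
  have hL := P.twenty_le_L
  obtain ⟨d, hd, hx⟩ : ∃ d : ℕ, 1 ≤ d ∧ p.1.1 = p₀.1.1 + (d : ZMod P.L) :=
    ⟨(p.1.1 - p₀.1.1).val + P.L, by omega, by simp⟩
  have hp' : p = P.slotAt p₀.1.1 (m + 2 * P.L * d) := by rw [← slotAt_add, ← hx, ← hp]
  have key : ∀ k, P.next^[k] p₀ = P.slotAt p₀.1.1 (n + k) := fun k => by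
    conv_lhs => rw [hp₀]
    exact P.next_iterate_slotAt _ _ _
  have : 2 * P.L ≤ 2 * P.L * d := Nat.le_mul_of_pos_right _ (by omega)
  refine ⟨m + 2 * P.L * d - n - 1, ?_⟩
  rw [key, hp']
  congr 1
  omega

end Params

/-- Vectors supported on valid configurations with a trivial chain line entering `u₀`. -/
def lineVac (𝒜 : AnyonData A) (P : Params) (u₀ : P.Slot) : Set (Config 𝒜 P → ℂ) :=
  {v | ∀ s, v s ≠ 0 → s.Valid ∧ s.1 u₀ = 𝒜.vac}

/-- The states that arise from states with a trivial chain line entering `u₀` by fusing a string into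
the chain, followed by the windings at `S`. -/
noncomputable def neutralSpace (𝒜 : AnyonData A) (P : Params) (u₀ : P.Slot) (S : Finset P.Slot) :
    Submodule ℂ (Config 𝒜 P → ℂ) :=
  Submodule.span ℂ {w | ∃ X, ∃ v ∈ lineVac 𝒜 P u₀,
    w = (windSet 𝒜 P S * stringOp 𝒜 P X).mulVec v}

lemma Neutral.mulVec_mem {u₀ : P.Slot} {O : Op 𝒜 P} (hO : Neutral u₀ O) {v : Config 𝒜 P → ℂ}
    (hv : v ∈ lineVac 𝒜 P u₀) : O.mulVec v ∈ lineVac 𝒜 P u₀ := by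
  intro s' hs'
  obtain ⟨s, -, hs⟩ := Finset.exists_ne_zero_of_sum_ne_zero hs'
  have h1 := hv s (right_ne_zero_of_mul hs)
  have h2 := hO.2 s' s (left_ne_zero_of_mul hs) h1.1
  exact ⟨h2.1, h2.2.trans h1.2⟩

/-- Past the windings the operator becomes neutral, so it also passes the string and then acts on a
state with trivial line, a property that it preserves. -/
lemma Transport.mulVec_mem {u₀ : P.Slot} {S S' : Finset P.Slot} {O : Op 𝒜 P}
    (hO : Transport u₀ S S' O) {w : Config 𝒜 P → ℂ} (hw : w ∈ neutralSpace 𝒜 P u₀ S) :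
    O.mulVec w ∈ neutralSpace 𝒜 P u₀ S' := by
  obtain ⟨O', hO', e⟩ := hO
  induction hw using Submodule.span_induction with
  | mem w hw =>
    obtain ⟨X, v, hv, rfl⟩ := hw
    refine Submodule.subset_span ⟨X, O'.mulVec v, hO'.mulVec_mem hv, ?_⟩
    rw [Matrix.mulVec_mulVec, Matrix.mulVec_mulVec, ← Matrix.mul_assoc, e, Matrix.mul_assoc,
      Matrix.mul_assoc, (hO'.1 X).eq]
  | zero => rw [Matrix.mulVec_zero]; exact Submodule.zero_mem _
  | add x y _ _ hx hy => rw [Matrix.mulVec_add]; exact Submodule.add_mem _ hx hy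
  | smul c x _ hx => rw [Matrix.mulVec_smul]; exact Submodule.smul_mem _ _ hx

lemma transport_collapse (u₀ : P.Slot) (S : Finset P.Slot) (c : P.Site → A) :
    Transport u₀ S S (collapse 𝒜 P c) :=
  transport_diagonal u₀ S fun s' s _ _ he => by simp only [he]

/-- A single nontrivial charge is not possible if some chain line is trivial. -/
lemma charge_eq_vac (h : 𝒜.IsModular) {s : Config 𝒜 P} (hs : s.Valid) {u₀ : P.Slot}
    (hu : s.1 u₀ = 𝒜.vac) {p₀ : P.Slot} (hp : ∀ p, p ≠ p₀ → s.2.1 p = 𝒜.vac) :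
    s.2.1 p₀ = 𝒜.vac := by
  have hstep : ∀ p, p ≠ p₀ → s.1 (P.next p) = s.1 p := by
    intro p hpp
    have h1 := hs p
    rw [hp p hpp, h.N_vac_right] at h1
    by_contra hc
    rw [if_neg fun hh => hc hh.symm] at h1
    omega
  -- Trivial charges do not change the line, so a single label runs around the torus from `next p₀`
  -- back to `p₀`. It passes `u₀` and is therefore trivial, which leaves only the vacuum for the
  -- charge at `p₀`.
  have hconst : ∀ k, s.1 (P.next^[k + 1] p₀) = s.1 (P.next p₀) := by
    intro k
    induction k with
    | zero => rfl
    | succ k ih =>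
      rw [Function.iterate_succ_apply']
      by_cases hk : P.next^[k + 1] p₀ = p₀
      · rw [hk]
      · rw [hstep _ hk, ih]
  obtain ⟨k, hk⟩ := P.exists_next_iterate p₀ u₀
  obtain ⟨k', hk'⟩ := P.exists_next_iterate p₀ p₀
  have h1 : s.1 (P.next p₀) = 𝒜.vac := by rw [← hconst k, ← hk, hu]
  have h2 : s.1 p₀ = 𝒜.vac := by
    rw [hk', hconst k', h1]
  have h3 := hs p₀
  rw [h1, h2, h.N_vac_left] at h3
  by_contra hc
  rw [if_neg hc] at h3
  omega

/-- Windings and strings keep all charges, so the projection passes through them and meets a state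
with trivial line, which it annihilates by `charge_eq_vac`. -/
lemma collapse_mulVec_eq_zero (h : 𝒜.IsModular) {u₀ : P.Slot} {S : Finset P.Slot}
    {c : P.Site → A} {r₀ : P.Site} (hr₀ : c r₀ ≠ 𝒜.vac) (hc : ∀ r, r ≠ r₀ → c r = 𝒜.vac)
    {w : Config 𝒜 P → ℂ} (hw : w ∈ neutralSpace 𝒜 P u₀ S) : (collapse 𝒜 P c).mulVec w = 0 := by
  have hzero : ∀ v ∈ lineVac 𝒜 P u₀, (collapse 𝒜 P c).mulVec v = 0 := by
    intro v hv
    ext s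
    unfold collapse
    rw [Matrix.mulVec_diagonal, Pi.zero_apply]
    by_contra hne
    have h1 := hv s (right_ne_zero_of_mul hne)
    have h2 : ∀ r, s.2.1 (r, false) = c r ∧ s.2.1 (r, true) = 𝒜.vac := by
      by_contra hh
      rw [if_neg hh, zero_mul] at hne
      exact hne rfl
    have h3 := charge_eq_vac h h1.1 h1.2 (p₀ := (r₀, false)) fun p hp => by
      obtain ⟨r, b⟩ := p
      cases b
      · rw [(h2 r).1]
        exact hc r fun hh => hp (by rw [hh])
      · exact (h2 r).2
    rw [(h2 r₀).1] at h3
    exact hr₀ h3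
  have hn : Neutral u₀ (collapse 𝒜 P c) := neutral_diagonal u₀ fun s' s _ _ he => by simp only [he]
  have hw' : Commute (collapse 𝒜 P c) (windSet 𝒜 P S) :=
    commute_windSet fun p _ => commute_diagonal fun s' s hne => by
      simp only [(wind_apply_ne_zero hne).2.2.2]
  induction hw using Submodule.span_induction with
  | mem w hw =>
    obtain ⟨X, v, hv, rfl⟩ := hw
    rw [Matrix.mulVec_mulVec, ← Matrix.mul_assoc, hw'.eq, Matrix.mul_assoc, (hn.1 X).eq,
      ← Matrix.mul_assoc, ← Matrix.mulVec_mulVec, hzero v hv, Matrix.mulVec_zero]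
  | zero => rw [Matrix.mulVec_zero]
  | add x y _ _ hx hy => rw [Matrix.mulVec_add, hx, hy, add_zero]
  | smul c x _ hx => rw [Matrix.mulVec_smul, hx, smul_zero]

section Ground

variable (h : 𝒜.IsModular)
include h

lemma idx_pos : 0 < ∑ a, ∑ b, ∑ c, 𝒜.N a b c := by
  have h1 : 𝒜.N 𝒜.vac 𝒜.vac 𝒜.vac = 1 := by rw [h.N_vac_left, if_pos rfl]
  have h2 : 𝒜.N 𝒜.vac 𝒜.vac 𝒜.vac ≤ ∑ c, 𝒜.N 𝒜.vac 𝒜.vac c :=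
    Finset.single_le_sum (f := fun c => 𝒜.N 𝒜.vac 𝒜.vac c) (fun _ _ => Nat.zero_le _)
      (Finset.mem_univ 𝒜.vac)
  have h3 : ∑ c, 𝒜.N 𝒜.vac 𝒜.vac c ≤ ∑ b, ∑ c, 𝒜.N 𝒜.vac b c :=
    Finset.single_le_sum (f := fun b => ∑ c, 𝒜.N 𝒜.vac b c) (fun _ _ => Nat.zero_le _)
      (Finset.mem_univ 𝒜.vac)
  have h4 : ∑ b, ∑ c, 𝒜.N 𝒜.vac b c ≤ ∑ a, ∑ b, ∑ c, 𝒜.N a b c :=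
    Finset.single_le_sum (f := fun a => ∑ b, ∑ c, 𝒜.N a b c) (fun _ _ => Nat.zero_le _)
      (Finset.mem_univ 𝒜.vac)
  omega

/-- The configuration without anyons with the chain label `X`. -/
def emptyConfig (P : Params) (X : A) : Config 𝒜 P :=
  (fun _ => X, fun _ => 𝒜.vac, fun _ => ⟨0, idx_pos h⟩)

lemma N_vac_right_self (X : A) : 𝒜.N X 𝒜.vac X = 1 := by rw [h.N_vac_right, if_pos rfl]

lemma N_vac_left_self (X : A) : 𝒜.N 𝒜.vac X X = 1 := by rw [h.N_vac_left, if_pos rfl]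

lemma eq_of_N_vac_right {X Y : A} {n : ℕ} (hn : n < 𝒜.N X 𝒜.vac Y) : X = Y ∧ n = 0 := by
  rw [h.N_vac_right] at hn
  split_ifs at hn with hh
  · exact ⟨hh, by omega⟩
  · omega

lemma eq_of_N_vac_left {X Y : A} {n : ℕ} (hn : n < 𝒜.N 𝒜.vac X Y) : X = Y ∧ n = 0 := by
  rw [h.N_vac_left] at hn
  split_ifs at hn with hh
  · exact ⟨hh, by omega⟩
  · omega

lemma valid_emptyConfig (X : A) : (emptyConfig h P X).Valid := fun p => by
  simp [emptyConfig, N_vac_right_self h]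

lemma eq_emptyConfig {s : Config 𝒜 P} {X : A} (h1 : ∀ p, s.1 p = X) (h2 : ∀ p, s.2.1 p = 𝒜.vac)
    (h3 : ∀ p, (s.2.2 p : ℕ) = 0) : s = emptyConfig h P X := by
  refine Prod.ext (funext h1) (Prod.ext (funext h2) (funext fun p => Fin.ext (h3 p)))

/-- Without anyons all vertices are forced, so the closed string contributes a single term, which
equals `1` by `F_vac_mid`. -/
lemma stringOp_emptyConfig (X : A) (s : Config 𝒜 P) :
    stringOp 𝒜 P X s (emptyConfig h P 𝒜.vac) = if s = emptyConfig h P X then 1 else 0 := by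
  have key : ∀ m : P.Slot → 𝒜.Idx, s.Valid → s.2.1 = (fun _ => 𝒜.vac) →
      ∏ u, stringWeight X s (emptyConfig h P 𝒜.vac) m u ≠ 0 →
      s = emptyConfig h P X ∧ m = fun _ => ⟨0, idx_pos h⟩ := by
    intro m hv ha hne
    have hm : ∀ u, (m u : ℕ) < 𝒜.N X 𝒜.vac (s.1 u) := by
      intro u
      have := Finset.prod_ne_zero_iff.1 hne u (Finset.mem_univ u)
      unfold stringWeight at this
      by_contra hc
      exact this (if_neg fun hh => hc hh.1)
    have hx : ∀ u, s.1 u = X := fun u => (eq_of_N_vac_right h (hm u)).1.symm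
    refine ⟨eq_emptyConfig h hx (fun p => by rw [ha]) fun p => ?_, funext fun u => Fin.ext ?_⟩
    · have := hv p
      rw [ha] at this
      exact (eq_of_N_vac_right h this).2
    · exact (eq_of_N_vac_right h (hm u)).2
  unfold stringOp
  by_cases hs : s = emptyConfig h P X
  · rw [if_pos hs, if_pos ⟨valid_emptyConfig h _, hs ▸ valid_emptyConfig h _, by rw [hs]; rfl⟩,
      Finset.sum_eq_single (fun _ => ⟨0, idx_pos h⟩)]
    · refine Finset.prod_eq_one fun u _ => ?_
      rw [hs]
      unfold stringWeight
      have hF := h.F_vac_mid X 𝒜.vac X 0 0 (by rw [N_vac_right_self h]; omega)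
        (by rw [N_vac_right_self h]; omega)
      rw [if_pos ⟨by simp [emptyConfig, N_vac_right_self h], by simp [emptyConfig, N_vac_right_self h]⟩]
      simp only [emptyConfig, hF, if_true, map_one]
    · intro m _ hm
      by_contra hne
      exact hm (key m (hs ▸ valid_emptyConfig h _) (by rw [hs]; rfl) hne).2
    · exact fun hh => absurd (Finset.mem_univ _) hh
  · rw [if_neg hs]
    split_ifs with hv
    · refine Finset.sum_eq_zero fun m _ => ?_
      by_contra hne
      exact hs (key m hv.2.1 hv.2.2 hne).1
    · rfl

lemma R_vac_ne_zero (X : A) : 𝒜.R X 𝒜.vac X 0 0 * 𝒜.R 𝒜.vac X X 0 0 ≠ 0 := by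
  have h1 := h.R_unitary_left X 𝒜.vac X 0 0 (by rw [N_vac_right_self h]; omega)
    (by rw [N_vac_right_self h]; omega)
  have h2 := h.R_unitary_left 𝒜.vac X X 0 0 (by rw [N_vac_left_self h]; omega)
    (by rw [N_vac_left_self h]; omega)
  rw [N_vac_left_self h] at h1
  rw [N_vac_right_self h] at h2
  simp only [Finset.sum_range_one, if_true] at h1 h2
  refine mul_ne_zero ?_ ?_
  · intro hh
    rw [hh] at h1
    simp at h1
  · intro hh
    rw [hh] at h2
    simp at h2

lemma wind_emptyConfig (X : A) (p : P.Slot) (s : Config 𝒜 P) :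
    wind 𝒜 P p s (emptyConfig h P X) =
      if s = emptyConfig h P X then 𝒜.R X 𝒜.vac X 0 0 * 𝒜.R 𝒜.vac X X 0 0 else 0 := by
  by_cases hs : s = emptyConfig h P X
  · rw [if_pos hs, hs]
    unfold wind
    rw [if_pos ⟨valid_emptyConfig h _, valid_emptyConfig h _, rfl, rfl, fun _ _ => rfl⟩]
    simp [emptyConfig, N_vac_left_self h]
  · rw [if_neg hs]
    refine if_neg fun hh => hs ?_
    obtain ⟨-, hv, h1, h2, h3⟩ := hh
    refine eq_emptyConfig h (fun u => by rw [h1]; rfl) (fun u => by rw [h2]; rfl) fun u => ?_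
    have := hv u
    rw [h1, h2] at this
    exact (eq_of_N_vac_right h this).2

omit h in
lemma mulVec_single_eq {O : Op 𝒜 P} {s : Config 𝒜 P} {r : ℂ} {s' : Config 𝒜 P}
    (hO : ∀ t, O t s = if t = s' then r else 0) :
    O.mulVec (Pi.single s 1) = r • Pi.single s' 1 := by
  rw [Matrix.mulVec_single_one]
  ext t
  simp [Matrix.col, hO, Pi.single_apply]

/-- Winding a vacuum charge multiplies by a nonzero scalar. Its value is irrelevant, since
`neutralSpace` is a linear span. -/
lemma windSet_emptyConfig (X : A) (S : Finset P.Slot) : ∃ r : ℂ, r ≠ 0 ∧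
    (windSet 𝒜 P S).mulVec (Pi.single (emptyConfig h P X) 1) =
      r • Pi.single (emptyConfig h P X) 1 := by
  induction S using Finset.induction_on with
  | empty =>
    refine ⟨1, one_ne_zero, ?_⟩
    have : windSet 𝒜 P ∅ = 1 := Finset.noncommProd_empty _ _
    rw [this, Matrix.one_mulVec, one_smul]
  | insert p S hp ih =>
    obtain ⟨r, hr, e⟩ := ih
    refine ⟨r * (𝒜.R X 𝒜.vac X 0 0 * 𝒜.R 𝒜.vac X X 0 0), mul_ne_zero hr (R_vac_ne_zero h X), ?_⟩
    rw [windSet_insert _ _ hp, ← Matrix.mulVec_mulVec, e, Matrix.mulVec_smul,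
      mulVec_single_eq (wind_emptyConfig h X p), smul_smul]

/-- A ground state is a superposition of strings in the empty chain, and any windings can be
inserted at the price of a scalar. The choice of `u₀` and `S` can therefore be adapted to the block
of the error. -/
lemma groundState_mem (u₀ : P.Slot) (S : Finset P.Slot) (ψ : A → ℂ) :
    groundState 𝒜 P ψ ∈ neutralSpace 𝒜 P u₀ S := by
  have hg : groundState 𝒜 P ψ = ∑ X, ψ X • Pi.single (emptyConfig h P X) 1 := by
    ext s
    simp only [groundState, Finset.sum_apply, Pi.smul_apply, Pi.single_apply, smul_eq_mul,
      mul_ite, mul_one, mul_zero]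
    refine Finset.sum_congr rfl fun X _ => ?_
    congr 1
    refine propext ⟨fun hh => eq_emptyConfig h (fun p => (hh p).1) (fun p => (hh p).2.1)
      fun p => (hh p).2.2, ?_⟩
    rintro rfl p
    exact ⟨rfl, rfl, rfl⟩
  rw [hg]
  refine Submodule.sum_mem _ fun X _ => Submodule.smul_mem _ _ ?_
  obtain ⟨r, hr, e⟩ := windSet_emptyConfig h X S
  have : (Pi.single (emptyConfig h P X) 1 : Config 𝒜 P → ℂ) =
      r⁻¹ • (windSet 𝒜 P S * stringOp 𝒜 P X).mulVec (Pi.single (emptyConfig h P 𝒜.vac) 1) := by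
    rw [← Matrix.mulVec_mulVec, mulVec_single_eq (stringOp_emptyConfig h X), one_smul, e,
      smul_smul, inv_mul_cancel₀ hr, one_smul]
  rw [this]
  refine Submodule.smul_mem _ _ (Submodule.subset_span ⟨X, _, ?_, rfl⟩)
  intro s hs
  have : s = emptyConfig h P 𝒜.vac := by
    by_contra hc
    exact hs (Pi.single_eq_of_ne hc _)
  subst this
  exact ⟨valid_emptyConfig h _, rfl⟩

end Ground

end NeutralSpace

end AnyonDecoder

/-! ### Which edges preserve the invariant subspace -/

namespace AnyonDecoder

open scoped Matrix ComplexConjugate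

section Edges

open scoped Classical

variable {A : Type*} [Fintype A] {𝒜 : AnyonData A} {P : Params}

namespace Params

variable (P)

lemma slotAt_two_mul_add (x : ZMod P.L) (y : ℕ) (c : Bool) :
    P.slotAt x (2 * y + c.toNat) = ((x + ((y / P.L : ℕ) : ZMod P.L), (y : ZMod P.L)), c) := by
  have h1 : (2 * y + c.toNat) / 2 = y := by cases c <;> simp; omega
  have h2 : (2 * y + c.toNat) / (2 * P.L) = y / P.L := by rw [← Nat.div_div_eq_div_mul, h1]
  have h3 : (2 * y + c.toNat) % 2 = c.toNat := by cases c <;> simp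
  simp only [slotAt, h1, h2, h3]
  cases c <;> simp

/-- The endpoint of an edge that is reached from the first one along the chain. -/
noncomputable def last (e : P.Edge) : P.Site := if P.IsWrap e then P.tail e else P.head e

lemma head_false (r : P.Site) : P.head (r, false) = (r.1 + 1, r.2) := by simp [head, shift]

lemma head_true (r : P.Site) : P.head (r, true) = (r.1, r.2 + 1) := by simp [head, shift]

/-- The height of the first endpoint of an edge. -/
noncomputable def firstRow (e : P.Edge) : ℕ := if P.IsWrap e then 0 else e.1.2.val

lemma firstRow_lt (e : P.Edge) : P.firstRow e < P.L := by
  have := P.twenty_le_L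
  unfold firstRow
  split_ifs
  · omega
  · exact ZMod.val_lt _

lemma first_eq_slotAt (e : P.Edge) (c : Bool) :
    (P.first e, c) = P.slotAt e.1.1 (2 * P.firstRow e + c.toNat) := by
  rw [slotAt_two_mul_add, Nat.div_eq_of_lt (P.firstRow_lt e)]
  obtain ⟨⟨x, y⟩, b⟩ := e
  unfold first firstRow
  split_ifs with hw
  · obtain ⟨h1, h2⟩ := hw
    simp only at h1 h2
    subst h1 h2
    simp [head_true]
  · simp [tail]

lemma val_add_one {y : ZMod P.L} (hy : y ≠ -1) : y.val + 1 < P.L := by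
  have h1 := ZMod.val_lt y
  by_contra hc
  have h2 : y.val + 1 = P.L := by omega
  apply hy
  have h3 : ((y.val + 1 : ℕ) : ZMod P.L) = 0 := by rw [h2]; exact ZMod.natCast_self _
  push_cast at h3
  rw [ZMod.natCast_zmod_val] at h3
  exact eq_neg_of_add_eq_zero_left h3

lemma last_eq_slotAt (e : P.Edge) (c : Bool) :
    (P.last e, c) = P.slotAt e.1.1 (2 * (P.firstRow e + P.sep e) + c.toNat) := by
  have hL := P.twenty_le_L
  rw [slotAt_two_mul_add]
  obtain ⟨⟨x, y⟩, b⟩ := e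
  unfold last firstRow sep
  by_cases hw : P.IsWrap ((x, y), b)
  · simp only [if_pos hw]
    obtain ⟨h1, h2⟩ := hw
    simp only at h1 h2
    subst h1 h2
    have h3 : (0 + (P.L - 1)) / P.L = 0 := Nat.div_eq_of_lt (by omega)
    rw [h3]
    simp [tail, Nat.cast_sub (show 1 ≤ P.L by omega)]
  · simp only [if_neg hw]
    cases b
    · have h3 : (y.val + P.L) / P.L = 1 := by
        rw [Nat.add_div_right _ (by omega), Nat.div_eq_of_lt (ZMod.val_lt y)]
      simp [head_false, h3]
    · have hy : y ≠ -1 := fun hh => hw ⟨rfl, hh⟩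
      have h3 : (y.val + 1) / P.L = 0 := Nat.div_eq_of_lt (P.val_add_one hy)
      simp [head_true, h3]

lemma sep_pos (e : P.Edge) : 0 < P.sep e := by
  have hL := P.twenty_le_L
  unfold sep
  split_ifs <;> omega

lemma sep_le (e : P.Edge) : P.sep e ≤ P.L := by
  have hL := P.twenty_le_L
  unfold sep
  split_ifs <;> omega

lemma next_iterate_first (e : P.Edge) {c c' : Bool} {d : ℕ}
    (hd : d + c.toNat = 2 * P.sep e + c'.toNat) : P.next^[d] (P.first e, c) = (P.last e, c') := by
  rw [first_eq_slotAt, next_iterate_slotAt, last_eq_slotAt]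
  congr 1
  omega

lemma slotAt_fst_eq (x : ZMod P.L) {k : ℕ} (hk : k < 2 * P.L * P.L) :
    (P.slotAt x k).1.1 = x ↔ k < 2 * P.L := by
  have hL := P.twenty_le_L
  have h1 : k / (2 * P.L) < P.L := Nat.div_lt_of_lt_mul hk
  simp only [slotAt, add_eq_left]
  rw [ZMod.natCast_eq_zero_iff]
  constructor
  · intro h
    have := Nat.eq_zero_of_dvd_of_lt h h1
    rcases Nat.div_eq_zero_iff.1 this with h | h <;> omega
  · intro h
    rw [Nat.div_eq_of_lt h]
    exact dvd_zero _

/-- The slots of the sites in the row `0`. -/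
noncomputable def rowZero : Finset P.Slot := Finset.univ.filter fun p => p.1.2 = 0

lemma mem_rowZero (p : P.Slot) : p ∈ P.rowZero ↔ p.1.2 = 0 := by simp [rowZero]

lemma slotAt_mem_rowZero (x : ZMod P.L) (k : ℕ) : P.slotAt x k ∈ P.rowZero ↔ P.L ∣ k / 2 := by
  rw [mem_rowZero, ← ZMod.natCast_eq_zero_iff]
  rfl

/-- The edges along which anyons can be moved without destroying the triviality of the chain line
entering the column `x` from the south, if the windings at `S` are taken into account. -/
def Compatible (x : ZMod P.L) (S : Finset P.Slot) (e : P.Edge) : Prop :=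
  (e.1.1 = x ∨ e.2 = true ∧ e.1.1 = x + 1) ∧
    (S = ∅ ∧ ¬ P.IsWrap e ∨ S = P.rowZero ∧ (P.IsWrap e ∨ e.2 = false))

/-- The number `k` counts positions from the south end of the column `x`, where the distinguished
line enters. The bound shows that the path along the edge does not run around the chain to cross
this line. -/
lemma Compatible.slotAt {x : ZMod P.L} {S : Finset P.Slot} {e : P.Edge} (he : P.Compatible x S e)
    (c : Bool) : ∃ k, k + 2 * P.sep e + 1 < 4 * P.L + 2 ∧ (P.first e, c) = P.slotAt x (k + c.toNat) ∧
      (e.1.1 = x → k = 2 * P.firstRow e) ∧ (e.2 = true → k % (2 * P.L) = 2 * P.firstRow e) := by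
  have hL := P.twenty_le_L
  have hf := P.firstRow_lt e
  have hs := P.sep_le e
  by_cases hx : e.1.1 = x
  · refine ⟨2 * P.firstRow e, by omega, ?_, fun _ => rfl, fun _ => Nat.mod_eq_of_lt (by omega)⟩
    rw [first_eq_slotAt, hx]
  · have h1 := he.1.resolve_left hx
    refine ⟨2 * P.firstRow e + 2 * P.L, ?_, ?_, fun hh => absurd hh hx, fun _ => ?_⟩
    · by_cases hw : P.IsWrap e
      · have h2 : P.firstRow e = 0 := if_pos hw
        omega
      · have h2 : P.sep e = 1 := by
          unfold sep; rw [if_neg hw, if_pos h1.1]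
        have h3 : P.firstRow e = e.1.2.val := if_neg hw
        have h4 := P.val_add_one (y := e.1.2) fun hh => hw ⟨h1.1, hh⟩
        omega
    · have := P.slotAt_add x 1 (2 * P.firstRow e + c.toNat)
      rw [first_eq_slotAt, h1.2]
      push_cast at this
      rw [this]
      congr 1
      omega
    · rw [Nat.add_mod_right, Nat.mod_eq_of_lt (by omega)]

end Params

/-- The two slots of a site lie in the same row, so they are both wound or both unwound. -/
lemma transport_fuse (h : 𝒜.IsModular) (x : ZMod P.L) {S : Finset P.Slot}
    (hS : S = ∅ ∨ S = P.rowZero) (G : PairOp A) (r : P.Site) :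
    Transport (P.slotAt x 0) S S (liftAlong 𝒜 P G (r, false) False 1) := by
  have hL := P.twenty_le_L
  refine transport_liftAlong h G (r, false) False ((r, false) ∈ S) (by simp) 0 (by omega) ?_
    (by simp) ?_
  · intro i hi
    have : i = 0 := by omega
    subst this
    simp [Params.next, Params.slotAt]
  · rcases hS with rfl | rfl
    · simp
    · simp [Params.mem_rowZero, Params.next]

/-- Without windings the only obstacle is a wrapping path. With row `0` wound, all crossings have
the sense required by `transport_carry`: for a wrapping edge `m` is false, since its path unwinds
the start, and for a horizontal edge `m` says that the edge lies in row `0`. -/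
lemma transport_edge (h : 𝒜.IsModular) {x : ZMod P.L} {S : Finset P.Slot} {e : P.Edge}
    (he : P.Compatible x S e) (G : PairOp A) {c c' : Bool} {d : ℕ} (hd0 : 0 < d)
    (hd : d + c.toNat = 2 * P.sep e + c'.toNat) :
    Transport (P.slotAt x 0) S S (liftAlong 𝒜 P G (P.first e, c) (P.IsWrap e) d) := by
  have hL := P.twenty_le_L
  have hLL : 4 * P.L + 4 < 2 * P.L * P.L := by nlinarith
  have hc : c.toNat ≤ 1 := Bool.toNat_le c
  have hc' : c'.toNat ≤ 1 := Bool.toNat_le c'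
  have hf := P.firstRow_lt e
  have hsl := P.sep_le e
  obtain ⟨k, hk, hp, hkx, hkv⟩ := he.slotAt P c
  obtain ⟨d, rfl⟩ := Nat.exists_eq_succ_of_ne_zero hd0.ne'
  have hu : ∀ i < d + 1, P.slotAt x 0 ≠ P.next^[i + 1] (P.first e, c) := by
    intro i hi hh
    rw [hp, Params.next_iterate_slotAt] at hh
    have := P.slotAt_injOn x (by omega) (by omega) hh
    omega
  rcases he.2 with ⟨rfl, hw⟩ | ⟨rfl, hw⟩
  · exact transport_liftAlong h G _ _ False (by simp [hw]) d (by omega) hu (by simp) (by simp)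
  by_cases hw' : P.IsWrap e
  · have h0 : P.firstRow e = 0 := if_pos hw'
    have hs : P.sep e = P.L - 1 := if_pos hw'
    have h1 := hkv hw'.1
    rw [h0, Nat.mul_zero] at h1
    obtain ⟨i, hi⟩ := Nat.dvd_of_mod_eq_zero h1
    refine transport_liftAlong h G _ _ False ?_ d (by omega) hu (by simp [hw']) ?_
    · rw [if_pos hw', hp, Params.slotAt_mem_rowZero]
      refine ⟨⟨i, ?_⟩, not_false⟩
      rw [hi, Nat.mul_assoc, Nat.mul_add_div (by omega), Nat.div_eq_of_lt (by omega), Nat.add_zero]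
    · rw [iff_false, hp, Params.next_iterate_slotAt, Params.slotAt_mem_rowZero, hi, Nat.mul_assoc,
        Nat.add_assoc, Nat.mul_add_div (by omega), Nat.dvd_add_right (Dvd.intro _ rfl)]
      exact fun hh => by
        have := Nat.le_of_dvd (by omega) hh
        omega
  · have hb := hw.resolve_left hw'
    have hx : e.1.1 = x := he.1.resolve_right fun hh => by simp [hb] at hh
    have hk' := hkx hx
    have hs : P.sep e = P.L := by unfold Params.sep; rw [if_neg hw']; simp [hb]
    have hmem : ∀ j, P.next^[j] (P.first e, c) ∈ P.rowZero ↔ P.L ∣ (k + c.toNat + j) / 2 := by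
      intro j
      rw [hp, Params.next_iterate_slotAt, Params.slotAt_mem_rowZero]
    -- In its own column the path meets a slot of row `0` only if it starts there. In the next
    -- column, a path from row `0` can cross only a slot of row `0` before it ends.
    refine transport_liftAlong h G _ _ (P.firstRow e = 0) ?_ d (by omega) hu ?_ ?_
    · rw [if_neg hw']
      have h1 := hmem 0
      simp only [Function.iterate_zero, id_eq] at h1
      rw [h1]
      constructor
      · intro hh
        by_contra h0
        have := Nat.le_of_dvd (by omega) hh
        omega
      · intro hh
        have : (k + c.toNat + 0) / 2 = 0 := by omega
        rw [this]; exact dvd_zero _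
    · intro i hi
      have hcol : (P.next^[i + 1] (P.first e, c)).1.1 = (P.first e, c).1.1 ↔
          k + c.toNat + (i + 1) < 2 * P.L := by
        rw [← P.slotAt_fst_eq x (by omega), ← P.next_iterate_slotAt, ← hp]
        have : (P.first e, c).1.1 = x := by
          rw [hp, P.slotAt_fst_eq x (by omega)]; omega
        rw [this]
      rw [hmem]
      split_ifs with hh
      · intro hd'
        have := hcol.1 hh.2
        by_contra h0
        have := Nat.le_of_dvd (by omega) hd'
        omega
      · intro h0
        have hh' : ¬ k + c.toNat + (i + 1) < 2 * P.L := fun hlt => hh ⟨hw', hcol.2 hlt⟩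
        have : (k + c.toNat + (i + 1)) / 2 = P.L := by omega
        rw [this]
    · rw [hmem]
      have h2 : (k + c.toNat + (d + 1)) / 2 = P.firstRow e + P.L := by omega
      rw [h2, Nat.dvd_add_self_right]
      exact ⟨fun hh => Nat.eq_zero_of_dvd_of_lt hh hf, fun hh => by rw [hh]; exact dvd_zero _⟩

end Edges

end AnyonDecoder

/-! ### Density operators: ranges, supporting configurations and possible histories -/

namespace AnyonDecoder

open scoped Matrix ComplexConjugate

section Channels

open scoped Classical

variable {A : Type*} [Fintype A] {𝒜 : AnyonData A} {P : Params}

/-- The range of `ρ` is contained in `V`. -/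
def RangeIn (ρ : Op 𝒜 P) (V : Submodule ℂ (Config 𝒜 P → ℂ)) : Prop := ∀ w, ρ.mulVec w ∈ V

/-- All Kraus operators are of the form `liftAlong` along one fixed path, so invariance of `V` under
all pair operators along this path suffices. -/
lemma rangeIn_channel {ρ : Op 𝒜 P} {V : Submodule ℂ (Config 𝒜 P → ℂ)} {K : KIdx 𝒜 → PairOp A}
    {p : P.Slot} {wrap : Prop} {d : ℕ} (hρ : RangeIn ρ V)
    (hK : ∀ G, ∀ w ∈ V, (liftAlong 𝒜 P G p wrap d).mulVec w ∈ V) :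
    RangeIn (channel 𝒜 P K p wrap d ρ) V := by
  intro w
  unfold channel
  rw [Matrix.sum_mulVec]
  refine Submodule.sum_mem _ fun k _ => ?_
  rw [← Matrix.mulVec_mulVec, ← Matrix.mulVec_mulVec]
  exact hK _ _ (hρ _)

lemma rangeIn_collapse_mul {ρ : Op 𝒜 P} {V : Submodule ℂ (Config 𝒜 P → ℂ)} {c : P.Site → A}
    (hρ : RangeIn ρ V) (hc : ∀ w ∈ V, (collapse 𝒜 P c).mulVec w ∈ V) :
    RangeIn (collapse 𝒜 P c * ρ * collapse 𝒜 P c) V := by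
  intro w
  rw [← Matrix.mulVec_mulVec, ← Matrix.mulVec_mulVec]
  exact hc _ (hρ _)

/-- The nonzero rows of `ρ` satisfy `T`. -/
def RowIn (ρ : Op 𝒜 P) (T : Config 𝒜 P → Prop) : Prop := ∀ s s', ρ s s' ≠ 0 → T s

lemma RowIn.mono {ρ : Op 𝒜 P} {T T' : Config 𝒜 P → Prop} (h : RowIn ρ T) (hT : ∀ s, T s → T' s) :
    RowIn ρ T' := fun s s' hne => hT s (h s s' hne)

lemma rowIn_mul {O ρ : Op 𝒜 P} {T T' : Config 𝒜 P → Prop} (h : RowIn ρ T)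
    (hO : ∀ s' s, O s' s ≠ 0 → T s → T' s') : RowIn (O * ρ) T' := by
  intro s s' hne
  obtain ⟨u, -, hu⟩ := Finset.exists_ne_zero_of_sum_ne_zero hne
  exact hO s u (left_ne_zero_of_mul hu) (h u s' (right_ne_zero_of_mul hu))

lemma RowIn.mul_right {O ρ : Op 𝒜 P} {T : Config 𝒜 P → Prop} (h : RowIn ρ T) :
    RowIn (ρ * O) T := by
  intro s s' hne
  obtain ⟨u, -, hu⟩ := Finset.exists_ne_zero_of_sum_ne_zero hne
  exact h s u (left_ne_zero_of_mul hu)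

lemma rowIn_channel {ρ : Op 𝒜 P} {T T' : Config 𝒜 P → Prop} {K : KIdx 𝒜 → PairOp A}
    {p : P.Slot} {wrap : Prop} {d : ℕ} (hρ : RowIn ρ T)
    (hK : ∀ k s' s, liftAlong 𝒜 P (K k) p wrap d s' s ≠ 0 → T s → T' s') :
    RowIn (channel 𝒜 P K p wrap d ρ) T' := by
  intro s s' hne
  unfold channel at hne
  rw [Matrix.sum_apply] at hne
  obtain ⟨k, -, hk⟩ := Finset.exists_ne_zero_of_sum_ne_zero hne
  exact (rowIn_mul hρ (hK k)).mul_right s s' hk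

lemma channel_zero (K : KIdx 𝒜 → PairOp A) (p : P.Slot) (wrap : Prop) (d : ℕ) :
    channel 𝒜 P K p wrap d 0 = 0 := by
  unfold channel
  refine Finset.sum_eq_zero fun k _ => ?_
  rw [Matrix.mul_zero, Matrix.zero_mul]

lemma displace_zero (r : P.Site) (v : ℤ × ℤ) (q : A) : displace 𝒜 P r v q 0 = 0 := by
  unfold displace
  split_ifs <;> exact channel_zero _ _ _ _

lemma fuseAll_zero : fuseAll 𝒜 P 0 = 0 := List.foldl_fixed' (fun _ => channel_zero _ _ _ _) _

variable {ℰ : Set (Err A P)} {h : History A P}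

lemma noiseStep_zero (order : List P.Edge) (t : ℕ) : noiseStep 𝒜 ℰ order t 0 = 0 :=
  List.foldl_fixed' (fun e => by split_ifs; exacts [channel_zero _ _ _ _, rfl]) _

/-- The `i`-th elementary displacement of the level-`k` rule at `r`. -/
noncomputable def siteStep (𝒜 : AnyonData A) (ℰ : Set (Err A P)) (h : History A P) (k t i : ℕ)
    (r : P.Site) (ρ : Op 𝒜 P) : Op 𝒜 P :=
  match appliedRule 𝒜 ℰ h k t r with
  | some v => displace 𝒜 P (P.shift r i v) v (ruleCharge 𝒜 ℰ h k t r) ρ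
  | none => ρ

/-- The simultaneous `i`-th elementary displacements of the level-`k` rules. -/
noncomputable def sweep (𝒜 : AnyonData A) (ℰ : Set (Err A P)) (h : History A P) (k t i : ℕ)
    (ρ : Op 𝒜 P) : Op 𝒜 P :=
  (Finset.univ : Finset P.Site).toList.foldl (fun ρ r => siteStep 𝒜 ℰ h k t i r ρ) ρ

lemma levelStep_eq (k t : ℕ) (ρ : Op 𝒜 P) : levelStep 𝒜 ℰ h k t ρ =
    (List.range (P.Q ^ k)).foldl (fun ρ i => fuseAll 𝒜 P (sweep 𝒜 ℰ h k t i ρ)) ρ := rfl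

lemma siteStep_of_some {k t i : ℕ} {r : P.Site} {v : ℤ × ℤ}
    (hv : appliedRule 𝒜 ℰ h k t r = some v) (ρ : Op 𝒜 P) : siteStep 𝒜 ℰ h k t i r ρ =
      displace 𝒜 P (P.shift r i v) v (ruleCharge 𝒜 ℰ h k t r) ρ := by
  unfold siteStep
  rw [hv]

lemma siteStep_of_none {k t i : ℕ} {r : P.Site}
    (hv : appliedRule 𝒜 ℰ h k t r = none) (ρ : Op 𝒜 P) : siteStep 𝒜 ℰ h k t i r ρ = ρ := by
  unfold siteStep
  rw [hv]

lemma sweep_zero (k t i : ℕ) : sweep 𝒜 ℰ h k t i 0 = 0 := by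
  refine List.foldl_fixed' (fun r => ?_) _
  cases hv : appliedRule 𝒜 ℰ h k t r
  · exact siteStep_of_none hv _
  · rw [siteStep_of_some hv, displace_zero]

lemma levelStep_zero (k t : ℕ) : levelStep 𝒜 ℰ h k t 0 = 0 := by
  rw [levelStep_eq]
  exact List.foldl_fixed' (fun i => by rw [sweep_zero, fuseAll_zero]) _

lemma ruleStep_zero (t : ℕ) : ruleStep 𝒜 ℰ h t 0 = 0 :=
  List.foldl_fixed' (fun k => levelStep_zero k t) _

variable {𝒱 : Env A P}

/-- The state before the projection at time `(j + 1) / 2`. -/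
noncomputable def preState (𝒱 : Env A P) (ℰ : Set (Err A P)) (h : History A P) (j : ℕ) : Op 𝒜 P :=
  if j % 2 = 0 then noiseStep 𝒜 ℰ (𝒱.order (j / 2)) (j / 2) (evolve 𝒜 𝒱 ℰ h j)
    else ruleStep 𝒜 ℰ h (j / 2) (evolve 𝒜 𝒱 ℰ h j)

lemma evolve_succ (j : ℕ) : evolve 𝒜 𝒱 ℰ h (j + 1) =
    collapse 𝒜 P (h (j + 1)) * preState 𝒱 ℰ h j * collapse 𝒜 P (h (j + 1)) := rfl

lemma preState_even (t : ℕ) : preState 𝒱 ℰ h (2 * t) =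
    noiseStep 𝒜 ℰ (𝒱.order t) t (evolve 𝒜 𝒱 ℰ h (2 * t)) := by
  unfold preState
  rw [if_pos (by omega), Nat.mul_div_cancel_left _ (by omega)]

lemma preState_odd (t : ℕ) : preState 𝒱 ℰ h (2 * t + 1) =
    ruleStep 𝒜 ℰ h t (evolve 𝒜 𝒱 ℰ h (2 * t + 1)) := by
  have h1 : (2 * t + 1) / 2 = t := by omega
  unfold preState
  rw [if_neg (by omega), h1]

/-- Possibility is used below only through the density operator being nonzero. This passes to
earlier times because every step maps zero to zero, without any appeal to positivity. -/
lemma Possible.evolve_ne_zero {j : ℕ} (hp : Possible 𝒜 𝒱 ℰ h j) : evolve 𝒜 𝒱 ℰ h j ≠ 0 := by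
  intro h0
  unfold Possible histProb at hp
  rw [h0, Matrix.trace_zero] at hp
  simp at hp

lemma evolve_ne_zero_of_succ {j : ℕ} (hj : evolve 𝒜 𝒱 ℰ h (j + 1) ≠ 0) :
    evolve 𝒜 𝒱 ℰ h j ≠ 0 := by
  intro h0
  apply hj
  rw [evolve_succ]
  have : preState (𝒜 := 𝒜) 𝒱 ℰ h j = 0 := by
    unfold preState
    rw [h0]
    split_ifs
    · exact noiseStep_zero _ _
    · exact ruleStep_zero _
  rw [this, Matrix.mul_zero, Matrix.zero_mul]

lemma evolve_ne_zero_of_le {i j : ℕ} (hij : i ≤ j) (hj : evolve 𝒜 𝒱 ℰ h j ≠ 0) :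
    evolve 𝒜 𝒱 ℰ h i ≠ 0 := by
  induction hij with
  | refl => exact hj
  | step _ ih => exact ih (evolve_ne_zero_of_succ hj)

/-- The configuration has the charges `c`. -/
def HasCharges (c : P.Site → A) (s : Config 𝒜 P) : Prop :=
  ∀ r, s.2.1 (r, false) = c r ∧ s.2.1 (r, true) = 𝒜.vac

lemma collapse_apply_ne_zero {c : P.Site → A} {s' s : Config 𝒜 P}
    (hne : collapse 𝒜 P c s' s ≠ 0) : s' = s ∧ HasCharges c s := by
  unfold collapse at hne
  have h1 : s' = s := by
    by_contra hc
    exact hne (Matrix.diagonal_apply_ne _ hc)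
  subst h1
  rw [Matrix.diagonal_apply_eq] at hne
  refine ⟨rfl, ?_⟩
  by_contra hc
  exact hne (if_neg hc)

/-- A nonzero operator has a nonzero row. Its configuration shows the recorded charges and has every
property of the rows before the projection, so statements about amplitudes become statements about
histories. -/
lemma exists_of_evolve_succ_ne_zero {j : ℕ} (hj : evolve 𝒜 𝒱 ℰ h (j + 1) ≠ 0)
    {T : Config 𝒜 P → Prop} (hT : RowIn (preState 𝒱 ℰ h j) T) :
    ∃ s, T s ∧ HasCharges (h (j + 1)) s := by
  have : RowIn (evolve 𝒜 𝒱 ℰ h (j + 1)) fun s => T s ∧ HasCharges (h (j + 1)) s := by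
    rw [evolve_succ]
    refine RowIn.mul_right (rowIn_mul hT fun s' s hne hs => ?_)
    have := collapse_apply_ne_zero hne
    rw [this.1]
    exact ⟨hs, this.2⟩
  by_contra hc
  apply hj
  ext s s'
  by_contra hne
  exact hc ⟨s, this s s' hne⟩

lemma rowIn_evolve_charges (j : ℕ) : RowIn (evolve 𝒜 𝒱 ℰ h j) (HasCharges (h j)) := by
  cases j with
  | zero =>
    refine RowIn.mul_right (rowIn_mul (T := fun _ => True) (fun _ _ _ => trivial) ?_)
    intro s' s hne _
    have := collapse_apply_ne_zero hne
    rw [this.1]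
    exact this.2
  | succ j =>
    refine RowIn.mul_right (rowIn_mul (T := fun _ => True) (fun _ _ _ => trivial) ?_)
    intro s' s hne _
    have := collapse_apply_ne_zero hne
    rw [this.1]
    exact this.2

lemma initial_vac (h0 : evolve 𝒜 𝒱 ℰ h 0 ≠ 0) (r : P.Site) : h 0 r = 𝒜.vac := by
  have : RowIn (evolve 𝒜 𝒱 ℰ h 0) fun s => (∀ p, s.2.1 p = 𝒜.vac) ∧ HasCharges (h 0) s := by
    refine RowIn.mul_right (rowIn_mul (T := fun s => ∀ p, s.2.1 p = 𝒜.vac) ?_ ?_)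
    · intro s s' hne
      have h1 := left_ne_zero_of_mul hne
      obtain ⟨x, -, hx⟩ := Finset.exists_ne_zero_of_sum_ne_zero h1
      intro p
      by_contra hc
      exact hx (if_neg fun hh => hc (hh p).2.1)
    · intro s' s hne hs
      have := collapse_apply_ne_zero hne
      rw [this.1]
      exact ⟨hs, this.2⟩
  by_contra hc
  apply h0
  ext s s'
  by_contra hne
  have h1 := this s s' hne
  exact hc ((h1.2 r).1.symm.trans (h1.1 _))

section Range

variable (hm : 𝒜.IsModular)
include hm

lemma rangeIn_evolve_zero (u₀ : P.Slot) (S : Finset P.Slot) :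
    RangeIn (evolve 𝒜 𝒱 ℰ h 0) (neutralSpace 𝒜 P u₀ S) := by
  refine rangeIn_collapse_mul (fun w => ?_) fun w hw => (transport_collapse u₀ S _).mulVec_mem hw
  have : (Matrix.vecMulVec (groundState 𝒜 P 𝒱.ψ) (star (groundState 𝒜 P 𝒱.ψ))).mulVec w =
      (star (groundState 𝒜 P 𝒱.ψ) ⬝ᵥ w) • groundState 𝒜 P 𝒱.ψ := by
    rw [Matrix.vecMulVec_mulVec]
    ext
    simp [mul_comm]
  rw [this]
  exact Submodule.smul_mem _ _ (groundState_mem hm u₀ S _)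

/-- A projection onto a lone charge annihilates the range of the preceding state, so such a history
would have a vanishing density operator. Control of the left factor alone is enough. -/
lemma not_single_charge {u₀ : P.Slot} {S : Finset P.Slot} {j : ℕ}
    (hr : RangeIn (preState 𝒱 ℰ h j) (neutralSpace 𝒜 P u₀ S))
    (hj : evolve 𝒜 𝒱 ℰ h (j + 1) ≠ 0) {r₀ : P.Site} (hr₀ : h (j + 1) r₀ ≠ 𝒜.vac) :
    ∃ r, r ≠ r₀ ∧ h (j + 1) r ≠ 𝒜.vac := by
  by_contra hc
  push Not at hc
  apply hj
  rw [evolve_succ]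
  have : collapse 𝒜 P (h (j + 1)) * preState 𝒱 ℰ h j = 0 := by
    apply Matrix.toLin'.injective
    ext1
    ext1
    ext1
    simp only [LinearMap.comp_apply, Matrix.toLin'_apply, ← Matrix.mulVec_mulVec]
    rw [collapse_mulVec_eq_zero hm hr₀ hc (hr _)]
    simp
  rw [this, Matrix.zero_mul]

end Range

end Channels

end AnyonDecoder

/-! ### How the elementary processes change the charges -/

namespace AnyonDecoder

open scoped Matrix ComplexConjugate

section Charges

open scoped Classical

variable {A : Type*} [Fintype A] {𝒜 : AnyonData A} {P : Params}

lemma lift_ne_zero {G : PairOp A} {p : P.Slot} {s' s : Config 𝒜 P} (hne : lift 𝒜 P G p s' s ≠ 0) :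
    s.Valid ∧ s'.Valid ∧ (∀ u, u ≠ p → u ≠ P.next p → s'.2.1 u = s.2.1 u) ∧
      ∃ e κ κ', κ < 𝒜.N (s.2.1 p) (s.2.1 (P.next p)) e ∧
        κ' < 𝒜.N (s'.2.1 p) (s'.2.1 (P.next p)) e ∧
        G (s.2.1 p) (s.2.1 (P.next p)) e κ (s'.2.1 p) (s'.2.1 (P.next p)) κ' ≠ 0 := by
  unfold lift at hne
  simp only at hne
  split_ifs at hne with hc
  · obtain ⟨e, -, he⟩ := Finset.exists_ne_zero_of_sum_ne_zero hne
    obtain ⟨κ, hκ, he⟩ := Finset.exists_ne_zero_of_sum_ne_zero he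
    obtain ⟨κ', hκ', he⟩ := Finset.exists_ne_zero_of_sum_ne_zero he
    obtain ⟨m, -, he⟩ := Finset.exists_ne_zero_of_sum_ne_zero he
    exact ⟨hc.1, hc.2.1, fun u h1 h2 => (hc.2.2.2 u h1 h2).1, e, κ, κ', Finset.mem_range.1 hκ,
      Finset.mem_range.1 hκ', right_ne_zero_of_mul (left_ne_zero_of_mul he)⟩
  · exact absurd rfl hne

lemma lift_exchange_charges {p : P.Slot} {s' s : Config 𝒜 P}
    (hne : lift 𝒜 P (exchange 𝒜) p s' s ≠ 0) :
    s.Valid ∧ s'.Valid ∧ s'.2.1 = s.2.1 ∘ Equiv.swap p (P.next p) := by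
  obtain ⟨h1, h2, h3, e, κ, κ', -, -, hG⟩ := lift_ne_zero hne
  refine ⟨h1, h2, funext fun u => ?_⟩
  unfold exchange at hG
  have hG' : s'.2.1 p = s.2.1 (P.next p) ∧ s'.2.1 (P.next p) = s.2.1 p := by
    by_contra hc
    exact hG (if_neg hc)
  rw [Function.comp_apply]
  by_cases hp : u = p
  · rw [hp, Equiv.swap_apply_left]
    exact hG'.1
  by_cases hq : u = P.next p
  · rw [hq, Equiv.swap_apply_right]
    exact hG'.2
  · rw [Equiv.swap_apply_of_ne_of_ne hp hq]
    exact h3 u hp hq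

lemma lift_exchange_conjTranspose_charges {p : P.Slot} {s' s : Config 𝒜 P}
    (hne : (lift 𝒜 P (exchange 𝒜) p)ᴴ s' s ≠ 0) :
    s.Valid ∧ s'.Valid ∧ s'.2.1 = s.2.1 ∘ Equiv.swap p (P.next p) := by
  rw [Matrix.conjTranspose_apply, star_ne_zero] at hne
  obtain ⟨h1, h2, h3⟩ := lift_exchange_charges hne
  refine ⟨h2, h1, ?_⟩
  rw [h3]
  ext u
  simp

/-- The permutation of the positions effected by `carry`. -/
def carryPerm (p : P.Slot) : ℕ → Equiv.Perm P.Slot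
  | 0 => 1
  | d + 1 => carryPerm p d * Equiv.swap (P.next^[d] p) (P.next (P.next^[d] p))

lemma carryPerm_apply (p : P.Slot) (d : ℕ) : carryPerm p d (P.next^[d] p) = p := by
  induction d with
  | zero => rfl
  | succ d ih =>
    rw [carryPerm, Equiv.Perm.mul_apply, Function.iterate_succ_apply', Equiv.swap_apply_right, ih]

lemma carryPerm_apply_of_lt (p : P.Slot) {d j : ℕ} (hd : d < j) (hj : j ≤ 2 * P.L + 1) :
    carryPerm p d (P.next^[j] p) = P.next^[j] p := by
  induction d with
  | zero => rfl
  | succ d ih =>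
    rw [carryPerm, Equiv.Perm.mul_apply, Equiv.swap_apply_of_ne_of_ne, ih (by omega)]
    · exact (P.next_iterate_ne p (by omega) hj).symm
    · rw [← Function.iterate_succ_apply' P.next]
      exact (P.next_iterate_ne p hd hj).symm

/-- Exchanges of either sense permute the charges alike, and windings keep them. Validity appears as
an equivalence because for `d = 0` the identity acts on invalid configurations as well. -/
lemma carry_charges {p : P.Slot} {wrap : Prop} {d : ℕ} {s' s : Config 𝒜 P}
    (hne : carry 𝒜 P p wrap d s' s ≠ 0) :
    (s.Valid ↔ s'.Valid) ∧ s'.2.1 = s.2.1 ∘ carryPerm p d := by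
  induction d generalizing s' with
  | zero =>
    unfold carry at hne
    split_ifs at hne with hw
    · rw [Matrix.conjTranspose_apply, star_ne_zero] at hne
      obtain ⟨h1, h2, -, h3⟩ := wind_apply_ne_zero hne
      exact ⟨iff_of_true h2 h1, h3.symm⟩
    · have : s' = s := by
        by_contra hc
        exact hne (Matrix.one_apply_ne hc)
      rw [this]
      exact ⟨Iff.rfl, rfl⟩
  | succ d ih =>
    rw [carry, Matrix.mul_apply] at hne
    obtain ⟨u, -, hu⟩ := Finset.exists_ne_zero_of_sum_ne_zero hne
    obtain ⟨h1, h2⟩ := ih (right_ne_zero_of_mul hu)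
    have h3 := left_ne_zero_of_mul hu
    have h4 : u.Valid ∧ s'.Valid ∧ s'.2.1 =
        u.2.1 ∘ Equiv.swap (P.next^[d] p) (P.next (P.next^[d] p)) := by
      split_ifs at h3
      · exact lift_exchange_charges h3
      · exact lift_exchange_conjTranspose_charges h3
    refine ⟨h1.trans (iff_of_true h4.1 h4.2.1), ?_⟩
    rw [h4.2.2, h2, carryPerm]
    rfl

/-- Carrying there and back permutes the charges by mutually inverse permutations, so only the two
endpoints of the path are affected. -/
lemma liftAlong_charges {G : PairOp A} {p : P.Slot} {wrap : Prop} {d : ℕ} (hd0 : 0 < d)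
    (hd : d ≤ 2 * P.L + 1) {s' s : Config 𝒜 P} (hne : liftAlong 𝒜 P G p wrap d s' s ≠ 0)
    {q : P.Slot} (hq : P.next^[d] p = q) :
    s'.Valid ∧ (∀ u, u ≠ p → u ≠ q → s'.2.1 u = s.2.1 u) ∧
      ∃ e κ κ', κ < 𝒜.N (s.2.1 p) (s.2.1 q) e ∧ κ' < 𝒜.N (s'.2.1 p) (s'.2.1 q) e ∧
        G (s.2.1 p) (s.2.1 q) e κ (s'.2.1 p) (s'.2.1 q) κ' ≠ 0 := by
  obtain ⟨d, rfl⟩ := Nat.exists_eq_succ_of_ne_zero hd0.ne'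
  rw [liftAlong, Matrix.mul_assoc, Matrix.mul_apply] at hne
  simp only [Nat.succ_eq_add_one, Nat.add_sub_cancel] at hne
  obtain ⟨s₂, -, hne⟩ := Finset.exists_ne_zero_of_sum_ne_zero hne
  have h3 := left_ne_zero_of_mul hne
  rw [Matrix.conjTranspose_apply, star_ne_zero] at h3
  have h12 := right_ne_zero_of_mul hne
  rw [Matrix.mul_apply] at h12
  obtain ⟨s₁, -, h12⟩ := Finset.exists_ne_zero_of_sum_ne_zero h12
  obtain ⟨v3, c3⟩ := carry_charges h3
  obtain ⟨v1, c1⟩ := carry_charges (right_ne_zero_of_mul h12)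
  obtain ⟨-, v2, c2, hG⟩ := lift_ne_zero (left_ne_zero_of_mul h12)
  have hp' : carryPerm p d (P.next^[d] p) = p := carryPerm_apply p d
  have hq' : carryPerm p d (P.next (P.next^[d] p)) = q := by
    rw [← Function.iterate_succ_apply' P.next, carryPerm_apply_of_lt p (by omega) (by omega), hq]
  have e1 : ∀ u, s₁.2.1 u = s.2.1 (carryPerm p d u) := fun u => congrFun c1 u
  have e3 : ∀ u, s₂.2.1 u = s'.2.1 (carryPerm p d u) := fun u => congrFun c3 u
  refine ⟨v3.2 v2, fun u hu hu' => ?_, ?_⟩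
  · obtain ⟨w, rfl⟩ := (carryPerm p d).surjective u
    rw [← e1, ← e3]
    refine c2 w ?_ ?_
    · rintro rfl
      exact hu hp'
    · rintro rfl
      exact hu' hq'
  · simpa only [e1, e3, hp', hq'] using hG

/-- If `N b a c` vanished, the unitarity relation of `R` would equate an empty sum with `1`. -/
lemma N_comm_pos (h : 𝒜.IsModular) {a b c : A} (hN : 0 < 𝒜.N a b c) : 0 < 𝒜.N b a c := by
  have h1 := h.R_unitary_left a b c 0 0 hN hN
  by_contra hc
  have h2 : 𝒜.N b a c = 0 := by omega
  rw [h2] at h1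
  simp at h1

lemma pairKraus_ne_zero {u a b e a' b' : A} {κ κ' : ℕ} {k : KIdx 𝒜}
    (hne : pairKraus 𝒜 u k a b e κ a' b' κ' ≠ 0) : 0 < 𝒜.N a u a' ∧ 0 < 𝒜.N (𝒜.dual u) b b' := by
  unfold pairKraus at hne
  simp only at hne
  split_ifs at hne with hc
  · exact ⟨by have := hc.2.2.1; omega, by have := hc.2.2.2; omega⟩
  · exact absurd rfl hne

lemma ontoFirst_ne_zero {a b e a' b' : A} {κ κ' : ℕ} {k : KIdx 𝒜}
    (hne : ontoFirst 𝒜 k a b e κ a' b' κ' ≠ 0) : a' = e ∧ b' = 𝒜.vac := by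
  unfold ontoFirst at hne
  split_ifs at hne with hc
  · exact ⟨hc.1, hc.2.1⟩
  · exact absurd rfl hne

lemma ontoSecond_ne_zero {a b e a' b' : A} {κ κ' : ℕ} {k : KIdx 𝒜}
    (hne : ontoSecond 𝒜 k a b e κ a' b' κ' ≠ 0) : a' = 𝒜.vac ∧ b' = e := by
  unfold ontoSecond at hne
  split_ifs at hne with hc
  · exact ⟨hc.1, hc.2.1⟩
  · exact absurd rfl hne

/-- The configuration has the charges `a` and `b` at the two slots of `r`, and `B a b`. -/
def AtSite (r : P.Site) (B : A → A → Prop) (s : Config 𝒜 P) : Prop :=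
  s.Valid ∧ B (s.2.1 (r, false)) (s.2.1 (r, true))

variable {ρ : Op 𝒜 P}

lemma fuse_atSite_ne {r r' : P.Site} (hr : r ≠ r') {B : A → A → Prop} (hρ : RowIn ρ (AtSite r B)) :
    RowIn (channel 𝒜 P (ontoFirst 𝒜) (r', false) False 1 ρ) (AtSite r B) := by
  refine rowIn_channel hρ fun k s' s hne hs => ?_
  obtain ⟨h1, h2, -⟩ := liftAlong_charges (by omega) (by have := P.twenty_le_L; omega) hne
    (q := (r', true)) rfl
  refine ⟨h1, ?_⟩
  rw [h2 (r, false) (by simp [hr]) (by simp), h2 (r, true) (by simp) (by simp [hr])]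
  exact hs.2

lemma fuse_atSite {r : P.Site} {B B' : A → A → Prop} (hρ : RowIn ρ (AtSite r B))
    (hB : ∀ a b y, B a b → 0 < 𝒜.N a b y → B' y 𝒜.vac) :
    RowIn (channel 𝒜 P (ontoFirst 𝒜) (r, false) False 1 ρ) (AtSite r B') := by
  refine rowIn_channel hρ fun k s' s hne hs => ?_
  obtain ⟨h1, -, e, κ, κ', hκ, -, hG⟩ := liftAlong_charges (by omega)
    (by have := P.twenty_le_L; omega) hne (q := (r, true)) rfl
  obtain ⟨rfl, h4⟩ := ontoFirst_ne_zero hG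
  refine ⟨h1, ?_⟩
  rw [h4]
  exact hB _ _ _ hs.2 (by omega)

lemma foldl_fuse_atSite {r : P.Site} {B : A → A → Prop} (l : List P.Site) (hr : r ∉ l)
    (hρ : RowIn ρ (AtSite r B)) : RowIn (l.foldl
      (fun ρ r => channel 𝒜 P (ontoFirst 𝒜) (r, false) False 1 ρ) ρ) (AtSite r B) := by
  induction l generalizing ρ with
  | nil => exact hρ
  | cons r' l ih =>
    rw [List.mem_cons, not_or] at hr
    exact ih hr.2 (fuse_atSite_ne hr.1 hρ)

/-- The site occurs exactly once in the list, and the fusions at other sites do not touch it. -/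
lemma fuseAll_atSite {r : P.Site} {B B' : A → A → Prop} (hρ : RowIn ρ (AtSite r B))
    (hB : ∀ a b y, B a b → 0 < 𝒜.N a b y → B' y 𝒜.vac) :
    RowIn (fuseAll 𝒜 P ρ) (AtSite r B') := by
  unfold fuseAll
  have hn := (Finset.univ : Finset P.Site).nodup_toList
  obtain ⟨l₁, l₂, hl⟩ := List.append_of_mem (Finset.mem_toList.2 (Finset.mem_univ r))
  rw [hl] at hn ⊢
  rw [List.foldl_append, List.foldl_cons]
  have h1 : r ∉ l₁ := fun hh => List.disjoint_of_nodup_append hn hh (List.mem_cons_self ..)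
  have h2 : r ∉ l₂ := (List.nodup_cons.1 hn.of_append_right).1
  exact foldl_fuse_atSite _ h2 (fuse_atSite (foldl_fuse_atSite _ h1 hρ) hB)

lemma createPair_atSite {r : P.Site} {e : P.Edge} {c : A} (hr : r ≠ P.tail e) (hr' : r ≠ P.head e)
    {B : A → A → Prop} (hρ : RowIn ρ (AtSite r B)) :
    RowIn (createPair 𝒜 P e c ρ) (AtSite r B) := by
  have hs := P.sep_pos e
  have hs' := P.sep_le e
  refine rowIn_channel hρ fun k s' s hne hs => ?_
  obtain ⟨h1, h2, -⟩ := liftAlong_charges (by omega) (by omega) hne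
    (P.next_iterate_first e (c := false) (c' := false) (by simp))
  have h3 : r ≠ P.first e ∧ r ≠ P.last e := by
    unfold Params.first Params.last
    split_ifs
    · exact ⟨hr', hr⟩
    · exact ⟨hr, hr'⟩
  refine ⟨h1, ?_⟩
  rw [h2 (r, false) (by simp [h3.1]) (by simp [h3.2]), h2 (r, true) (by simp) (by simp)]
  exact hs.2

/-- The unit vectors. -/
def units : Set (ℤ × ℤ) := {(1, 0), (-1, 0), (0, 1), (0, -1)}

lemma edgeAt_tail_head {r : P.Site} {v : ℤ × ℤ} (hv : v ∈ units) :
    P.tail (P.edgeAt r v) = r ∧ P.head (P.edgeAt r v) = P.shift r 1 v ∨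
      P.tail (P.edgeAt r v) = P.shift r 1 v ∧ P.head (P.edgeAt r v) = r := by
  rcases hv with rfl | rfl | rfl | rfl <;>
    simp [Params.edgeAt, Params.tail, Params.head, Params.shift]

lemma edgeAt_ends {r : P.Site} {v : ℤ × ℤ} (hv : v ∈ units) :
    P.first (P.edgeAt r v) = r ∧ P.last (P.edgeAt r v) = P.shift r 1 v ∨
      P.first (P.edgeAt r v) = P.shift r 1 v ∧ P.last (P.edgeAt r v) = r := by
  have h1 := edgeAt_tail_head (r := r) hv
  unfold Params.first Params.last
  split_ifs <;> tauto

lemma shift_ne {r : P.Site} {v : ℤ × ℤ} (hv : v ∈ units) : P.shift r 1 v ≠ r := by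
  have hL := P.twenty_le_L
  have : Fact (1 < P.L) := ⟨by omega⟩
  intro hh
  rcases hv with rfl | rfl | rfl | rfl <;> simp [Params.shift, Prod.ext_iff] at hh

/-- The change of the charges of a configuration when the charge `q` is displaced from `r` to
`r'`. -/
lemma displace_rowIn (h : 𝒜.IsModular) {r : P.Site} {v : ℤ × ℤ} (hv : v ∈ units) {q : A}
    {T T' : Config 𝒜 P → Prop} (hρ : RowIn ρ T)
    (hT' : ∀ s s' : Config 𝒜 P, T s → s'.Valid →
      (∀ u, u ≠ (r, false) → u ≠ (P.shift r 1 v, true) → s'.2.1 u = s.2.1 u) →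
      (s.2.1 (r, false) = q → s'.2.1 (r, false) = 𝒜.vac) →
      0 < 𝒜.N (s.2.1 (P.shift r 1 v, true)) q (s'.2.1 (P.shift r 1 v, true)) → T' s') :
    RowIn (displace 𝒜 P r v q ρ) T' := by
  have hs := P.sep_pos (P.edgeAt r v)
  have hs' := P.sep_le (P.edgeAt r v)
  have hne' := shift_ne (r := r) hv
  have hends := edgeAt_ends (r := r) hv
  unfold displace
  generalize P.edgeAt r v = e at hs hs' hends ⊢
  rcases hends with ⟨hf, hl⟩ | ⟨hf, hl⟩
  · rw [if_pos hf]
    refine rowIn_channel hρ fun k s' s hne hs0 => ?_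
    rw [← hf] at hne
    obtain ⟨h1, h2, e, κ, κ', hκ, hκ', hG⟩ := liftAlong_charges (by omega) (by omega) hne
      (P.next_iterate_first _ (c := false) (c' := true) (by simp))
    rw [hf, hl] at h2 hκ hκ' hG
    refine hT' s s' hs0 h1 h2 ?_ ?_
    all_goals
      unfold moveKraus at hG
      rw [if_pos trivial] at hG
      split_ifs at hG with hq
    · exact fun _ => (ontoSecond_ne_zero hG).1
    · exact fun hh => absurd hh hq
    · rw [(ontoSecond_ne_zero hG).2, ← hq]
      exact N_comm_pos h (by omega)
    · have := (pairKraus_ne_zero hG).2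
      rw [h.dual_dual] at this
      exact N_comm_pos h this
  · rw [if_neg (by rw [hf]; exact hne')]
    refine rowIn_channel hρ fun k s' s hne hs0 => ?_
    obtain ⟨h1, h2, e, κ, κ', hκ, hκ', hG⟩ := liftAlong_charges (by omega) (by omega) hne
      (P.next_iterate_first _ (c := true) (c' := false) (by simp; omega))
    rw [hf, hl] at h2 hκ hκ' hG
    refine hT' s s' hs0 h1 (fun u hu hu' => h2 u hu' hu) ?_ ?_
    all_goals
      unfold moveKraus at hG
      rw [if_neg not_false] at hG
      split_ifs at hG with hq
    · exact fun _ => (ontoFirst_ne_zero hG).2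
    · exact fun hh => absurd hh hq
    · rw [(ontoFirst_ne_zero hG).1, ← hq]
      omega
    · exact (pairKraus_ne_zero hG).1

lemma displace_atSite_ne (h : 𝒜.IsModular) {r r' : P.Site} {v : ℤ × ℤ} (hv : v ∈ units) {q : A}
    (hr : r ≠ r') (hr' : r ≠ P.shift r' 1 v) {B : A → A → Prop} (hρ : RowIn ρ (AtSite r B)) :
    RowIn (displace 𝒜 P r' v q ρ) (AtSite r B) := by
  refine displace_rowIn h hv hρ fun s s' hs hs' hu _ _ => ⟨hs', ?_⟩
  rw [hu (r, false) (by simp [hr]) (by simp), hu (r, true) (by simp) (by simp [hr'])]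
  exact hs.2

lemma displace_atSite_source (h : 𝒜.IsModular) {r : P.Site} {v : ℤ × ℤ} (hv : v ∈ units) {q : A}
    {B B' : A → A → Prop} (hB : ∀ a a' b, B a b → (a = q → a' = 𝒜.vac) → B' a' b)
    (hρ : RowIn ρ (AtSite r B)) : RowIn (displace 𝒜 P r v q ρ) (AtSite r B') := by
  refine displace_rowIn h hv hρ fun s s' hs hs' hu hq _ => ⟨hs', ?_⟩
  rw [hu (r, true) (by simp) (by simp [(shift_ne (r := r) hv).symm])]
  exact hB _ _ _ hs.2 hq

lemma displace_atSite_target (h : 𝒜.IsModular) {r r' : P.Site} {v : ℤ × ℤ} (hv : v ∈ units) {q : A}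
    (hr : P.shift r' 1 v = r) {B B' : A → A → Prop}
    (hB : ∀ a b b', B a b → 0 < 𝒜.N b q b' → B' a b')
    (hρ : RowIn ρ (AtSite r B)) : RowIn (displace 𝒜 P r' v q ρ) (AtSite r B') := by
  have hr' := shift_ne (r := r') hv
  subst hr
  refine displace_rowIn h hv hρ fun s s' hs hs' hu _ hN => ⟨hs', ?_⟩
  rw [hu (_, false) (by simp [hr']) (by simp)]
  exact hB _ _ _ hs.2 hN

end Charges

end AnyonDecoder

/-! ### The charge at one site during a time step -/

namespace AnyonDecoder

open scoped Matrix ComplexConjugate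

section Steps

open scoped Classical

variable {A : Type*} [Fintype A] {𝒜 : AnyonData A} {P : Params}

lemma cascade_eq_some {s : ℤ × ℤ → Prop} {l : List ((ℤ × ℤ) × Option (ℤ × ℤ))}
    {d : Option (ℤ × ℤ)} {v : ℤ × ℤ} (h : cascade s l d = some v) :
    (∃ x ∈ l, x.2 = some v) ∨ d = some v := by
  induction l with
  | nil => exact Or.inr h
  | cons x l ih =>
    obtain ⟨u, o⟩ := x
    rw [cascade] at h
    split_ifs at h
    · exact Or.inl ⟨(u, o), List.mem_cons_self .., h⟩
    · rcases ih h with ⟨x, hx, hv⟩ | hd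
      · exact Or.inl ⟨x, List.mem_cons_of_mem _ hx, hv⟩
      · exact Or.inr hd

lemma rule_mem_units {Q X Y : ℕ} {s : ℤ × ℤ → Prop} {v : ℤ × ℤ} (h : rule Q X Y s = some v) :
    v ∈ units := by
  unfold rule at h
  simp only at h
  have h' := cascade_eq_some h
  clear h
  unfold units
  simp only [List.mem_append, Set.mem_insert_iff, Set.mem_singleton_iff] at h' ⊢
  rcases h' with ⟨x, (hx | hx) | hx, hv⟩ | h'
  · split_ifs at hx
    · simp only [List.mem_cons, List.not_mem_nil, or_false] at hx
      rcases hx with rfl | rfl | rfl <;> simp at hv <;> simp [← hv]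
    · simp at hx
  · split_ifs at hx
    · simp only [List.mem_cons, List.not_mem_nil, or_false] at hx
      rcases hx with rfl | rfl | rfl <;> simp at hv <;> simp [← hv]
    · simp at hx
  · split_ifs at hx
    all_goals
      simp only [List.mem_cons, List.not_mem_nil, or_false] at hx
    all_goals
      rcases hx with rfl | rfl | rfl | rfl | rfl | rfl | rfl <;> simp at hv <;> simp [← hv]
  · split_ifs at h' <;> simp at h' <;> simp [← h']

variable {ℰ : Set (Err A P)} {h : History A P} {𝒱 : Env A P}

lemma appliedRule_mem_units {k t : ℕ} {r : P.Site} {v : ℤ × ℤ}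
    (hv : appliedRule 𝒜 ℰ h k t r = some v) : v ∈ units := by
  unfold appliedRule at hv
  split_ifs at hv
  exact rule_mem_units hv

lemma shift_shift (r : P.Site) (i : ℕ) (v : ℤ × ℤ) :
    P.shift (P.shift r i v) 1 v = P.shift r (i + 1) v := by
  ext <;> simp [Params.shift] <;> ring

lemma shift_zero (r : P.Site) (v : ℤ × ℤ) : P.shift r 0 v = r := by
  simp [Params.shift]

section Modular

variable (hm : 𝒜.IsModular)
include hm

/-- No elementary displacement of a level-`k` rule in time step `t` touches `r`. -/
lemma sweep_atSite {ρ : Op 𝒜 P} {k t i : ℕ} {r : P.Site}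
    (hr : ∀ r' v, appliedRule 𝒜 ℰ h k t r' = some v → r ≠ P.shift r' i v ∧ r ≠ P.shift r' (i + 1) v)
    {B : A → A → Prop} (hρ : RowIn ρ (AtSite r B)) :
    RowIn (sweep 𝒜 ℰ h k t i ρ) (AtSite r B) := by
  unfold sweep
  generalize (Finset.univ : Finset P.Site).toList = l
  induction l generalizing ρ with
  | nil => exact hρ
  | cons r' l ih =>
    refine ih ?_
    beta_reduce
    cases hv : appliedRule 𝒜 ℰ h k t r' with
    | none => rwa [siteStep_of_none hv]
    | some v =>
      rw [siteStep_of_some hv]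
      have := hr r' v hv
      exact displace_atSite_ne hm (appliedRule_mem_units hv) this.1 (by rw [shift_shift]; exact this.2)
        hρ

lemma fuseAll_atSite_vac {ρ : Op 𝒜 P} {r : P.Site} {C : A → Prop}
    (hρ : RowIn ρ (AtSite r fun a b => C a ∧ b = 𝒜.vac)) :
    RowIn (fuseAll 𝒜 P ρ) (AtSite r fun a b => C a ∧ b = 𝒜.vac) := by
  refine fuseAll_atSite hρ ?_
  rintro a b y ⟨ha, rfl⟩ hN
  rw [← (eq_of_N_vac_right hm hN).1]
  exact ⟨ha, rfl⟩

lemma levelStep_atSite {ρ : Op 𝒜 P} {k t : ℕ} {r : P.Site}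
    (hr : ∀ r' v i, appliedRule 𝒜 ℰ h k t r' = some v → i ≤ P.Q ^ k → r ≠ P.shift r' i v)
    {C : A → Prop} (hρ : RowIn ρ (AtSite r fun a b => C a ∧ b = 𝒜.vac)) :
    RowIn (levelStep 𝒜 ℰ h k t ρ) (AtSite r fun a b => C a ∧ b = 𝒜.vac) := by
  rw [levelStep_eq]
  have : ∀ l : List ℕ, (∀ i ∈ l, i < P.Q ^ k) → RowIn (l.foldl
      (fun ρ i => fuseAll 𝒜 P (sweep 𝒜 ℰ h k t i ρ)) ρ) (AtSite r fun a b => C a ∧ b = 𝒜.vac) := by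
    intro l hl
    induction l generalizing ρ with
    | nil => exact hρ
    | cons i l ih =>
      refine ih ?_ fun j hj => hl j (List.mem_cons_of_mem _ hj)
      refine fuseAll_atSite_vac hm (sweep_atSite hm (fun r' v hv => ?_) hρ)
      have := hl i (List.mem_cons_self ..)
      exact ⟨hr r' v i hv (by omega), hr r' v (i + 1) hv (by omega)⟩
  exact this _ fun i hi => List.mem_range.1 hi

/-- The level-`0` rule at `r'` displaces a charge to `r`. -/
def MovesTo (𝒜 : AnyonData A) (ℰ : Set (Err A P)) (h : History A P) (t : ℕ) (r r' : P.Site) : Prop :=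
  ∃ v, appliedRule 𝒜 ℰ h 0 t r' = some v ∧ P.shift r' 1 v = r

/-- The charge `a` can remain at `r` from the charge `a₀`; `moved` says whether the level-`0` rule at
`r` has already been carried out. -/
def Remains (𝒜 : AnyonData A) (ℰ : Set (Err A P)) (h : History A P) (t : ℕ) (r : P.Site) (a₀ : A)
    (moved : Prop) (a : A) : Prop :=
  ((∃ v, appliedRule 𝒜 ℰ h 0 t r = some v) → moved → ruleCharge 𝒜 ℰ h 0 t r = a₀ → a = 𝒜.vac) ∧
    (¬ ((∃ v, appliedRule 𝒜 ℰ h 0 t r = some v) ∧ moved) → a = a₀)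

/-- Arriving charges wait in the second slot, so the resident anyon that leaves is unaffected by
them; this makes the displacements simultaneous. `FusesTo` has the latest arrival at the head of the
list, hence the reversal. -/
lemma sweep_zero_foldl {ρ : Op 𝒜 P} {t : ℕ} {r : P.Site} {a₀ : A}
    (hρ : RowIn ρ (AtSite r fun a b => a = a₀ ∧ b = 𝒜.vac)) (l : List P.Site) (hl : l.Nodup) :
    RowIn (l.foldl (fun ρ r => siteStep 𝒜 ℰ h 0 t 0 r ρ) ρ) (AtSite r fun a b =>
      Remains 𝒜 ℰ h t r a₀ (r ∈ l) a ∧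
        FusesTo 𝒜 ((l.reverse.filter (MovesTo 𝒜 ℰ h t r)).map (ruleCharge 𝒜 ℰ h 0 t)) b) := by
  induction l using List.reverseRecOn with
  | nil =>
    refine hρ.mono fun s hs => ⟨hs.1, ⟨fun _ hh => by simp at hh, fun _ => hs.2.1⟩, ?_⟩
    rw [hs.2.2]
    exact FusesTo.nil
  | append_singleton l r' ih =>
    have hn := List.nodup_append.1 hl
    have ih := ih hn.1
    have hr' : r' ∉ l := fun hh => hn.2.2 r' hh r' (by simp) rfl
    rw [List.foldl_append, List.foldl_cons, List.foldl_nil, List.reverse_append,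
      List.reverse_singleton, List.singleton_append]
    cases hv : appliedRule 𝒜 ℰ h 0 t r' with
    | none =>
      rw [siteStep_of_none hv]
      refine ih.mono fun s hs => ⟨hs.1, ⟨fun he hmem => ?_, fun hne => ?_⟩, ?_⟩
      · refine hs.2.1.1 he ?_
        rcases List.mem_append.1 hmem with hh | hh
        · exact hh
        · rw [List.mem_singleton] at hh
          subst hh
          obtain ⟨v, hv'⟩ := he
          rw [hv] at hv'
          exact absurd hv' (by simp)
      · exact hs.2.1.2 fun hh => hne ⟨hh.1, List.mem_append_left _ hh.2⟩
      · rw [List.filter_cons_of_neg]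
        · exact hs.2.2
        · simp [MovesTo, hv]
    | some v =>
      rw [siteStep_of_some hv, shift_zero]
      have hu := appliedRule_mem_units hv
      by_cases hrr : r = r'
      · subst hrr
        refine displace_atSite_source hm hu (fun a a' b hab haq => ?_) ih
        refine ⟨⟨fun he _ hq => haq ?_, fun hne => absurd ⟨⟨v, hv⟩, by simp⟩ hne⟩, ?_⟩
        · rw [hq]
          exact hab.1.2 fun hh => hr' hh.2
        · rw [List.filter_cons_of_neg]
          · exact hab.2
          · simp [MovesTo, hv, shift_ne hu]
      · have hmem : r ∈ l ++ [r'] ↔ r ∈ l := by simp [hrr]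
        rw [hmem]
        by_cases ht : P.shift r' 1 v = r
        · refine displace_atSite_target hm hu ht (fun a b b' hab hN => ⟨hab.1, ?_⟩) ih
          rw [List.filter_cons_of_pos (by simpa using ⟨v, hv, ht⟩), List.map_cons]
          exact FusesTo.cons _ b _ _ hab.2 hN
        · have := displace_atSite_ne hm hu (q := ruleCharge 𝒜 ℰ h 0 t r') hrr (Ne.symm ht) ih
          rwa [List.filter_cons_of_neg (by simpa [MovesTo, hv] using ht)]

/-- The charge at `r` after the level-`0` rules have been applied. -/
def Outcome (𝒜 : AnyonData A) (ℰ : Set (Err A P)) (h : History A P) (t : ℕ) (r : P.Site) (a₀ y : A) :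
    Prop :=
  ∃ a x, ∃ l : List P.Site, l.Nodup ∧ (∀ r', r' ∈ l ↔ MovesTo 𝒜 ℰ h t r r') ∧
    FusesTo 𝒜 (l.map (ruleCharge 𝒜 ℰ h 0 t)) x ∧ Remains 𝒜 ℰ h t r a₀ True a ∧ 0 < 𝒜.N a x y

lemma levelStep_zero_atSite {ρ : Op 𝒜 P} {t : ℕ} {r : P.Site} {a₀ : A}
    (hρ : RowIn ρ (AtSite r fun a b => a = a₀ ∧ b = 𝒜.vac)) :
    RowIn (levelStep 𝒜 ℰ h 0 t ρ) (AtSite r fun y b => Outcome 𝒜 ℰ h t r a₀ y ∧ b = 𝒜.vac) := by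
  rw [levelStep_eq, pow_zero, List.range_one, List.foldl_cons, List.foldl_nil]
  refine fuseAll_atSite (sweep_zero_foldl hm hρ _ (Finset.univ : Finset P.Site).nodup_toList) ?_
  rintro a b y ⟨ha, hb⟩ hN
  refine ⟨⟨a, b, _, ?_, ?_, hb, ?_, hN⟩, rfl⟩
  · exact (List.nodup_reverse.2 (Finset.nodup_toList _)).filter _
  · intro r'
    simp
  · simpa using ha

/-- Level `0` acts first; the paths of higher rules avoid `r`, so these keep the result. -/
lemma ruleStep_atSite {ρ : Op 𝒜 P} {t : ℕ} {r : P.Site} {a₀ : A}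
    (hr : ∀ k r' v i, 0 < k → appliedRule 𝒜 ℰ h k t r' = some v → i ≤ P.Q ^ k → r ≠ P.shift r' i v)
    (hρ : RowIn ρ (AtSite r fun a b => a = a₀ ∧ b = 𝒜.vac)) :
    RowIn (ruleStep 𝒜 ℰ h t ρ) (AtSite r fun y b => Outcome 𝒜 ℰ h t r a₀ y ∧ b = 𝒜.vac) := by
  unfold ruleStep
  obtain ⟨n, hn⟩ := Nat.exists_eq_succ_of_ne_zero P.n_pos.ne'
  rw [hn, List.range_succ_eq_map, List.foldl_cons]
  have h0 := levelStep_zero_atSite (ℰ := ℰ) (h := h) hm (t := t) hρ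
  have : ∀ l : List ℕ, ∀ ρ' : Op 𝒜 P, (∀ k ∈ l, 0 < k) →
      RowIn ρ' (AtSite r fun y b => Outcome 𝒜 ℰ h t r a₀ y ∧ b = 𝒜.vac) →
      RowIn (l.foldl (fun ρ k => levelStep 𝒜 ℰ h k t ρ) ρ')
        (AtSite r fun y b => Outcome 𝒜 ℰ h t r a₀ y ∧ b = 𝒜.vac) := by
    intro l
    induction l with
    | nil => exact fun _ _ hh => hh
    | cons k l ih =>
      intro ρ' hl hρ'
      refine ih _ (fun j hj => hl j (List.mem_cons_of_mem _ hj)) ?_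
      exact levelStep_atSite hm (fun r' v i => hr k r' v i (hl k (List.mem_cons_self ..))) hρ'
  refine this _ _ ?_ h0
  intro k hk
  obtain ⟨j, -, rfl⟩ := List.mem_map.1 hk
  exact Nat.succ_pos j

omit hm in
lemma noiseStep_atSite {ρ : Op 𝒜 P} {t : ℕ} {r : P.Site} {B : A → A → Prop} (order : List P.Edge)
    (hr : ∀ e c, Err.charge e t c ∈ ℰ → r ∉ (Err.charge e t c).sites)
    (hρ : RowIn ρ (AtSite r B)) : RowIn (noiseStep 𝒜 ℰ order t ρ) (AtSite r B) := by
  unfold noiseStep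
  induction order generalizing ρ with
  | nil => exact hρ
  | cons e l ih =>
    refine ih ?_
    beta_reduce
    split_ifs with hc
    · have := hr e _ hc.choose_spec
      simp only [Err.sites, Set.mem_insert_iff, Set.mem_singleton_iff, not_or] at this
      exact createPair_atSite this.1 this.2 hρ
    · exact hρ

end Modular

end Steps

end AnyonDecoder

/-! ### Consequences for possible histories, and invariance of the neutral subspace -/

namespace AnyonDecoder

open scoped Matrix ComplexConjugate

section Evolution

open scoped Classical

variable {A : Type*} [Fintype A] {𝒜 : AnyonData A} {P : Params}

variable {ℰ : Set (Err A P)} {h : History A P} {𝒱 : Env A P}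

lemma foldl_induction {α β : Type*} {f : α → β → α} {C : α → Prop} (l : List β) {a : α} (ha : C a)
    (hf : ∀ a, ∀ b ∈ l, C a → C (f a b)) : C (l.foldl f a) := by
  induction l generalizing a with
  | nil => exact ha
  | cons b l ih =>
    exact ih (hf a b (List.mem_cons_self ..) ha)
      fun a b hb => hf a b (List.mem_cons_of_mem _ hb)

lemma rowIn_channel_valid {K : KIdx 𝒜 → PairOp A} {p : P.Slot} {wrap : Prop} {d : ℕ} (hd0 : 0 < d)
    (hd : d ≤ 2 * P.L + 1) (ρ : Op 𝒜 P) : RowIn (channel 𝒜 P K p wrap d ρ) Config.Valid :=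
  rowIn_channel (T := fun _ => True) (fun _ _ _ => trivial)
    fun _ _ _ hne _ => (liftAlong_charges hd0 hd hne rfl).1

lemma rowIn_displace_valid (r : P.Site) (v : ℤ × ℤ) (q : A) (ρ : Op 𝒜 P) :
    RowIn (displace 𝒜 P r v q ρ) Config.Valid := by
  have hs := P.sep_pos (P.edgeAt r v)
  have hs' := P.sep_le (P.edgeAt r v)
  unfold displace
  split_ifs <;> exact rowIn_channel_valid (by omega) (by omega) _

lemma rowIn_noiseStep_valid {ρ : Op 𝒜 P} (hρ : RowIn ρ Config.Valid) (order : List P.Edge) (t : ℕ) :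
    RowIn (noiseStep 𝒜 ℰ order t ρ) Config.Valid := by
  refine foldl_induction (C := fun ρ : Op 𝒜 P => RowIn ρ Config.Valid) _ hρ fun ρ e _ hρ => ?_
  have hs := P.sep_pos e
  have hs' := P.sep_le e
  split_ifs
  · exact rowIn_channel_valid (by omega) (by omega) _
  · exact hρ

lemma rowIn_ruleStep_valid {ρ : Op 𝒜 P} (hρ : RowIn ρ Config.Valid) (t : ℕ) :
    RowIn (ruleStep 𝒜 ℰ h t ρ) Config.Valid := by
  have hL := P.twenty_le_L
  refine foldl_induction (C := fun ρ : Op 𝒜 P => RowIn ρ Config.Valid) _ hρ fun ρ k _ hρ => ?_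
  rw [levelStep_eq]
  refine foldl_induction (C := fun ρ : Op 𝒜 P => RowIn ρ Config.Valid) _ hρ fun ρ i _ hρ => ?_
  refine foldl_induction (C := fun ρ : Op 𝒜 P => RowIn ρ Config.Valid) _ ?_ fun ρ r _ hρ => rowIn_channel_valid (by omega) (by omega) _
  refine foldl_induction (C := fun ρ : Op 𝒜 P => RowIn ρ Config.Valid) _ hρ fun ρ r _ hρ => ?_
  cases hv : appliedRule 𝒜 ℰ h k t r with
  | none => rwa [siteStep_of_none hv]
  | some v => rw [siteStep_of_some hv]; exact rowIn_displace_valid _ _ _ _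

lemma groundState_ne_zero {ψ : A → ℂ} {s : Config 𝒜 P} (hs : groundState 𝒜 P ψ s ≠ 0) :
    ∃ x, ∀ p, s.1 p = x ∧ s.2.1 p = 𝒜.vac ∧ (s.2.2 p : ℕ) = 0 := by
  obtain ⟨x, -, hx⟩ := Finset.exists_ne_zero_of_sum_ne_zero hs
  refine ⟨x, ?_⟩
  by_contra hc
  exact hx (if_neg hc)

section Modular

variable (hm : 𝒜.IsModular)
include hm

lemma rowIn_evolve_valid (j : ℕ) : RowIn (evolve 𝒜 𝒱 ℰ h j) Config.Valid := by
  have key : ∀ {ρ : Op 𝒜 P} (c : P.Site → A), RowIn ρ Config.Valid →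
      RowIn (collapse 𝒜 P c * ρ * collapse 𝒜 P c) Config.Valid := by
    intro ρ c hρ
    refine RowIn.mul_right (rowIn_mul hρ fun s' s hne hs => ?_)
    rw [(collapse_apply_ne_zero hne).1]
    exact hs
  induction j with
  | zero =>
    refine key _ fun s s' hne => ?_
    obtain ⟨x, hx⟩ := groundState_ne_zero (left_ne_zero_of_mul hne)
    intro p
    rw [(hx p).1, (hx p).2.1, (hx p).2.2, (hx (P.next p)).1, N_vac_right_self hm]
    exact Nat.one_pos
  | succ j ih =>
    rw [evolve_succ]
    refine key _ ?_
    unfold preState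
    split_ifs
    · exact rowIn_noiseStep_valid ih _ _
    · exact rowIn_ruleStep_valid ih _

lemma rowIn_evolve_atSite (j : ℕ) (r : P.Site) : RowIn (evolve 𝒜 𝒱 ℰ h j)
    (AtSite r fun a b => a = h j r ∧ b = 𝒜.vac) := fun s s' hne =>
  ⟨rowIn_evolve_valid hm j s s' hne, rowIn_evolve_charges j s s' hne r⟩

lemma charge_of_noise {t : ℕ} {r : P.Site} (ht : evolve 𝒜 𝒱 ℰ h (2 * t + 1) ≠ 0)
    (hr : ∀ e c, Err.charge e t c ∈ ℰ → r ∉ (Err.charge e t c).sites) :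
    h (2 * t + 1) r = h (2 * t) r := by
  have h1 := noiseStep_atSite (𝒱.order t) hr
    (rowIn_evolve_atSite (ℰ := ℰ) (h := h) (𝒱 := 𝒱) hm (2 * t) r)
  rw [← preState_even] at h1
  obtain ⟨s, hs, hc⟩ := exists_of_evolve_succ_ne_zero ht h1
  exact (hc r).1.symm.trans hs.2.1

lemma outcome_of_rules {t : ℕ} {r : P.Site} (ht : evolve 𝒜 𝒱 ℰ h (2 * (t + 1)) ≠ 0)
    (hr : ∀ k r' v i, 0 < k → appliedRule 𝒜 ℰ h k t r' = some v → i ≤ P.Q ^ k →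
      r ≠ P.shift r' i v) :
    Outcome 𝒜 ℰ h t r (h (2 * t + 1) r) (h (2 * (t + 1)) r) := by
  have h1 := ruleStep_atSite hm hr
    (rowIn_evolve_atSite (ℰ := ℰ) (h := h) (𝒱 := 𝒱) hm (2 * t + 1) r)
  rw [← preState_odd] at h1
  obtain ⟨s, hs, hc⟩ := exists_of_evolve_succ_ne_zero (j := 2 * t + 1) ht h1
  have h2 := hs.2.1
  rwa [(hc r).1] at h2

/-- A nontrivial charge after the application of the rules has been moved to its site, or has not
been moved, or has been moved on the basis of a wrong report. -/
lemma Outcome.ne_vac {t : ℕ} {r : P.Site} {a₀ y : A} (ho : Outcome 𝒜 ℰ h t r a₀ y)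
    (hy : y ≠ 𝒜.vac) : (∃ r', MovesTo 𝒜 ℰ h t r r') ∨
      (a₀ ≠ 𝒜.vac ∧ appliedRule 𝒜 ℰ h 0 t r = none) ∨
      (∃ v, appliedRule 𝒜 ℰ h 0 t r = some v) ∧ ruleCharge 𝒜 ℰ h 0 t r ≠ a₀ := by
  obtain ⟨a, x, l, -, hl, hx, ha, hN⟩ := ho
  by_contra hc
  push Not at hc
  obtain ⟨h1, h2, h3⟩ := hc
  have hl' : l = [] := by
    rw [List.eq_nil_iff_forall_not_mem]
    exact fun r' hr' => h1 r' ((hl r').1 hr')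
  subst hl'
  have hx' : x = 𝒜.vac := by cases hx; rfl
  subst hx'
  have hay := (eq_of_N_vac_right hm hN).1
  subst hay
  cases hv : appliedRule 𝒜 ℰ h 0 t r with
  | none =>
    have := ha.2 (by simp [hv])
    rw [this] at hy
    exact h2 hy hv
  | some v => exact hy (ha.1 ⟨v, hv⟩ trivial (h3 ⟨v, hv⟩))

/-- If the rule at `r` has moved the true charge, only moved charges remain at `r`. -/
lemma Outcome.success {t : ℕ} {r : P.Site} {a₀ y : A} (ho : Outcome 𝒜 ℰ h t r a₀ y)
    (hv : ∃ v, appliedRule 𝒜 ℰ h 0 t r = some v) (hq : ruleCharge 𝒜 ℰ h 0 t r = a₀) :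
    ∃ l : List P.Site, l.Nodup ∧ (∀ r', r' ∈ l ↔ MovesTo 𝒜 ℰ h t r r') ∧
      FusesTo 𝒜 (l.map (ruleCharge 𝒜 ℰ h 0 t)) y := by
  obtain ⟨a, x, l, hn, hl, hx, ha, hN⟩ := ho
  refine ⟨l, hn, hl, ?_⟩
  rw [ha.1 hv trivial hq] at hN
  rwa [← (eq_of_N_vac_left hm hN).1]

section Ranges

variable {x : ZMod P.L} {S : Finset P.Slot}

lemma createPair_rangeIn {ρ : Op 𝒜 P} {e : P.Edge} {c : A} (he : P.Compatible x S e)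
    (hρ : RangeIn ρ (neutralSpace 𝒜 P (P.slotAt x 0) S)) :
    RangeIn (createPair 𝒜 P e c ρ) (neutralSpace 𝒜 P (P.slotAt x 0) S) := by
  have hs := P.sep_pos e
  exact rangeIn_channel hρ fun G w hw =>
    (transport_edge hm he G (c := false) (c' := false) (by omega) (by simp)).mulVec_mem hw

lemma displace_rangeIn {ρ : Op 𝒜 P} {r : P.Site} {v : ℤ × ℤ} {q : A}
    (he : P.Compatible x S (P.edgeAt r v))
    (hρ : RangeIn ρ (neutralSpace 𝒜 P (P.slotAt x 0) S)) :
    RangeIn (displace 𝒜 P r v q ρ) (neutralSpace 𝒜 P (P.slotAt x 0) S) := by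
  have hs := P.sep_pos (P.edgeAt r v)
  unfold displace
  split_ifs with hf
  · refine rangeIn_channel hρ fun G w hw => ?_
    have := transport_edge hm he G (c := false) (c' := true) (d := 2 * P.sep (P.edgeAt r v) + 1)
      (by omega) (by simp)
    rw [hf] at this
    exact this.mulVec_mem hw
  · exact rangeIn_channel hρ fun G w hw =>
      (transport_edge hm he G (c := true) (c' := false) (by omega) (by simp; omega)).mulVec_mem hw

lemma fuseAll_rangeIn {ρ : Op 𝒜 P} (hS : S = ∅ ∨ S = P.rowZero)
    (hρ : RangeIn ρ (neutralSpace 𝒜 P (P.slotAt x 0) S)) :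
    RangeIn (fuseAll 𝒜 P ρ) (neutralSpace 𝒜 P (P.slotAt x 0) S) :=
  foldl_induction
    (C := fun ρ : Op 𝒜 P => RangeIn ρ (neutralSpace 𝒜 P (P.slotAt x 0) S)) _ hρ fun _ r _ hρ => rangeIn_channel hρ fun G _ hw =>
    (transport_fuse hm x hS G r).mulVec_mem hw

lemma noiseStep_rangeIn {ρ : Op 𝒜 P} {t : ℕ} (order : List P.Edge)
    (he : ∀ e c, Err.charge e t c ∈ ℰ → P.Compatible x S e)
    (hρ : RangeIn ρ (neutralSpace 𝒜 P (P.slotAt x 0) S)) :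
    RangeIn (noiseStep 𝒜 ℰ order t ρ) (neutralSpace 𝒜 P (P.slotAt x 0) S) := by
  refine foldl_induction
    (C := fun ρ : Op 𝒜 P => RangeIn ρ (neutralSpace 𝒜 P (P.slotAt x 0) S)) _ hρ fun ρ e _ hρ => ?_
  split_ifs with hc
  · exact createPair_rangeIn hm (he e _ hc.choose_spec) hρ
  · exact hρ

lemma ruleStep_rangeIn {ρ : Op 𝒜 P} {t : ℕ} (hS : S = ∅ ∨ S = P.rowZero)
    (h0 : ∀ r v, appliedRule 𝒜 ℰ h 0 t r = some v → P.Compatible x S (P.edgeAt r v))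
    (hk : ∀ k r, 0 < k → appliedRule 𝒜 ℰ h k t r = none)
    (hρ : RangeIn ρ (neutralSpace 𝒜 P (P.slotAt x 0) S)) :
    RangeIn (ruleStep 𝒜 ℰ h t ρ) (neutralSpace 𝒜 P (P.slotAt x 0) S) := by
  refine foldl_induction
    (C := fun ρ : Op 𝒜 P => RangeIn ρ (neutralSpace 𝒜 P (P.slotAt x 0) S)) _ hρ fun ρ k _ hρ => ?_
  rw [levelStep_eq]
  refine foldl_induction
    (C := fun ρ : Op 𝒜 P => RangeIn ρ (neutralSpace 𝒜 P (P.slotAt x 0) S)) _ hρ fun ρ i hi hρ => fuseAll_rangeIn hm hS ?_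
  refine foldl_induction
    (C := fun ρ : Op 𝒜 P => RangeIn ρ (neutralSpace 𝒜 P (P.slotAt x 0) S)) _ hρ fun ρ r _ hρ => ?_
  cases hv : appliedRule 𝒜 ℰ h k t r with
  | none => rwa [siteStep_of_none hv]
  | some v =>
    rw [siteStep_of_some hv]
    rcases Nat.eq_zero_or_pos k with rfl | hk0
    · have : i = 0 := by simpa using hi
      subst this
      rw [shift_zero]
      exact displace_rangeIn hm (h0 r v hv) hρ
    · rw [hk k r hk0] at hv
      exact absurd hv (by simp)

omit hm in
lemma rangeIn_evolve_succ {j : ℕ}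
    (hj : RangeIn (preState 𝒱 ℰ h j) (neutralSpace 𝒜 P (P.slotAt x 0) S)) :
    RangeIn (evolve 𝒜 𝒱 ℰ h (j + 1)) (neutralSpace 𝒜 P (P.slotAt x 0) S) := by
  rw [evolve_succ]
  exact rangeIn_collapse_mul hj fun w hw => (transport_collapse _ S _).mulVec_mem hw

end Ranges

end Modular

end Evolution

end AnyonDecoder

/-! ### Faithfulness and successfulness at level `0` -/

namespace AnyonDecoder

open scoped Matrix ComplexConjugate

section ZeroSuccess

open scoped Classical

variable {A : Type*} [Fintype A] {𝒜 : AnyonData A} {P : Params}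

variable {ℰ : Set (Err A P)} {h : History A P}

lemma ruleCharge_zero (t : ℕ) (r : P.Site) : ruleCharge 𝒜 ℰ h 0 t r = syndrome ℰ h r t := by
  unfold ruleCharge
  rw [pow_zero, Nat.div_one, Nat.add_sub_cancel]
  rfl

lemma sameColony_zero {r s : P.Site} : P.SameColony 0 r s ↔ s = r := by
  unfold Params.SameColony
  simp only [pow_zero, Nat.div_one]
  constructor
  · intro hh
    exact Prod.ext (ZMod.val_injective _ hh.1.symm) (ZMod.val_injective _ hh.2.symm)
  · rintro rfl
    exact ⟨rfl, rfl⟩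

lemma shift_one_zero (r : P.Site) : P.shift r 1 (0, 0) = r := by
  simp [Params.shift]

/-- A level-`0` colony has only one site, so `tc = τ` works; its upper bound needs just `f_c ≤ 1`.
-/
theorem kFaithful_zero (hb : 0 < P.b) : KFaithful 𝒜 P 0 := by
  intro 𝒱 ℰ _ k' τ r hk _ _
  obtain rfl : k' = 0 := by omega
  refine ⟨τ, by simp, ?_, fun t _ _ s _ hs => sameColony_zero.1 hs⟩
  have h1 : 0 ≤ (1 - fc 𝒜 P) * P.b * (P.U : ℝ) ^ (((0 : ℕ) : ℤ) - 1) := by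
    refine mul_nonneg (mul_nonneg ?_ (by positivity)) (by positivity)
    have h2 : fc 𝒜 P ≤ 1 := by
      unfold fc
      rw [div_le_one (by exact_mod_cast hb)]
      have : (0 : ℝ) ≤ nThr 𝒜 P := by positivity
      linarith
    linarith
  simpa using h1

/-- The supremum of an unbounded set of naturals is `0` by convention, so a bound is needed first: a
path longer than the number of labels repeats a label and closes a cycle. The edge from `c` to the
vacuum then gives a path of length one. -/
lemma diam_pos (hm : 𝒜.IsModular) (hc : 𝒜.NonCyclic) {c : A} (hc' : c ≠ 𝒜.vac) :
    0 < 𝒜.diam := by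
  have hbdd : BddAbove {l | ∃ x : ℕ → A, ∀ i < l, x i ≠ 𝒜.vac ∧
      0 < 𝒜.N (x i) (𝒜.dual (x i)) (x (i + 1))} := by
    refine ⟨Fintype.card A, ?_⟩
    rintro l ⟨x, hx⟩
    by_contra hl
    push Not at hl
    obtain ⟨i, hi, j, hj, hne, hij⟩ := Finset.exists_ne_map_eq_of_card_lt_of_maps_to
      (s := Finset.range l) (t := Finset.univ) (f := x) (by simpa using hl)
      (fun _ _ => Finset.mem_univ _)
    wlog hlt : i < j generalizing i j with H
    · exact H j hj i hi hne.symm hij.symm (by omega)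
    rw [Finset.mem_range] at hi hj
    refine hc ⟨j - i, fun m => x (i + m), by omega, (hx i hi).1, ?_, fun m hm => ?_⟩
    · simp only [add_zero]
      rw [Nat.add_sub_cancel' hlt.le, hij]
    · exact (hx (i + m) (by omega)).2
  refine lt_of_lt_of_le Nat.one_pos (le_csSup hbdd ⟨fun i => if i = 0 then c else 𝒜.vac, ?_⟩)
  intro i hi
  obtain rfl : i = 0 := by omega
  refine ⟨by simpa using hc', ?_⟩
  simp [hm.N_dual]

/-- With a true syndrome the displaced charge is the entire charge of the site, so the first
application succeeds whatever else arrives. The diameter is positive because that charge is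
nontrivial. -/
theorem zeroSuccessful (hm : 𝒜.IsModular) (hc : 𝒜.NonCyclic) : ZeroSuccessful 𝒜 P := by
  intro 𝒱 ℰ _ h r v τ hp _ hH ha
  have hsyn : syndrome ℰ h r τ = h (2 * τ + 1) r := by
    have := ha.2.1 (0, 0) (by simp [Params.nbhd])
    rwa [shift_one_zero] at this
  have hD := diam_pos hm hc (c := h (2 * τ + 1) r) (by rw [← hsyn]; exact ha.1)
  refine ⟨0, hD, fun i hi => ?_, ?_⟩
  · obtain rfl : i = 0 := by omega
    exact ha
  · have hne := evolve_ne_zero_of_le (i := 2 * (τ + 1)) (by omega) hp.evolve_ne_zero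
    have ho := outcome_of_rules hm (r := r) hne fun k r' v' i hk hv hi hr =>
      hH 0 hD ⟨k, r', v', hk, hv, i, hi, (0, 0), by simp [Params.nbhd], by
        rw [shift_one_zero]; exact hr.symm⟩
    exact ho.success hm ⟨v, ha.2.2⟩ (by rw [ruleCharge_zero, hsyn])

end ZeroSuccess

end AnyonDecoder

/-! ### The transition rules on a block of four sites, as a finite check -/

namespace AnyonDecoder

section Combinatorics

/-- The list of clauses of the transition rule. -/
def ruleData (Q X Y : ℕ) : List ((ℤ × ℤ) × Option (ℤ × ℤ)) × Option (ℤ × ℤ) :=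
  let H := Q / 2
  let west : List ((ℤ × ℤ) × Option (ℤ × ℤ)) :=
    if X = 0 then
      [((-1, 1), some (-1, 0)), ((-1, 0), some (-1, 0)), ((-1, -1), some (-1, 0))]
    else []
  let south : List ((ℤ × ℤ) × Option (ℤ × ℤ)) :=
    if Y = 0 then
      [((-1, -1), some (0, -1)), ((0, -1), some (0, -1)), ((1, -1), some (0, -1))]
    else []
  let inner : List ((ℤ × ℤ) × Option (ℤ × ℤ)) × Option (ℤ × ℤ) :=
    if X < H ∧ Y < H then
      ([((0, -1), none), ((-1, 0), none), ((-1, -1), none), ((0, 1), some (0, 1)),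
        ((-1, 1), some (0, 1)), ((1, 0), some (1, 0)), ((1, -1), some (1, 0))], some (0, 1))
    else if X < H ∧ Y = H then
      ([((0, -1), none), ((-1, 0), none), ((0, 1), none), ((-1, -1), none), ((-1, 1), none)],
        some (1, 0))
    else if X < H ∧ H < Y then
      ([((-1, 0), none), ((0, 1), none), ((-1, 1), none), ((1, 0), some (1, 0)),
        ((1, 1), some (1, 0)), ((0, -1), some (0, -1)), ((-1, -1), some (0, -1))], some (1, 0))
    else if X = H ∧ H < Y then
      ([((-1, 0), none), ((0, 1), none), ((1, 0), none), ((-1, 1), none), ((1, 1), none)],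
        some (0, -1))
    else if H < X ∧ H < Y then
      ([((0, 1), none), ((1, 0), none), ((1, 1), none), ((0, -1), some (0, -1)),
        ((1, -1), some (0, -1)), ((-1, 0), some (-1, 0)), ((-1, 1), some (-1, 0))], some (0, -1))
    else if H < X ∧ Y = H then
      ([((0, 1), none), ((1, 0), none), ((0, -1), none), ((1, 1), none), ((1, -1), none)],
        some (-1, 0))
    else if H < X ∧ Y < H then
      ([((1, 0), none), ((0, -1), none), ((1, -1), none), ((-1, 0), some (-1, 0)),
        ((-1, -1), some (-1, 0)), ((0, 1), some (0, 1)), ((1, 1), some (0, 1))], some (-1, 0))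
    else if X = H ∧ Y < H then
      ([((1, 0), none), ((0, -1), none), ((-1, 0), none), ((1, -1), none), ((-1, -1), none)],
        some (0, 1))
    else ([], none)
  (west ++ south ++ inner.1, inner.2)

lemma rule_eq_cascade (Q X Y : ℕ) (s : ℤ × ℤ → Prop) :
    rule Q X Y s = cascade s (ruleData Q X Y).1 (ruleData Q X Y).2 := rfl

/-- The decision list with decidable reports. -/
def cascadeBool (s : ℤ × ℤ → Bool) :
    List ((ℤ × ℤ) × Option (ℤ × ℤ)) → Option (ℤ × ℤ) → Option (ℤ × ℤ)
  | [], d => d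
  | (v, o) :: l, d => bif s v then o else cascadeBool s l d

/-- The four positions of a `2 × 2` block. -/
def corners : List (ℤ × ℤ) := [(0, 0), (0, 1), (1, 0), (1, 1)]

/-- The position to which the charge at `p` is moved if the charges at `m` are nontrivial, in a
block with column coordinates `X` and row coordinates `Y`. -/
def target (Q : ℕ) (X Y : ℤ → ℕ) (m : List (ℤ × ℤ)) (p : ℤ × ℤ) : ℤ × ℤ :=
  match cascadeBool (fun v => m.elem (p.1 + v.1, p.2 + v.2)) (ruleData Q (X p.1) (Y p.2)).1
      (ruleData Q (X p.1) (Y p.2)).2 with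
  | some v => (p.1 + v.1, p.2 + v.2)
  | none => p

/-- Two or more charges in a block stay in the block, and are all moved to a single site within two
steps. -/
def Gathers (Q : ℕ) (X Y : ℤ → ℕ) : Prop :=
  ∀ m ∈ corners.sublists, 2 ≤ m.length → (∀ p ∈ m, target Q X Y m p ∈ corners) ∧
    ∀ n ∈ corners.sublists, 2 ≤ n.length → (∀ p ∈ n, p ∈ m.map (target Q X Y m)) →
      ∀ p ∈ n, ∀ q ∈ n, target Q X Y n p = target Q X Y n q

instance (Q : ℕ) (X Y : ℤ → ℕ) : Decidable (Gathers Q X Y) := by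
  unfold Gathers; infer_instance

/-- The classes of the coordinates of two neighbouring columns or rows. -/
def classPairs : List (ℕ × ℕ) := [(0, 1), (1, 1), (1, 2), (2, 3), (3, 3), (3, 0)]

/-- The function with the values `c.1` at `0` and `c.2` elsewhere. -/
def pairFun (c : ℕ × ℕ) (i : ℤ) : ℕ := if i = 0 then c.1 else c.2

set_option maxRecDepth 100000 in
-- All `36` combinations of column and row classes are checked. In a colony of size `5` the
-- coordinates `0`, `1`, `2`, `3` represent the border, the lower half, the middle and the upper
-- half.
lemma gathers_classPairs : ∀ c ∈ classPairs, ∀ d ∈ classPairs, Gathers 5 (pairFun c) (pairFun d) := by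
  decide +kernel

end Combinatorics

end AnyonDecoder

/-! ### Transfer of the finite check to blocks on the torus -/

namespace AnyonDecoder

section Blocks

variable {P : Params}

/-- The class of a coordinate within a colony. -/
def coordClass (Q X : ℕ) : ℕ := if X = 0 then 0 else if X < Q / 2 then 1 else if X = Q / 2 then 2 else 3

lemma coordClass_spec {Q : ℕ} (hQ : 2 ≤ Q / 2) (X : ℕ) : (coordClass Q X = 0 ↔ X = 0) ∧
    (coordClass Q X < 2 ↔ X < Q / 2) ∧ (coordClass Q X = 2 ↔ X = Q / 2) ∧
    (2 < coordClass Q X ↔ Q / 2 < X) := by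
  unfold coordClass
  refine ⟨?_, ?_, ?_, ?_⟩ <;> split_ifs <;> first | omega | (simp; done) | (simp; omega)

/-- The clauses compare a coordinate only with `0` and with the middle of the colony. -/
lemma ruleData_coordClass {Q : ℕ} (hQ : 2 ≤ Q / 2) (X Y : ℕ) :
    ruleData Q X Y = ruleData 5 (coordClass Q X) (coordClass Q Y) := by
  obtain ⟨h1, h2, h3, h4⟩ := coordClass_spec hQ X
  obtain ⟨k1, k2, k3, k4⟩ := coordClass_spec hQ Y
  unfold ruleData
  simp only [h1, h2, h3, h4, k1, k2, k3, k4, Nat.reduceDiv]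

lemma classPair_mem {Q X : ℕ} (hQ : 2 ≤ Q / 2) (hX : X < Q) :
    (coordClass Q X, coordClass Q ((X + 1) % Q)) ∈ classPairs := by
  have h1 : (X + 1) % Q = if X + 1 = Q then 0 else X + 1 := by
    split_ifs with hh
    · rw [hh, Nat.mod_self]
    · exact Nat.mod_eq_of_lt (by omega)
  rw [h1]
  by_cases hh : X + 1 = Q
  · rw [if_pos hh]
    unfold coordClass
    split_ifs <;> first | (exfalso; omega) | decide
  · rw [if_neg hh]
    unfold coordClass
    split_ifs <;> first | (exfalso; omega) | decide

lemma corners_fst {p : ℤ × ℤ} (hp : p ∈ corners) : p.1 = 0 ∨ p.1 = 1 := by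
  simp only [corners, List.mem_cons, List.not_mem_nil, or_false] at hp
  rcases hp with rfl | rfl | rfl | rfl <;> simp

lemma corners_snd {p : ℤ × ℤ} (hp : p ∈ corners) : p.2 = 0 ∨ p.2 = 1 := by
  simp only [corners, List.mem_cons, List.not_mem_nil, or_false] at hp
  rcases hp with rfl | rfl | rfl | rfl <;> simp

lemma target_congr {Q Q' : ℕ} {X Y X' Y' : ℤ → ℕ}
    (h : ∀ p ∈ corners, ruleData Q (X p.1) (Y p.2) = ruleData Q' (X' p.1) (Y' p.2))
    (m : List (ℤ × ℤ)) {p : ℤ × ℤ} (hp : p ∈ corners) :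
    target Q X Y m p = target Q' X' Y' m p := by
  unfold target
  rw [h p hp]

lemma gathers_congr {Q Q' : ℕ} {X Y X' Y' : ℤ → ℕ}
    (h : ∀ p ∈ corners, ruleData Q (X p.1) (Y p.2) = ruleData Q' (X' p.1) (Y' p.2))
    (hg : Gathers Q' X' Y') : Gathers Q X Y := by
  intro m hm hm2
  have hsub : ∀ {m}, m ∈ corners.sublists → ∀ p ∈ m, p ∈ corners := fun hm p hp =>
    (List.mem_sublists.1 hm).subset hp
  obtain ⟨h1, h2⟩ := hg m hm hm2
  refine ⟨fun p hp => ?_, fun n hn hn2 hsubn p hp q hq => ?_⟩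
  · rw [target_congr h m (hsub hm p hp)]
    exact h1 p hp
  · rw [target_congr h n (hsub hn p hp), target_congr h n (hsub hn q hq)]
    refine h2 n hn hn2 (fun p hp => ?_) p hp q hq
    obtain ⟨u, hu, rfl⟩ := List.mem_map.1 (hsubn p hp)
    rw [target_congr h m (hsub hm u hu)]
    exact List.mem_map_of_mem hu

/-- The coordinate within its colony of a column or row. -/
def coord (P : Params) (x : ZMod P.L) (i : ℤ) : ℕ := (x + (i : ZMod P.L)).val % P.Q

lemma two_le_half_Q (P : Params) : 2 ≤ P.Q / 2 := by
  have h1 := P.le_Q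
  have h2 := P.three_le_a
  omega

lemma coord_one (x : ZMod P.L) : coord P x 1 = (coord P x 0 + 1) % P.Q := by
  have hL := P.twenty_le_L
  have : Fact (1 < P.L) := ⟨by omega⟩
  have hd : P.Q ∣ P.L := dvd_pow_self _ P.n_pos.ne'
  unfold coord
  simp only [Int.cast_one, Int.cast_zero, add_zero]
  rw [ZMod.val_add, ZMod.val_one, Nat.mod_mod_of_dvd _ hd, Nat.mod_add_mod]

lemma coord_lt (x : ZMod P.L) (i : ℤ) : coord P x i < P.Q :=
  Nat.mod_lt _ (by have := two_le_half_Q P; omega)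

lemma gathers_coord (x y : ZMod P.L) : Gathers P.Q (coord P x) (coord P y) := by
  have hQ := two_le_half_Q P
  have key : ∀ z : ZMod P.L, ∀ i, i = 0 ∨ i = 1 → coordClass P.Q (coord P z i) =
      pairFun (coordClass P.Q (coord P z 0), coordClass P.Q ((coord P z 0 + 1) % P.Q)) i := by
    rintro z i (rfl | rfl)
    · simp [pairFun]
    · simp [pairFun, coord_one]
  refine gathers_congr (fun p hp => ?_) (gathers_classPairs _ (classPair_mem hQ (coord_lt x 0)) _
    (classPair_mem hQ (coord_lt y 0)))
  rw [ruleData_coordClass hQ, key x _ (corners_fst hp), key y _ (corners_snd hp)]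

/-- The site at the position `p` relative to `(x, y)`. -/
def siteAt (P : Params) (x y : ZMod P.L) (p : ℤ × ℤ) : P.Site :=
  (x + (p.1 : ZMod P.L), y + (p.2 : ZMod P.L))

lemma shift_siteAt (x y : ZMod P.L) (p v : ℤ × ℤ) :
    P.shift (siteAt P x y p) 1 v = siteAt P x y (p.1 + v.1, p.2 + v.2) := by
  ext <;> simp [Params.shift, siteAt] <;> ring

lemma intCast_injOn {i j : ℤ} (h : |i - j| ≤ 2) (hij : (i : ZMod P.L) = j) : i = j := by
  have hL := P.twenty_le_L
  have h1 := (ZMod.intCast_eq_intCast_iff_dvd_sub i j P.L).1 hij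
  rw [abs_le] at h
  obtain ⟨k, hk⟩ := h1
  have : k = 0 := by
    by_contra hk0
    rcases lt_or_gt_of_ne hk0 with h2 | h2
    · have : (P.L : ℤ) * k ≤ -P.L := by nlinarith
      omega
    · have : (P.L : ℤ) ≤ P.L * k := by nlinarith
      omega
  rw [this] at hk
  omega

lemma siteAt_inj {x y : ZMod P.L} {p q : ℤ × ℤ} (h1 : |p.1 - q.1| ≤ 2) (h2 : |p.2 - q.2| ≤ 2)
    (h : siteAt P x y p = siteAt P x y q) : p = q := by
  simp only [siteAt, Prod.mk.injEq, add_right_inj] at h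
  exact Prod.ext (intCast_injOn h1 h.1) (intCast_injOn h2 h.2)

/-- The `2 × 2` block of sites with south-west corner `(x, y)`. -/
def Square (P : Params) (x y : ZMod P.L) (s : P.Site) : Prop := ∃ p ∈ corners, siteAt P x y p = s

lemma square_iff {x y : ZMod P.L} {s : P.Site} :
    Square P x y s ↔ (s.1 = x ∨ s.1 = x + 1) ∧ (s.2 = y ∨ s.2 = y + 1) := by
  constructor
  · rintro ⟨p, hp, rfl⟩
    rcases corners_fst hp with h1 | h1 <;> rcases corners_snd hp with h2 | h2 <;>
      simp [siteAt, h1, h2]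
  · rintro ⟨h1, h2⟩
    rcases h1 with h1 | h1 <;> rcases h2 with h2 | h2
    · exact ⟨(0, 0), by decide, by ext <;> simp [siteAt, h1, h2]⟩
    · exact ⟨(0, 1), by decide, by ext <;> simp [siteAt, h1, h2]⟩
    · exact ⟨(1, 0), by decide, by ext <;> simp [siteAt, h1, h2]⟩
    · exact ⟨(1, 1), by decide, by ext <;> simp [siteAt, h1, h2]⟩

/-- The displacement of the charge at `s` if the reports are nontrivial at the sites in `B`. -/
noncomputable def moveOf (P : Params) (B : P.Site → Prop) (s : P.Site) : Option (ℤ × ℤ) :=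
  rule P.Q (s.1.val % P.Q) (s.2.val % P.Q) fun v => B (P.shift s 1 v)

/-- `s'` is reached by a charge at a site in `B`. -/
def Reached (P : Params) (B : P.Site → Prop) (s' : P.Site) : Prop :=
  ∃ s, B s ∧ (moveOf P B s = none ∧ s = s' ∨ ∃ v, moveOf P B s = some v ∧ P.shift s 1 v = s')

lemma cascade_eq_cascadeBool {s : ℤ × ℤ → Prop} {s' : ℤ × ℤ → Bool}
    (l : List ((ℤ × ℤ) × Option (ℤ × ℤ))) (d : Option (ℤ × ℤ))
    (h : ∀ x ∈ l, s x.1 ↔ s' x.1 = true) : cascade s l d = cascadeBool s' l d := by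
  induction l with
  | nil => rfl
  | cons x l ih =>
    obtain ⟨v, o⟩ := x
    have hv := h (v, o) (List.mem_cons_self ..)
    rw [cascade, cascadeBool, ih fun x hx => h x (List.mem_cons_of_mem _ hx)]
    by_cases hs : s v
    · rw [if_pos hs, hv.1 hs]; rfl
    · rw [if_neg hs, Bool.eq_false_iff.2 fun hh => hs (hv.2 hh)]; rfl

lemma ruleData_nbhd (Q X Y : ℕ) : ∀ x ∈ (ruleData Q X Y).1, |x.1.1| ≤ 1 ∧ |x.1.2| ≤ 1 := by
  have h1 : ∀ x ∈ (ruleData Q X Y).1, x.1 ∈ ([(-1, -1), (-1, 0), (-1, 1), (0, -1), (0, 1), (1, -1),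
      (1, 0), (1, 1)] : List (ℤ × ℤ)) := by
    unfold ruleData
    simp only
    intro x hx
    simp only [List.mem_append] at hx
    rcases hx with (hx | hx) | hx
    · split_ifs at hx
      · revert x; decide
      · simp at hx
    · split_ifs at hx
      · revert x; decide
      · simp at hx
    · split_ifs at hx <;> revert x <;> decide
  intro x hx
  have h2 : ∀ v ∈ ([(-1, -1), (-1, 0), (-1, 1), (0, -1), (0, 1), (1, -1),
      (1, 0), (1, 1)] : List (ℤ × ℤ)), |v.1| ≤ 1 ∧ |v.2| ≤ 1 := by decide
  exact h2 _ (h1 x hx)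

section

open scoped Classical

/-- The corners of the block at `(x, y)` that belong to `B`. -/
noncomputable def cornersIn (x y : ZMod P.L) (B : P.Site → Prop) : List (ℤ × ℤ) :=
  corners.filter fun p => B (siteAt P x y p)

variable {x y : ZMod P.L} {B : P.Site → Prop}

lemma mem_cornersIn {p : ℤ × ℤ} : p ∈ cornersIn x y B ↔ p ∈ corners ∧ B (siteAt P x y p) := by
  simp [cornersIn]

lemma cornersIn_mem_sublists : cornersIn x y B ∈ corners.sublists :=
  List.mem_sublists.2 List.filter_sublist

lemma exists_cornersIn (hB : ∀ s, B s → Square P x y s) {s : P.Site} (hs : B s) :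
    ∃ p ∈ cornersIn x y B, siteAt P x y p = s := by
  obtain ⟨p, hp, rfl⟩ := hB s hs
  exact ⟨p, mem_cornersIn.2 ⟨hp, hs⟩, rfl⟩

lemma two_le_length_cornersIn (hB : ∀ s, B s → Square P x y s) {s s' : P.Site} (hs : B s)
    (hs' : B s') (hne : s ≠ s') : 2 ≤ (cornersIn x y B).length := by
  obtain ⟨p, hp, rfl⟩ := exists_cornersIn hB hs
  obtain ⟨q, hq, rfl⟩ := exists_cornersIn hB hs'
  have hpq : p ≠ q := fun hh => hne (by rw [hh])
  generalize cornersIn x y B = l at hp hq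
  rcases l with _ | ⟨a, _ | ⟨b, l⟩⟩
  · simp at hp
  · rw [List.mem_singleton] at hp hq
    exact absurd (hp.trans hq.symm) hpq
  · simp

/-- This identifies the rule on the torus with its finite model. A reporting neighbour of a corner
is itself a corner and, the torus being large, sits at the expected relative position
(`siteAt_inj`). -/
lemma moveOf_siteAt (hB : ∀ s, B s → Square P x y s) {p : ℤ × ℤ} (hp : p ∈ corners) :
    target P.Q (coord P x) (coord P y) (cornersIn x y B) p =
      match moveOf P B (siteAt P x y p) with
      | some v => (p.1 + v.1, p.2 + v.2)
      | none => p := by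
  have h1 : moveOf P B (siteAt P x y p) =
      cascadeBool (fun v => (cornersIn x y B).elem (p.1 + v.1, p.2 + v.2))
        (ruleData P.Q (coord P x p.1) (coord P y p.2)).1
        (ruleData P.Q (coord P x p.1) (coord P y p.2)).2 := by
    unfold moveOf
    rw [rule_eq_cascade]
    refine cascade_eq_cascadeBool _ _ fun w hw => ?_
    have hn := ruleData_nbhd _ _ _ w hw
    rw [shift_siteAt, List.elem_eq_mem, decide_eq_true_eq]
    constructor
    · intro hs
      obtain ⟨q, hq, he⟩ := exists_cornersIn hB hs
      have hqc := (mem_cornersIn.1 hq).1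
      have : q = (p.1 + w.1.1, p.2 + w.1.2) := by
        have hn1 := abs_le.1 hn.1
        have hn2 := abs_le.1 hn.2
        refine siteAt_inj (x := x) (y := y) ?_ ?_ he <;> rw [abs_le] <;> simp only
        · rcases corners_fst hp with h | h <;> rcases corners_fst hqc with h' | h' <;>
            rw [h, h'] <;> constructor <;> omega
        · rcases corners_snd hp with h | h <;> rcases corners_snd hqc with h' | h' <;>
            rw [h, h'] <;> constructor <;> omega
      rwa [← this]
    · exact fun hs => (mem_cornersIn.1 hs).2
  unfold target
  rw [h1]

lemma exists_target_of_reached (hB : ∀ s, B s → Square P x y s) {s' : P.Site}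
    (hs' : Reached P B s') : ∃ p ∈ cornersIn x y B,
      siteAt P x y (target P.Q (coord P x) (coord P y) (cornersIn x y B) p) = s' := by
  obtain ⟨s, hs, hm⟩ := hs'
  obtain ⟨p, hp, rfl⟩ := exists_cornersIn hB hs
  refine ⟨p, hp, ?_⟩
  rw [moveOf_siteAt hB (mem_cornersIn.1 hp).1]
  rcases hm with ⟨hm, rfl⟩ | ⟨v, hm, rfl⟩
  · rw [hm]
  · rw [hm, shift_siteAt]

/-- Two occupied sites are essential: an isolated charge is sent towards the centre of its colony
and may leave the block. -/
lemma square_of_reached (hB : ∀ s, B s → Square P x y s) {s₁ s₂ : P.Site} (h₁ : B s₁) (h₂ : B s₂)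
    (hne : s₁ ≠ s₂) {s : P.Site} (hs : Reached P B s) : Square P x y s := by
  obtain ⟨p, hp, rfl⟩ := exists_target_of_reached hB hs
  exact ⟨_, (gathers_coord x y _ cornersIn_mem_sublists (two_le_length_cornersIn hB h₁ h₂ hne)).1 p hp,
    rfl⟩

/-- Two or more charges in a block are all moved to a single site within two steps. -/
lemma reached_unique (hB : ∀ s, B s → Square P x y s) {s₁ s₂ : P.Site} (h₁ : B s₁) (h₂ : B s₂)
    (hne : s₁ ≠ s₂) {B' : P.Site → Prop} (hB' : ∀ s, B' s → Reached P B s) {s₁' s₂' : P.Site}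
    (h₁' : B' s₁') (h₂' : B' s₂') (hne' : s₁' ≠ s₂') {s s' : P.Site} (hs : Reached P B' s)
    (hs' : Reached P B' s') : s = s' := by
  have hsq : ∀ s, B' s → Square P x y s := fun s hs => square_of_reached hB h₁ h₂ hne (hB' s hs)
  obtain ⟨p, hp, rfl⟩ := exists_target_of_reached hsq hs
  obtain ⟨q, hq, rfl⟩ := exists_target_of_reached hsq hs'
  obtain ⟨hin, hg⟩ := gathers_coord x y _ cornersIn_mem_sublists
    (two_le_length_cornersIn hB h₁ h₂ hne)
  -- `Gathers` allows every subset of the image with at least two elements, because arriving charges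
  -- may fuse to the vacuum and `B'` is only known to lie in the image.
  rw [hg _ cornersIn_mem_sublists (two_le_length_cornersIn hsq h₁' h₂' hne') ?_ p hp q hq]
  intro u hu
  obtain ⟨hu1, hu2⟩ := mem_cornersIn.1 hu
  obtain ⟨w, hw, he⟩ := exists_target_of_reached hB (hB' _ hu2)
  have := siteAt_inj (x := x) (y := y) ?_ ?_ he
  · rw [← this]
    exact List.mem_map_of_mem hw
  · rcases corners_fst hu1 with h | h <;> rcases corners_fst (hin w hw) with h' | h' <;>
      rw [h, h'] <;> norm_num
  · rcases corners_snd hu1 with h | h <;> rcases corners_snd (hin w hw) with h' | h' <;>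
      rw [h, h'] <;> norm_num

end

end Blocks

end AnyonDecoder

/-! ### Geometry of a single level-`0` error, and silence of the higher rules -/

namespace AnyonDecoder

open scoped Matrix ComplexConjugate

section Single

open scoped Classical

variable {A : Type*} [Fintype A] {𝒜 : AnyonData A} {P : Params}

/-- The midpoint of an edge in a closed unit interval with integer ends must be the midpoint of the
interval, so the edge starts at the lower end. -/
lemma eq_intCast_of_half {v : ZMod P.L} {x i : ℤ} (h1 : (x : ℝ) ≤ (v.val + 1 / 2 : ℝ) + i * P.L)
    (h2 : (v.val + 1 / 2 : ℝ) + i * P.L ≤ x + 1) : v = (x : ZMod P.L) := by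
  have h3 : x < v.val + i * P.L + 1 := by
    have : (x : ℝ) < ((v.val + i * P.L + 1 : ℤ) : ℝ) := by push_cast; linarith
    exact_mod_cast this
  have h4 : (v.val + i * P.L : ℤ) < x + 1 := by
    have : ((v.val + i * P.L : ℤ) : ℝ) < ((x + 1 : ℤ) : ℝ) := by push_cast; linarith
    exact_mod_cast this
  have h5 : x = v.val + i * P.L := by omega
  rw [h5]
  simp

lemma eq_intCast_or {v : ZMod P.L} {x i : ℤ} (h1 : (x : ℝ) ≤ (v.val : ℝ) + i * P.L)
    (h2 : (v.val : ℝ) + i * P.L ≤ x + 1) : v = (x : ZMod P.L) ∨ v = (x : ZMod P.L) + 1 := by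
  have h3 : x ≤ v.val + i * P.L := by
    have : (x : ℝ) ≤ ((v.val + i * P.L : ℤ) : ℝ) := by push_cast; linarith
    exact_mod_cast this
  have h4 : (v.val + i * P.L : ℤ) ≤ x + 1 := by
    have : ((v.val + i * P.L : ℤ) : ℝ) ≤ ((x + 1 : ℤ) : ℝ) := by push_cast; linarith
    exact_mod_cast this
  have h5 : x = v.val + i * P.L ∨ x + 1 = v.val + i * P.L := by omega
  rcases h5 with h5 | h5
  · left; rw [h5]; simp
  · right
    have : ((x : ZMod P.L) + 1) = ((x + 1 : ℤ) : ZMod P.L) := by push_cast; rfl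
    rw [this, h5]; simp

omit [Fintype A] in
lemma sites_subset_square {e : Err A P} {x y : ℤ} {t : ℝ} (he : e.InUnitBox x y t) :
    ∀ s ∈ e.sites, Square P x y s := by
  obtain ⟨⟨i, hi1, hi2⟩, ⟨j, hj1, hj2⟩, -⟩ := he
  intro s hs
  rw [square_iff]
  cases e with
  | charge e t c =>
    obtain ⟨⟨a, b⟩, d⟩ := e
    simp only [Err.sites, Set.mem_insert_iff, Set.mem_singleton_iff] at hs
    cases d
    · simp only [Err.pos, Bool.false_eq_true, if_false, add_zero] at hi1 hi2 hj1 hj2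
      have h1 := eq_intCast_of_half hi1 hi2
      have h2 := eq_intCast_or hj1 hj2
      rcases hs with rfl | rfl
      · exact ⟨Or.inl h1, h2⟩
      · rw [Params.head_false]
        exact ⟨Or.inr (by rw [h1]), h2⟩
    · simp only [Err.pos, if_true, add_zero] at hi1 hi2 hj1 hj2
      have h1 := eq_intCast_of_half hj1 hj2
      have h2 := eq_intCast_or hi1 hi2
      rcases hs with rfl | rfl
      · exact ⟨h2, Or.inl h1⟩
      · rw [Params.head_true]
        exact ⟨h2, Or.inr (by rw [h1])⟩
  | meas r t w =>
    simp only [Err.sites, Set.mem_singleton_iff] at hs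
    subst hs
    exact ⟨eq_intCast_or hi1 hi2, eq_intCast_or hj1 hj2⟩

omit [Fintype A] in
/-- A level-`0` candidate consists of errors of one kind in a single time step and in a block. -/
lemma candidateZero_spec {ℰ E : Set (Err A P)} (hE : E ∈ candidateZero ℰ) :
    ∃ (t₀ : ℕ) (x y : ZMod P.L), E.Nonempty ∧ E ⊆ ℰ ∧ (∀ e ∈ E, e.step = t₀) ∧
      ((∀ e ∈ E, e.IsCharge) ∨ ∀ e ∈ E, ¬ e.IsCharge) ∧ ∀ e ∈ E, ∀ s ∈ e.sites, Square P x y s := by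
  obtain ⟨⟨e₀, he₀⟩, hsub, hk, x, y, t, hb⟩ := hE
  refine ⟨e₀.step, x, y, ⟨e₀, he₀⟩, hsub, fun e he => ?_, hk, fun e he => sites_subset_square (hb e he)⟩
  have h1 : e.time = e₀.time := (hb e he).2.2.trans (hb e₀ he₀).2.2.symm
  rcases hk with hk | hk
  · have h2 := hk e he
    have h3 := hk e₀ he₀
    cases e <;> cases e₀ <;> simp_all [Err.IsCharge, Err.time, Err.step]
  · have h2 := hk e he
    have h3 := hk e₀ he₀
    cases e <;> cases e₀ <;> simp_all [Err.IsCharge, Err.time, Err.step]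

section Higher

omit [Fintype A] in
lemma le_card_of_binCharge_ne {b thr : ℕ} {s : ℕ → A} {i : ℕ} (h : binCharge 𝒜 b thr s i ≠ 𝒜.vac) :
    thr ≤ ((Finset.range b).filter fun β => s (i + β) ≠ 𝒜.vac).card := by
  by_contra hc
  exact h (if_neg hc)

omit [Fintype A] in
lemma exists_bin {b thr : ℕ} (hthr : 0 < thr) {s : ℕ → A} {k τ : ℕ}
    (h : levelSyndrome 𝒜 b thr s (k + 1) τ ≠ 𝒜.vac) : ∃ β < b, thr ≤ ((Finset.range b).filter
      fun γ => levelSyndrome 𝒜 b thr s k (τ * b ^ 2 + β * b + γ) ≠ 𝒜.vac).card := by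
  rw [levelSyndrome] at h
  simp only at h
  split_ifs at h with hc
  · obtain ⟨β, hβ⟩ := Finset.card_pos.1 (lt_of_lt_of_le hthr hc)
    rw [Finset.mem_filter, Finset.mem_range] at hβ
    exact ⟨β, hβ.1, le_card_of_binCharge_ne hβ.2⟩
  · exact absurd rfl h

omit [Fintype A] in
/-- A nontrivial syndrome of positive level requires many nontrivial reports. -/
lemma le_card_of_levelSyndrome_ne {b thr : ℕ} (hthr : 0 < thr) {s : ℕ → A} (k : ℕ) {τ : ℕ}
    (h : levelSyndrome 𝒜 b thr s (k + 1) τ ≠ 𝒜.vac) :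
    thr ≤ ((Finset.range ((τ + 1) * (b ^ 2) ^ (k + 1))).filter fun t => s t ≠ 𝒜.vac).card := by
  induction k generalizing τ with
  | zero =>
    obtain ⟨β, hβ, hc⟩ := exists_bin hthr h
    refine hc.trans (Finset.card_le_card_of_injOn (fun γ => τ * b ^ 2 + β * b + γ) ?_ ?_)
    · intro γ hγ
      simp only [Finset.coe_filter, Finset.mem_range, Set.mem_ofPred_eq] at hγ ⊢
      refine ⟨?_, hγ.2⟩
      have : β * b + γ < b ^ 2 := by nlinarith [hγ.1]
      rw [zero_add, pow_one, add_mul]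
      omega
    · intro γ _ γ' _ hh
      simp only at hh
      omega
  | succ k ih =>
    obtain ⟨β, hβ, hc⟩ := exists_bin hthr h
    obtain ⟨γ, hγ⟩ := Finset.card_pos.1 (lt_of_lt_of_le hthr hc)
    rw [Finset.mem_filter, Finset.mem_range] at hγ
    refine (ih hγ.2).trans (Finset.card_le_card (Finset.filter_subset_filter _ ?_))
    refine Finset.range_subset_range.2 ?_
    have : β * b + γ + 1 ≤ b ^ 2 := by nlinarith [hγ.1]
    have h2 : τ * b ^ 2 + β * b + γ + 1 ≤ (τ + 1) * b ^ 2 := by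
      rw [add_mul]; omega
    calc _ ≤ (τ + 1) * b ^ 2 * (b ^ 2) ^ (k + 1) := Nat.mul_le_mul_right _ h2
      _ = _ := by rw [pow_succ (b ^ 2) (k + 1)]; ring

variable {ℰ : Set (Err A P)} {h : History A P}

/-- Up to time step `t`, nontrivial charges are only reported in the steps from `t₀` to `t₀ + 2`. -/
def ReportsIn (𝒜 : AnyonData A) (ℰ : Set (Err A P)) (h : History A P) (t₀ t : ℕ) : Prop :=
  ∀ s t', t' ≤ t → syndrome ℰ h s t' ≠ 𝒜.vac → t₀ ≤ t' ∧ t' ≤ t₀ + 2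

/-- A rule of positive level needs at least `cThr` nontrivial level-`0` reports at its centre
(`le_card_of_levelSyndrome_ne`), but only three time steps can supply them. -/
lemma appliedRule_eq_none (hthr : 3 < cThr 𝒜 P) {t₀ t : ℕ} (hR : ReportsIn 𝒜 ℰ h t₀ t) {k : ℕ}
    (hk : 0 < k) (r : P.Site) : appliedRule 𝒜 ℰ h k t r = none := by
  unfold appliedRule
  refine if_neg fun hc => ?_
  obtain ⟨-, -, hmod, hq⟩ := hc
  obtain ⟨k, rfl⟩ := Nat.exists_eq_succ_of_ne_zero hk.ne'
  have h1 := le_card_of_levelSyndrome_ne (by omega) k hq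
  -- The rule acts at the end of a working period, where `t + 1` is a positive multiple of its
  -- length, so the truncated subtraction is harmless.
  have h2 : ((t + 1) / P.U ^ (k + 1) - 1 + 1) * (P.b ^ 2) ^ (k + 1) = t + 1 := by
    obtain ⟨m, hm⟩ := Nat.dvd_of_mod_eq_zero hmod
    have hU : 0 < P.U ^ (k + 1) := by
      rcases Nat.eq_zero_or_pos (P.U ^ (k + 1)) with h0 | h0
      · rw [Nat.succ_eq_add_one, h0] at hm; omega
      · exact h0
    have hm0 : m ≠ 0 := by rintro rfl; omega
    rw [Nat.succ_eq_add_one] at hm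
    rw [hm, Nat.mul_div_cancel_left _ hU, Nat.sub_add_cancel (by omega), mul_comm]
    rfl
  rw [h2] at h1
  have h3 : ((Finset.range (t + 1)).filter fun t => syndrome ℰ h r t ≠ 𝒜.vac) ⊆
      Finset.Icc t₀ (t₀ + 2) := by
    intro t' ht'
    rw [Finset.mem_filter, Finset.mem_range] at ht'
    exact Finset.mem_Icc.2 (hR r t' (by omega) ht'.2)
  have h4 := Finset.card_le_card h3
  rw [Nat.card_Icc] at h4
  omega

lemma appliedRule_zero (t : ℕ) (r : P.Site) : appliedRule 𝒜 ℰ h 0 t r =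
    if syndrome ℰ h r t ≠ 𝒜.vac then moveOf P (fun s => syndrome ℰ h s t ≠ 𝒜.vac) r else none := by
  unfold appliedRule
  rw [ruleCharge_zero]
  by_cases hs : syndrome ℰ h r t ≠ 𝒜.vac
  · rw [if_pos ⟨P.n_pos, by simp [Params.IsCentre, Nat.mod_one], by simp [Nat.mod_one], hs⟩, if_pos hs]
    simp only [pow_zero, Nat.div_one, Nat.add_sub_cancel]
    rfl
  · rw [if_neg fun hc => hs hc.2.2.2, if_neg hs]

omit [Fintype A] in
lemma three_lt_cThr (hb : 2 * (4 * (3 * 𝒜.diam + 1) * P.Q + 1) < P.b) : 3 < cThr 𝒜 P := by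
  have h1 := P.le_Q
  have h2 := P.three_le_a
  have h3 : 4 * P.Q ≤ 4 * (3 * 𝒜.diam + 1) * P.Q := Nat.mul_le_mul_right _ (by omega)
  unfold cThr nThr
  omega

end Higher

/-- The positions to which windings are attached for a block whose south-west corner is in the
row `y`. -/
noncomputable def windingSet (P : Params) (y : ZMod P.L) : Finset P.Slot :=
  if y = -1 then P.rowZero else ∅

lemma windingSet_eq (y : ZMod P.L) : windingSet P y = ∅ ∨ windingSet P y = P.rowZero := by
  unfold windingSet
  split_ifs <;> simp

lemma add_two_ne (x : ZMod P.L) : x + 1 + 1 ≠ x ∧ x + 1 + 1 ≠ x + 1 ∧ x + 1 ≠ x := by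
  have hL := P.twenty_le_L
  have h1 : ∀ n : ℕ, 0 < n → n < P.L → (n : ZMod P.L) ≠ 0 := fun n h0 hn hh =>
    absurd (Nat.le_of_dvd h0 ((ZMod.natCast_eq_zero_iff _ _).1 hh)) (by omega)
  have h2 := h1 2 (by omega) (by omega)
  have h3 := h1 1 (by omega) (by omega)
  push_cast at h2 h3
  refine ⟨?_, ?_, ?_⟩
  · rw [add_assoc, one_add_one_eq_two]
    simpa using h2
  · simpa using h3
  · simpa using h3

/-- On a torus this large, a horizontal edge inside the block starts in the western column and a
vertical one in the southern row. The vertical edges wrap exactly if this row is the last one, the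
case in which `windingSet` is row `0`. -/
lemma compatible_of_square {x y : ZMod P.L} {e : P.Edge} (h1 : Square P x y (P.tail e))
    (h2 : Square P x y (P.head e)) : P.Compatible x (windingSet P y) e := by
  rw [square_iff] at h1 h2
  obtain ⟨⟨a, b⟩, c⟩ := e
  obtain ⟨hx1, hx2, hx3⟩ := add_two_ne x
  obtain ⟨hy1, hy2, hy3⟩ := add_two_ne y
  cases c
  · rw [Params.head_false] at h2
    have ha : a = x := by
      rcases h1.1 with h | h
      · exact h
      · simp only [Params.tail] at h
        subst h
        rcases h2.1 with h | h
        · exact absurd h hx1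
        · exact absurd h hx2
    have hw : ¬ P.IsWrap ((a, b), false) := fun hh => by simp [Params.IsWrap] at hh
    refine ⟨Or.inl ha, ?_⟩
    unfold windingSet
    split_ifs
    · exact Or.inr ⟨rfl, Or.inr rfl⟩
    · exact Or.inl ⟨rfl, hw⟩
  · rw [Params.head_true] at h2
    have hb : b = y := by
      rcases h1.2 with h | h
      · exact h
      · simp only [Params.tail] at h
        subst h
        rcases h2.2 with h | h
        · exact absurd h hy1
        · exact absurd h hy2
    refine ⟨h1.1.imp id fun hh => ⟨rfl, hh⟩, ?_⟩
    unfold windingSet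
    split_ifs with hy
    · exact Or.inr ⟨rfl, Or.inl ⟨rfl, hb.trans hy⟩⟩
    · exact Or.inl ⟨rfl, fun hh => hy (hb.symm.trans hh.2)⟩

lemma compatible_edgeAt {x y : ZMod P.L} {r : P.Site} {v : ℤ × ℤ} (hv : v ∈ units)
    (h1 : Square P x y r) (h2 : Square P x y (P.shift r 1 v)) :
    P.Compatible x (windingSet P y) (P.edgeAt r v) := by
  rcases edgeAt_tail_head (r := r) hv with ⟨ht, hh⟩ | ⟨ht, hh⟩
  · exact compatible_of_square (by rwa [ht]) (by rwa [hh])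
  · exact compatible_of_square (by rwa [ht]) (by rwa [hh])

end Single

end AnyonDecoder

/-! ### The course of events after a single level-`0` error -/

namespace AnyonDecoder

open scoped Matrix ComplexConjugate

section Correction

open scoped Classical

variable {A : Type*} [Fintype A] {𝒜 : AnyonData A} {P : Params}

variable {E : Set (Err A P)} {h : History A P} {𝒱 : Env A P}

/-- There are no charges at time `j / 2`. -/
def Clean (𝒜 : AnyonData A) (h : History A P) (j : ℕ) : Prop := ∀ s, h j s = 𝒜.vac

/-- The charges at time `j / 2` lie in the block at `(x, y)`. -/
def Supported (𝒜 : AnyonData A) (h : History A P) (x y : ZMod P.L) (j : ℕ) : Prop :=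
  ∀ s, h j s ≠ 𝒜.vac → Square P x y s

/-- There is not exactly one nontrivial charge at time `j / 2`. -/
def NotSingle (𝒜 : AnyonData A) (h : History A P) (j : ℕ) : Prop :=
  ∀ s, h j s ≠ 𝒜.vac → ∃ s', s' ≠ s ∧ h j s' ≠ 𝒜.vac

omit [Fintype A] in
lemma Clean.supported {j : ℕ} (hc : Clean 𝒜 h j) (x y : ZMod P.L) : Supported 𝒜 h x y j :=
  fun s hs => absurd (hc s) hs

lemma syndrome_eq {t : ℕ} {s : P.Site} (hs : ∀ w, Err.meas s t w ∉ E) :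
    syndrome E h s t = h (2 * t + 1) s :=
  dif_neg fun ⟨w, hw⟩ => hs w hw

section Modular

variable (hm : 𝒜.IsModular)
include hm

lemma charge_of_quiet_noise {t : ℕ} (ht : evolve 𝒜 𝒱 E h (2 * t + 1) ≠ 0)
    (hE : ∀ e c, Err.charge e t c ∉ E) : h (2 * t + 1) = h (2 * t) :=
  funext fun _ => charge_of_noise hm ht fun e c he => absurd he (hE e c)

lemma rangeIn_quiet_noise {t : ℕ} (hE : ∀ e c, Err.charge e t c ∉ E) {x : ZMod P.L}
    {S : Finset P.Slot}
    (hr : RangeIn (evolve 𝒜 𝒱 E h (2 * t)) (neutralSpace 𝒜 P (P.slotAt x 0) S)) :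
    RangeIn (evolve 𝒜 𝒱 E h (2 * t + 1)) (neutralSpace 𝒜 P (P.slotAt x 0) S) := by
  refine rangeIn_evolve_succ ?_
  rw [preState_even]
  exact noiseStep_rangeIn hm _ (fun e c he => absurd he (hE e c)) hr

lemma outcome_of_no_higher {t : ℕ} (ht : evolve 𝒜 𝒱 E h (2 * (t + 1)) ≠ 0)
    (hk : ∀ k r, 0 < k → appliedRule 𝒜 E h k t r = none) (r : P.Site) :
    Outcome 𝒜 E h t r (h (2 * t + 1) r) (h (2 * (t + 1)) r) :=
  outcome_of_rules hm ht fun k r' v _ hk0 hv => by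
    rw [hk k r' hk0] at hv
    exact absurd hv (by simp)

/-- A time step without errors and without charges. -/
lemma quiet_step {t : ℕ} (ht : evolve 𝒜 𝒱 E h (2 * (t + 1)) ≠ 0) (hE : ∀ e ∈ E, e.step ≠ t)
    (hk : ∀ k r, 0 < k → appliedRule 𝒜 E h k t r = none) (hc : Clean 𝒜 h (2 * t)) :
    Clean 𝒜 h (2 * (t + 1)) ∧ ∀ (x : ZMod P.L) (S : Finset P.Slot), S = ∅ ∨ S = P.rowZero →
      RangeIn (evolve 𝒜 𝒱 E h (2 * t)) (neutralSpace 𝒜 P (P.slotAt x 0) S) →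
      RangeIn (evolve 𝒜 𝒱 E h (2 * (t + 1))) (neutralSpace 𝒜 P (P.slotAt x 0) S) := by
  have h1 := charge_of_quiet_noise hm (evolve_ne_zero_of_succ ht) fun e c he => hE _ he rfl
  have h2 : ∀ s, syndrome E h s t = 𝒜.vac := fun s => by
    rw [syndrome_eq fun w hw => hE _ hw rfl, h1, hc s]
  have h0 : ∀ r, appliedRule 𝒜 E h 0 t r = none := fun r => by
    rw [appliedRule_zero, if_neg (not_not.2 (h2 r))]
  refine ⟨fun s => ?_, fun x S hS hr => ?_⟩
  · by_contra hs
    rcases (outcome_of_no_higher hm ht hk s).ne_vac hm hs with ⟨r', v, hv, -⟩ | ⟨hv, -⟩ | ⟨⟨v, hv⟩, -⟩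
    · rw [h0] at hv
      exact absurd hv (by simp)
    · rw [h1] at hv
      exact hv (hc s)
    · rw [h0] at hv
      exact absurd hv (by simp)
  · have h3 := rangeIn_quiet_noise hm (t := t) (fun e c he => hE _ he rfl) hr
    refine rangeIn_evolve_succ (j := 2 * t + 1) ?_
    rw [preState_odd]
    refine ruleStep_rangeIn hm hS (fun r v hv => ?_) hk h3
    rw [h0] at hv
    exact absurd hv (by simp)

lemma clean_noise {t : ℕ} (ht : evolve 𝒜 𝒱 E h (2 * t + 1) ≠ 0)
    (hE : ∀ e c, Err.charge e t c ∉ E) (hc : Clean 𝒜 h (2 * t)) : Clean 𝒜 h (2 * t + 1) := by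
  intro s
  rw [charge_of_quiet_noise hm ht hE, hc s]

/-- A time step in which level-`0` rules are applied on the basis of true reports. -/
lemma active_step {t : ℕ} (ht : evolve 𝒜 𝒱 E h (2 * (t + 1)) ≠ 0)
    (hE : ∀ r w, Err.meas r t w ∉ E) (hk : ∀ k r, 0 < k → appliedRule 𝒜 E h k t r = none)
    {x y : ZMod P.L} (hS : Supported 𝒜 h x y (2 * t + 1)) (hN : NotSingle 𝒜 h (2 * t + 1))
    (hr : RangeIn (evolve 𝒜 𝒱 E h (2 * t + 1)) (neutralSpace 𝒜 P (P.slotAt x 0) (windingSet P y))) :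
    (∀ s, h (2 * (t + 1)) s ≠ 𝒜.vac → Reached P (fun s => h (2 * t + 1) s ≠ 𝒜.vac) s) ∧
      NotSingle 𝒜 h (2 * (t + 1)) ∧
      RangeIn (evolve 𝒜 𝒱 E h (2 * (t + 1)))
        (neutralSpace 𝒜 P (P.slotAt x 0) (windingSet P y)) := by
  have hs : (fun s => syndrome E h s t) = h (2 * t + 1) := funext fun s => syndrome_eq (hE s)
  have h0 : ∀ r, appliedRule 𝒜 E h 0 t r = if h (2 * t + 1) r ≠ 𝒜.vac then
      moveOf P (fun s => h (2 * t + 1) s ≠ 𝒜.vac) r else none := fun r => by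
    rw [appliedRule_zero, ← hs]
  have h1 : ∀ r v, appliedRule 𝒜 E h 0 t r = some v → h (2 * t + 1) r ≠ 𝒜.vac ∧
      moveOf P (fun s => h (2 * t + 1) s ≠ 𝒜.vac) r = some v := by
    intro r v hv
    rw [h0] at hv
    split_ifs at hv with hh
    exact ⟨hh, hv⟩
  have hpre : RangeIn (preState 𝒱 E h (2 * t + 1))
      (neutralSpace 𝒜 P (P.slotAt x 0) (windingSet P y)) := by
    rw [preState_odd]
    refine ruleStep_rangeIn hm (windingSet_eq y) (fun r v hv => ?_) hk hr
    obtain ⟨h2, h3⟩ := h1 r v hv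
    obtain ⟨r', hne, hr'⟩ := hN r h2
    -- Since a second charge is present, the target of the displacement lies in the block too, and
    -- the edge is compatible.
    exact compatible_edgeAt (appliedRule_mem_units hv) (hS r h2)
      (square_of_reached hS h2 hr' hne.symm ⟨r, h2, Or.inr ⟨v, h3, rfl⟩⟩)
  refine ⟨fun s hs' => ?_, fun s hs' => not_single_charge hm hpre ht hs', rangeIn_evolve_succ hpre⟩
  rcases (outcome_of_no_higher hm ht hk s).ne_vac hm hs' with ⟨r', v, hv, he⟩ | ⟨hv, hn⟩ | ⟨-, hq⟩
  · exact ⟨r', (h1 r' v hv).1, Or.inr ⟨v, (h1 r' v hv).2, he⟩⟩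
  · rw [h0, if_pos hv] at hn
    exact ⟨s, hv, Or.inl ⟨hn, rfl⟩⟩
  · rw [ruleCharge_zero] at hq
    exact absurd (congrFun hs s) hq

end Modular

section Course

variable (hm : 𝒜.IsModular) (hthr : 3 < cThr 𝒜 P) {t₀ : ℕ} (hE : ∀ e ∈ E, e.step = t₀)
include hm hthr hE

omit hm hthr [Fintype A] in
lemma not_charge {t : ℕ} (ht : t ≠ t₀) (e : P.Edge) (c : A) : Err.charge e t c ∉ E :=
  fun he => ht (hE _ he)

omit hm hthr [Fintype A] in
lemma not_meas {t : ℕ} (ht : t ≠ t₀) (r : P.Site) (w : A → A) : Err.meas r t w ∉ E :=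
  fun he => ht (hE _ he)

/-- Nothing happens before the time step of the errors. -/
lemma before (t : ℕ) (ht : t ≤ t₀) (hne : evolve 𝒜 𝒱 E h (2 * t) ≠ 0) :
    Clean 𝒜 h (2 * t) ∧ (∀ s, ∀ t' < t, syndrome E h s t' = 𝒜.vac) ∧
      ∀ (x : ZMod P.L) (S : Finset P.Slot), S = ∅ ∨ S = P.rowZero →
        RangeIn (evolve 𝒜 𝒱 E h (2 * t)) (neutralSpace 𝒜 P (P.slotAt x 0) S) := by
  induction t with
  | zero =>
    refine ⟨fun s => initial_vac hne s, fun s t' ht' => absurd ht' (by omega), fun x S _ => ?_⟩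
    exact rangeIn_evolve_zero hm _ S
  | succ t ih =>
    have hne1 : evolve 𝒜 𝒱 E h (2 * t + 1) ≠ 0 := evolve_ne_zero_of_succ hne
    obtain ⟨h1, h2, h3⟩ := ih (by omega) (evolve_ne_zero_of_succ hne1)
    have hc := clean_noise hm hne1 (not_charge hE (by omega)) h1
    have hs : ∀ s, ∀ t' < t + 1, syndrome E h s t' = 𝒜.vac := by
      intro s t' ht'
      rcases Nat.lt_succ_iff_lt_or_eq.1 ht' with hlt | rfl
      · exact h2 s t' hlt
      · rw [syndrome_eq (not_meas hE (by omega) s), hc s]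
    have hk : ∀ k r, 0 < k → appliedRule 𝒜 E h k t r = none := fun k r hk =>
      appliedRule_eq_none hthr (t₀ := t₀) (fun s t' ht' hh => absurd (hs s t' (by omega)) hh) hk r
    obtain ⟨h4, h5⟩ := quiet_step hm hne (fun e he => by have := hE e he; omega) hk h1
    exact ⟨h4, hs, fun x S hS => h5 x S hS (h3 x S hS)⟩

/-- If the charges at time `τ + 1/2` lie in a block and all errors belong to earlier steps, or to the
noise of this step, the charges stay in the block, and are gone two time steps later. -/
lemma course {τ : ℕ} (h₁ : t₀ ≤ τ) (h₂ : τ ≤ t₀ + 1) (hmeas : ∀ r w, Err.meas r τ w ∉ E)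
    (hR : ReportsIn 𝒜 E h t₀ τ) {x y : ZMod P.L} (hS : Supported 𝒜 h x y (2 * τ + 1))
    (hN : evolve 𝒜 𝒱 E h (2 * τ + 1) ≠ 0 → NotSingle 𝒜 h (2 * τ + 1))
    (hr : RangeIn (evolve 𝒜 𝒱 E h (2 * τ + 1))
      (neutralSpace 𝒜 P (P.slotAt x 0) (windingSet P y)))
    {j : ℕ} (hj : 2 * τ + 1 ≤ j) (hne : evolve 𝒜 𝒱 E h j ≠ 0) :
    Supported 𝒜 h x y j ∧ (2 * (τ + 2) ≤ j → Clean 𝒜 h j) := by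
  have hle : ∀ i, i ≤ j → evolve 𝒜 𝒱 E h i ≠ 0 := fun i hi => evolve_ne_zero_of_le hi hne
  rcases Nat.eq_or_lt_of_le hj with rfl | hj2
  · exact ⟨hS, fun hh => by omega⟩
  have hN := hN (hle _ hj)
  have hk : ∀ k r, 0 < k → appliedRule 𝒜 E h k τ r = none := fun k r hk =>
    appliedRule_eq_none hthr hR hk r
  -- The first application keeps the charges in the block and the state neutral, so there remain
  -- either no charges or at least two.
  obtain ⟨a1, a2, a3⟩ := active_step hm (hle (2 * (τ + 1)) (by omega)) hmeas hk hS hN hr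
  have hS2 : Supported 𝒜 h x y (2 * (τ + 1)) := by
    intro s hs
    obtain ⟨s₁, hs₁, -⟩ := a1 s hs
    obtain ⟨s₂, hne', hs₂⟩ := hN s₁ hs₁
    exact square_of_reached hS hs₁ hs₂ hne'.symm (a1 s hs)
  rcases Nat.eq_or_lt_of_le hj2 with rfl | hj3
  · exact ⟨hS2, fun hh => by omega⟩
  have e3 := charge_of_quiet_noise hm (hle (2 * (τ + 1) + 1) (by omega))
    (not_charge hE (by omega))
  have hS3 : Supported 𝒜 h x y (2 * (τ + 1) + 1) := by
    unfold Supported; rw [e3]; exact hS2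
  rcases Nat.eq_or_lt_of_le hj3 with rfl | hj4
  · exact ⟨hS3, fun hh => by omega⟩
  have hN3 : NotSingle 𝒜 h (2 * (τ + 1) + 1) := by unfold NotSingle; rw [e3]; exact a2
  have hR1 : ReportsIn 𝒜 E h t₀ (τ + 1) := by
    intro s t' ht' hs
    rcases Nat.lt_succ_iff_lt_or_eq.1 (Nat.lt_succ_of_le ht') with hlt | rfl
    · exact hR s t' (by omega) hs
    · omega
  obtain ⟨b1, b2, -⟩ := active_step hm (hle (2 * (τ + 1 + 1)) (by omega))
    (not_meas hE (by omega)) (fun k r hk => appliedRule_eq_none hthr hR1 hk r) hS3 hN3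
    (rangeIn_quiet_noise hm (not_charge hE (by omega)) a3)
  -- A charge left after the second application has a partner at another site. At both earlier times
  -- there were at least two charges, so `reached_unique` places the two at the same site, a
  -- contradiction.
  have hC : Clean 𝒜 h (2 * (τ + 2)) := by
    intro s
    by_contra hs
    obtain ⟨s', hss, hs'⟩ := b2 s hs
    obtain ⟨u, hu, -⟩ := b1 s hs
    obtain ⟨u', hne1, hu'⟩ := hN3 u hu
    have hB : ∀ s, h (2 * (τ + 1) + 1) s ≠ 𝒜.vac →
        Reached P (fun s => h (2 * τ + 1) s ≠ 𝒜.vac) s := by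
      rw [e3]; exact a1
    obtain ⟨w, hw, -⟩ := hB u hu
    obtain ⟨w', hne2, hw'⟩ := hN w hw
    exact hss (reached_unique hS hw hw' hne2.symm hB hu hu' hne1.symm (b1 s' hs') (b1 s hs))
  -- The record of reports has to be carried along, because rules of higher level act on the reports
  -- of past time steps.
  have hlate : ∀ t, τ + 2 ≤ t → 2 * t ≤ j → Clean 𝒜 h (2 * t) ∧
      ∀ s, ∀ t' < t, syndrome E h s t' ≠ 𝒜.vac → t₀ ≤ t' ∧ t' ≤ t₀ + 2 := by
    intro t ht
    induction t, ht using Nat.le_induction with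
    | base => exact fun _ => ⟨hC, fun s t' ht' hs => hR1 s t' (by omega) hs⟩
    | succ t ht ih =>
      intro hj
      obtain ⟨c1, c2⟩ := ih (by omega)
      have hc := clean_noise hm (hle (2 * t + 1) (by omega)) (not_charge hE (by omega)) c1
      have hs : ∀ s, ∀ t' < t + 1, syndrome E h s t' ≠ 𝒜.vac → t₀ ≤ t' ∧ t' ≤ t₀ + 2 := by
        intro s t' ht' hs
        rcases Nat.lt_succ_iff_lt_or_eq.1 ht' with hlt | rfl
        · exact c2 s t' hlt hs
        · rw [syndrome_eq (not_meas hE (by omega) s)] at hs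
          exact absurd (hc s) hs
      exact ⟨(quiet_step hm (hle _ hj) (fun e he => by have := hE e he; omega)
        (fun k r hk => appliedRule_eq_none hthr (fun s t' ht' => hs s t' (by omega)) hk r) c1).1, hs⟩
  have hCj : Clean 𝒜 h j := by
    rcases Nat.even_or_odd' j with ⟨t, rfl | rfl⟩
    · exact (hlate t (by omega) le_rfl).1
    · exact clean_noise hm hne (not_charge hE (by omega)) (hlate t (by omega) (by omega)).1
  exact ⟨hCj.supported x y, fun _ => hCj⟩

lemma clean_of_le {j : ℕ} (hj : j ≤ 2 * t₀) (hne : evolve 𝒜 𝒱 E h j ≠ 0) : Clean 𝒜 h j := by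
  rcases Nat.even_or_odd' j with ⟨t, rfl | rfl⟩
  · exact (before hm hthr hE t (by omega) hne).1
  · exact clean_noise hm hne (not_charge hE (by omega))
      (before hm hthr hE t (by omega) (evolve_ne_zero_of_succ hne)).1

/-- The noise changes charges only at endpoints of the erroneous edges, all in the block, and
preserves the neutral subspace. The reports of the same time step are already true, so `course`
starts with `τ = t₀`. -/
lemma charge_course (hch : ∀ e ∈ E, e.IsCharge) {x y : ZMod P.L}
    (hsq : ∀ e ∈ E, ∀ s ∈ e.sites, Square P x y s) {j : ℕ} (hne : evolve 𝒜 𝒱 E h j ≠ 0) :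
    Supported 𝒜 h x y j ∧ (2 * (t₀ + 2) ≤ j → Clean 𝒜 h j) := by
  rcases Nat.lt_or_ge (2 * t₀) j with hj | hj
  · have hne1 : evolve 𝒜 𝒱 E h (2 * t₀ + 1) ≠ 0 := evolve_ne_zero_of_le hj hne
    obtain ⟨h1, h2, h3⟩ := before hm hthr hE t₀ le_rfl (evolve_ne_zero_of_succ hne1)
    have hS : Supported 𝒜 h x y (2 * t₀ + 1) := by
      intro s hs
      by_contra hns
      refine hs ?_
      rw [charge_of_noise hm hne1 fun e c he hmem => hns (hsq _ he s hmem), h1 s]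
    have hpre : RangeIn (preState 𝒱 E h (2 * t₀))
        (neutralSpace 𝒜 P (P.slotAt x 0) (windingSet P y)) := by
      rw [preState_even]
      refine noiseStep_rangeIn hm _ (fun e c he => ?_) (h3 x _ (windingSet_eq y))
      exact compatible_of_square (hsq _ he _ (by simp [Err.sites])) (hsq _ he _ (by simp [Err.sites]))
    refine course hm hthr hE le_rfl (by omega) (fun r w hw => hch _ hw) ?_ hS
      (fun _ s hs => not_single_charge hm hpre hne1 hs) (rangeIn_evolve_succ hpre) hj hne
    intro s t' ht' hs
    rcases Nat.lt_or_ge t' t₀ with hlt | hge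
    · exact absurd (h2 s t' hlt) hs
    · omega
  · have := clean_of_le hm hthr hE hj hne
    exact ⟨this.supported x y, fun _ => this⟩

end Course

end Correction

end AnyonDecoder

/-! ### Measurement errors, and assembly of the theorem -/

namespace AnyonDecoder

open scoped Matrix ComplexConjugate

section Main

open scoped Classical

variable {A : Type*} [Fintype A] {𝒜 : AnyonData A} {P : Params}

lemma exists_square_of_unit (s : P.Site) {v : ℤ × ℤ} (hv : v ∈ units) :
    ∃ x y, Square P x y s ∧ Square P x y (P.shift s 1 v) := by
  simp only [square_iff]
  rcases hv with rfl | rfl | rfl | rfl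
  · exact ⟨s.1, s.2, by simp, by simp [Params.shift]⟩
  · exact ⟨s.1 - 1, s.2, by simp, by simp [Params.shift, sub_eq_add_neg]⟩
  · exact ⟨s.1, s.2, by simp, by simp [Params.shift]⟩
  · exact ⟨s.1, s.2 - 1, by simp, by simp [Params.shift, sub_eq_add_neg]⟩

/-- Nontrivial reports in a block move charges only inside some block. -/
lemma exists_square_of_reached {B : P.Site → Prop} {x y : ZMod P.L}
    (hB : ∀ s, B s → Square P x y s) {s₀ : P.Site} (h₀ : B s₀) :
    ∃ x' y', (∀ s, B s → Square P x' y' s) ∧ ∀ s, Reached P B s → Square P x' y' s := by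
  by_cases hs : ∃ s, B s ∧ s ≠ s₀
  · obtain ⟨s, hs, hne⟩ := hs
    exact ⟨x, y, hB, fun s' => square_of_reached hB hs h₀ hne⟩
  -- A lone wrong report may point out of the given block, which is then replaced by one that
  -- contains both the source and the target of the displacement.
  · have hu : ∀ s, B s → s = s₀ := fun s hs' => by
      by_contra hne
      exact hs ⟨s, hs', hne⟩
    cases hv : moveOf P B s₀ with
    | none =>
      refine ⟨x, y, hB, ?_⟩
      rintro s' ⟨s, hs, ⟨-, rfl⟩ | ⟨v, hv', -⟩⟩
      · exact hB s hs
      · rw [hu s hs, hv] at hv'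
        exact absurd hv' (by simp)
    | some v =>
      obtain ⟨x', y', h1, h2⟩ := exists_square_of_unit s₀ (rule_mem_units hv)
      refine ⟨x', y', fun s hs => by rwa [hu s hs], ?_⟩
      rintro s' ⟨s, hs, ⟨hv', -⟩ | ⟨v', hv', rfl⟩⟩
      · rw [hu s hs, hv] at hv'
        exact absurd hv' (by simp)
      · rw [hu s hs, hv, Option.some_inj] at hv'
        rw [hu s hs, ← hv']
        exact h2

variable {E : Set (Err A P)} {h : History A P} {𝒱 : Env A P}

section Measurement

variable (hm : 𝒜.IsModular) (hthr : 3 < cThr 𝒜 P) {t₀ : ℕ} (hE : ∀ e ∈ E, e.step = t₀)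
include hm hthr hE

/-- The wrong reports are made in the vacuum, so the rules act by creating pairs, whose members lie
in the block by `hB` and `hB'` and leave the state neutral. From the next time step on all reports
are true and `course` applies with `τ = t₀ + 1`. -/
lemma meas_course (hch : ∀ e ∈ E, ¬ e.IsCharge)
    (hne : ∀ r w, Err.meas r t₀ w ∈ E → w 𝒜.vac ≠ 𝒜.vac) {x y : ZMod P.L}
    (hB : ∀ s w, Err.meas s t₀ w ∈ E → Square P x y s)
    (hB' : ∀ s, Reached P (fun s => ∃ w, Err.meas s t₀ w ∈ E) s → Square P x y s) {j : ℕ}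
    (hj : evolve 𝒜 𝒱 E h j ≠ 0) :
    Supported 𝒜 h x y j ∧ (2 * (t₀ + 3) ≤ j → Clean 𝒜 h j) := by
  have hle : ∀ i, i ≤ j → evolve 𝒜 𝒱 E h i ≠ 0 := fun i hi => evolve_ne_zero_of_le hi hj
  have hnc : ∀ e c t, Err.charge e t c ∉ E := fun e c t he => hch _ he trivial
  rcases Nat.lt_or_ge (2 * t₀) j with hj0 | hj0
  swap
  · have := clean_of_le hm hthr hE hj0 hj
    exact ⟨this.supported x y, fun _ => this⟩
  obtain ⟨h1, h2, h3⟩ := before hm hthr hE t₀ le_rfl (hle _ (by omega))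
  have hC := clean_noise hm (hle (2 * t₀ + 1) (by omega)) (fun e c => hnc e c t₀) h1
  rcases Nat.eq_or_lt_of_le hj0 with rfl | hj1
  · exact ⟨hC.supported x y, fun _ => hC⟩
  have hs : (fun s => syndrome E h s t₀ ≠ 𝒜.vac) = fun s => ∃ w, Err.meas s t₀ w ∈ E := by
    ext s
    by_cases hw : ∃ w, Err.meas s t₀ w ∈ E
    · refine iff_of_true ?_ hw
      unfold syndrome
      rw [dif_pos hw, hC s]
      exact hne s _ hw.choose_spec
    · refine iff_of_false (not_not.2 ?_) hw
      rw [syndrome_eq fun w hw' => hw ⟨w, hw'⟩, hC s]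
  have hmv : ∀ r v, appliedRule 𝒜 E h 0 t₀ r = some v → (∃ w, Err.meas r t₀ w ∈ E) ∧
      moveOf P (fun s => ∃ w, Err.meas s t₀ w ∈ E) r = some v := by
    intro r v hv
    rw [appliedRule_zero, hs] at hv
    split_ifs at hv with hh
    exact ⟨(congrFun hs r).mp hh, hv⟩
  have hR : ∀ t, t₀ ≤ t → t ≤ t₀ + 2 → ReportsIn 𝒜 E h t₀ t := by
    intro t _ ht s t' ht' hs'
    rcases Nat.lt_or_ge t' t₀ with hlt | hge
    · exact absurd (h2 s t' hlt) hs'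
    · omega
  have hk : ∀ k r, 0 < k → appliedRule 𝒜 E h k t₀ r = none := fun k r hk =>
    appliedRule_eq_none hthr (hR t₀ le_rfl (by omega)) hk r
  have hpre : RangeIn (preState 𝒱 E h (2 * t₀ + 1))
      (neutralSpace 𝒜 P (P.slotAt x 0) (windingSet P y)) := by
    rw [preState_odd]
    refine ruleStep_rangeIn hm (windingSet_eq y) (fun r v hv => ?_) hk
      (rangeIn_quiet_noise hm (fun e c => hnc e c t₀) (h3 x _ (windingSet_eq y)))
    obtain ⟨⟨w, hw⟩, hv'⟩ := hmv r v hv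
    exact compatible_edgeAt (appliedRule_mem_units hv) (hB r w hw)
      (hB' _ ⟨r, ⟨w, hw⟩, Or.inr ⟨v, hv', rfl⟩⟩)
  have hne2 := hle (2 * (t₀ + 1)) (by omega)
  have hS : Supported 𝒜 h x y (2 * (t₀ + 1)) := by
    intro s hs'
    rcases (outcome_of_no_higher hm hne2 hk s).ne_vac hm hs' with ⟨r', v, hv, he⟩ | ⟨hv, -⟩ | ⟨⟨v, hv⟩, -⟩
    · exact hB' s ⟨r', (hmv r' v hv).1, Or.inr ⟨v, (hmv r' v hv).2, he⟩⟩
    · exact absurd (hC s) hv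
    · obtain ⟨w, hw⟩ := (hmv s v hv).1
      exact hB s w hw
  rcases Nat.eq_or_lt_of_le hj1 with rfl | hj2
  · exact ⟨hS, fun hh => by omega⟩
  have e3 := charge_of_quiet_noise hm (hle (2 * (t₀ + 1) + 1) (by omega))
    (fun e c => hnc e c (t₀ + 1))
  have hN : NotSingle 𝒜 h (2 * (t₀ + 1)) := fun s hs' => not_single_charge hm hpre hne2 hs'
  have hr2 : RangeIn (evolve 𝒜 𝒱 E h (2 * (t₀ + 1)))
      (neutralSpace 𝒜 P (P.slotAt x 0) (windingSet P y)) := rangeIn_evolve_succ hpre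
  exact course hm hthr hE (τ := t₀ + 1) (by omega) le_rfl (not_meas hE (by omega))
    (hR _ (by omega) (by omega)) (by unfold Supported; rw [e3]; exact hS)
    (fun _ => by unfold NotSingle; rw [e3]; exact hN)
    (rangeIn_quiet_noise hm (fun e c => hnc e c _) hr2) hj2 hj

end Measurement

/-- A single level-`0` actual error is corrected within a block. -/
lemma exists_block (hm : 𝒜.IsModular) (hthr : 3 < cThr 𝒜 P) {ℰ : Set (Err A P)}
    (hℰ : IsErrorSet 𝒜 ℰ) (hE : IsActual ℰ 0 E) :
    ∃ x y, (∀ e ∈ E, ∀ s ∈ e.sites, Square P x y s) ∧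
      ∀ (𝒱 : Env A P) (h : History A P) (j : ℕ), evolve 𝒜 𝒱 E h j ≠ 0 →
        Supported 𝒜 h x y j ∧ ∀ e ∈ E, (e.IsCharge → 2 * (e.step + 2) ≤ j → Clean 𝒜 h j) ∧
          (¬ e.IsCharge → 2 * (e.step + 3) ≤ j → Clean 𝒜 h j) := by
  obtain ⟨t₀, x, y, ⟨e₀, he₀⟩, hsub, hstep, hk, hsq⟩ := candidateZero_spec hE.1
  rcases hk with hk | hk
  · refine ⟨x, y, hsq, fun 𝒱 h j hj => ?_⟩
    obtain ⟨h1, h2⟩ := charge_course hm hthr hstep hk hsq hj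
    refine ⟨h1, fun e he => ⟨fun _ => ?_, fun hh => absurd (hk e he) hh⟩⟩
    rw [hstep e he]
    exact h2
  · have hmeas : ∀ e ∈ E, ∃ r w, e = Err.meas r t₀ w := by
      intro e he
      have h1 := hk e he
      have h2 := hstep e he
      cases e with
      | charge e t c => exact absurd trivial h1
      | meas r t w =>
        simp only [Err.step] at h2
        subst h2
        exact ⟨r, w, rfl⟩
    obtain ⟨r₀, w₀, rfl⟩ := hmeas e₀ he₀
    obtain ⟨x', y', h1, h2⟩ := exists_square_of_reached
      (B := fun s => ∃ w, Err.meas s t₀ w ∈ E) (x := x) (y := y)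
      (fun s ⟨w, hw⟩ => hsq _ hw s rfl) ⟨w₀, he₀⟩
    refine ⟨x', y', fun e he s hs => ?_, fun 𝒱 h j hj => ?_⟩
    · obtain ⟨r, w, rfl⟩ := hmeas e he
      obtain rfl : s = r := hs
      exact h1 s ⟨w, he⟩
    · obtain ⟨h3, h4⟩ := meas_course hm hthr hstep hk
        (fun r w hw => hℰ.meas_ne r t₀ w (hsub hw) _) (fun s w hw => h1 s ⟨w, hw⟩) h2 hj
      refine ⟨h3, fun e he => ⟨fun hh => absurd hh (hk e he), fun _ => ?_⟩⟩
      rw [hstep e he]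
      exact h4

lemma mem_block_zero {x y : ZMod P.L} {s : P.Site} (hs : Square P x y s) :
    s ∈ P.block 0 (x, y) := by
  obtain ⟨p, hp, rfl⟩ := hs
  refine ⟨p.1, p.2, corners_fst hp, corners_snd hp, ?_⟩
  rw [sameColony_zero]
  simp [siteAt, Params.shift]

theorem zeroCorrected (hm : 𝒜.IsModular) (hthr : 3 < cThr 𝒜 P) : ZeroCorrected 𝒜 P := by
  intro 𝒱 ℰ hℰ E hE
  obtain ⟨x, y, -, h⟩ := exists_block hm hthr hℰ hE
  refine ⟨(x, y), fun h' j hp => ?_⟩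
  obtain ⟨h1, h2⟩ := h 𝒱 h' j hp.evolve_ne_zero
  exact ⟨fun s hs => mem_block_zero (h1 s hs), fun e he => h2 e he⟩

omit [Fintype A] in
lemma subset_noise {ℰ : Set (Err A P)} (hE : IsActual ℰ 0 E) (k : ℕ) : E ⊆ (levels P ℰ k).2.2 := by
  induction k with
  | zero => exact Set.subset_sUnion_of_mem hE
  | succ k ih => exact ih.trans Set.subset_union_right

omit [Fintype A] in
/-- A level-`0` actual error is not an actual error of a higher level. -/
lemma level_eq_zero {ℰ : Set (Err A P)} (hE : IsActual ℰ 0 E) {k : ℕ} (hk : IsActual ℰ k E) :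
    k = 0 := by
  cases k with
  | zero => rfl
  | succ k =>
    obtain ⟨⟨e, he⟩, hsub, -⟩ := hk.1
    exact absurd (subset_noise hE k he) (hsub he).2

/-- No error has lower level, so the restricted cluster is the error alone, and a removal that
leaves a member removes nothing. Every later location carries a nontrivial charge and thus lies in
the block, whichever levels of rules a trajectory may follow. -/
theorem kLocal_zero (hm : 𝒜.IsModular) (hthr : 3 < cThr 𝒜 P) : KLocal 𝒜 P 0 := by
  intro 𝒱 ℰ hℰ t k' E hk hE
  obtain rfl : k' = 0 := by omega
  obtain ⟨x, y, hsites, hc⟩ := exists_block hm hthr hℰ hE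
  have hres : restricted ℰ E = {E} := by
    refine Set.Subset.antisymm ?_ Set.subset_union_right
    rintro E' (⟨k', k, -, hk, hlt⟩ | hE')
    · have := level_eq_zero hE hk
      omega
    · exact hE'
  have hcl : cluster 𝒜 𝒱 {E} E t ⊆ {E} := by
    refine Set.iUnion_subset fun i => ?_
    cases i with
    | zero => exact subset_rfl
    | succ i => exact fun E' hE' => hE'.1
  rw [hres]
  refine ⟨(x, y), ?_⟩
  rintro ⟨s, t'⟩ ⟨ht', 𝒟, -, h, hp, E', ⟨hE', hD⟩, e, he, hloc⟩
  obtain rfl : E' = E := hcl hE'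
  have hU : ⋃₀ ({E'} \ 𝒟) = E' := by
    have : ({E'} \ 𝒟 : Set (Set (Err A P))) = {E'} :=
      Set.Subset.antisymm Set.sdiff_subset fun F hF => by
        obtain rfl : F = E' := hF
        exact ⟨rfl, hD⟩
    rw [this, Set.sUnion_singleton]
  rw [hU] at hp
  have key : ∀ t'' s', t'' + 1 ≤ t → h (2 * (t'' + 1)) s' ≠ 𝒜.vac → s' ∈ P.block 0 (x, y) :=
    fun t'' s' hle hs' => mem_block_zero
      ((hc 𝒱 h _ (evolve_ne_zero_of_le (by omega) hp.evolve_ne_zero)).1 s' hs')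
  simp only at hloc ht'
  cases hloc with
  | start r hr => exact mem_block_zero (hsites e he _ hr)
  | stay t r hr hc => exact key _ _ ht' hc
  | moved k t t'' r v hk ht htU hr hv hc => exact key _ _ ht' hc
  | left k t t'' r v hk ht htU hr hv hc => exact key _ _ ht' hc

end Main

end AnyonDecoder

theorem mainTheorem6 {A : Type*} [Fintype A] (𝒜 : AnyonDecoder.AnyonData A)
    (hmod : 𝒜.IsModular) (hcyc : 𝒜.NonCyclic) (P : AnyonDecoder.Params)
    (hb : 2 * (4 * (3 * 𝒜.diam + 1) * P.Q + 1) < P.b) :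
    AnyonDecoder.KLocal 𝒜 P 0 ∧ AnyonDecoder.KFaithful 𝒜 P 0 ∧
      AnyonDecoder.ZeroSuccessful 𝒜 P ∧ AnyonDecoder.ZeroCorrected 𝒜 P := by
  have hthr := AnyonDecoder.three_lt_cThr hb
  exact ⟨AnyonDecoder.kLocal_zero hmod hthr, AnyonDecoder.kFaithful_zero (by omega),
    AnyonDecoder.zeroSuccessful hmod hcyc, AnyonDecoder.zeroCorrected hmod hthr⟩
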